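/- **Theorem (zero-cost robustness).** Let $\mathcal X$ be a nonempty domain, $k$ a kernel on $\mathcal X$ with $|k|\le\kappa$, $f:\mathcal X\to\mathbb R$ the objective, $\sigma>0$, $0<\delta<1$, and put $\delta'=\delta/2$. In round $t=1,\dots,T$ an algorithm queries $x_t\in\mathcal X$ and observes $y_t=f(x_t)+\epsilon_t+c_t$, where $\epsilon_t$ is noise and $c_t$ a corruption. Write $T_c=|\{t\le T:c_t\ne0\}|$, $R_T=\sum_{t=1}^T(\max f-f(x_t))$, $\boldsymbol k_t(x)=(k(x,x_i))_{i\le t}$, $K_t=(k(x_i,x_j))_{i,j\le t}$, and $\gamma_T=\sup_{z_1,\dots,z_T\in\mathcal X}\frac12\log\det\big(I+\sigma^{-2}(k(z_i,z_j))_{i,j}\big)$. Let $\mu_{uc,t},\sigma_{uc,t}$ be the posterior mean and standard deviation of the Gaussian process (GP) with prior $\mathcal{GP}(0,k)$ and noise variance $\sigma^2$, conditioned on the uncorrupted data of rounds $1,\dots,t$. One of the following settings is assumed. 1. $\mathcal X$ is finite, $f$ is a sample from $\mathcal{GP}(0,k)$, and the $\epsilon_t\sim\mathcal N(0,\sigma^2)$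 are i.i.d. and independent of $f$. Put $N_T=\sigma\sqrt{2\log(T/\delta')}$ and $\beta'_t=2\log\big(|\mathcal X|t^2\pi^2/(6\delta')\big)$. 2. $\mathcal X\subset[0,r]^d$ is compact and convex, $k$ is continuous, $f$ is a sample from $\mathcal{GP}(0,k)$ with almost surely differentiable paths such that $\mathbb P(\sup_{\mathcal X}|\partial f/\partial x_j|>\ell)\le a e^{-(\ell/b)^2}$ for all $j$ and $\ell>0$, where $a,b>0$ are chosen large enough that $d\,b\,r\sqrt{\log(4da/\delta')}\ge1$ (in particular $4da\ge\delta'$); the noise and $N_T$ are as in 1. Put $\beta'_t=2\log\big(2\pi^2t^2/(3\delta')\big)+2d\log\big(t^2dbr\sqrt{\log(4da/\delta')}\big)$. 3. $\mathcal X$ is a compact metrizable space (e.g. a compact subset of $\mathbb R^d$), $k$ is continuous, $f$ lies in the reproducing kernel Hilbert space of $k$ with $\|f\|_k^2\le B_f$, and the noise satisfies $\mathbb E[\epsilon_t\mid\text{history}]=0$ and $|\epsilon_t|\le\sigma$ almost surely. Put $N_T=\sigma$ and $\beta'_t=2B_f+300\,\gamma_t\log^3(t/\delta')$. Let $B$ be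 a bound on the realized objective, $|f(x)|\le B$ for all $x\in\mathcal X$ (so $B$ may depend on the sample $f$ in settings 1 and 2). For a shape parameter $c>0$, a center $g$ and a half-width $L$, let $w_{L,g}(x,y)=\frac{\sigma}{\sqrt2}$ if $|y-g(x)|\le L(x)$ and $w_{L,g}(x,y)=\frac{\sigma}{\sqrt2}\big(1+(|y-g(x)|-L(x))^2/c^2\big)^{-1/2}$ otherwise. With weights $w_i$ for the observations, the robust conjugate GP (RCGP) posterior is $$\mu^R_t(x)=\boldsymbol k_t(x)^\top(K_t+\sigma^2J_w)^{-1}(\boldsymbol y_t-\boldsymbol m_w),\qquad \sigma^R_t(x)^2=k(x,x)-\boldsymbol k_t(x)^\top(K_t+\sigma^2J_w)^{-1}\boldsymbol k_t(x),$$ with $J_w=\mathrm{diag}(\sigma^2/(2w_i^2))$ and $\boldsymbol m_w=(\sigma^2\partial_y\log w_i^2)_i$. A model has the robust multiplier $\sqrt{\beta_t}=\sqrt{\beta'_t}+C_w\sqrt{T_c}$, where $C_w=\frac{\sqrt2}{\sigma^2}\sup_{x,y}|w(x,y)(y-m_w(x,y)-\mu_{uc}(x))|$, with the weight function $w$ and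 the posterior mean $\mu_{uc}$ of round $t-1$. * FC-RCGP-UCB uses one model, with $g=0$ and $L=B+N_T$, and queries $x_t\in\arg\max_x\mu^R_{t-1}(x)+\sqrt{\beta_t}\,\sigma_{uc,t-1}(x)$. * A2-RCGP-UCB maintains the same model as an anchor, with posterior mean $\mu_{A,t}$ and multiplier $\sqrt{\beta_{A,t}}$, and an adaptive model whose weight for round $t$ has center $\mu_{A,t-1}$ and half-width either $\sqrt{\beta_{A,T}}\sqrt\kappa+N_T$ or $\sqrt{\beta_{A,t}}\,\sigma'_{t-1}(x)+N_T$, where $\sigma'_n$ is the GP posterior standard deviation given an arbitrary subset of the uncorrupted data of rounds $1,\dots,n$ from which $\lceil\rho n\rceil$ points were removed ($0<\rho<1$ fixed). It queries a maximizer of the same acquisition function, formed with the posterior mean and the multiplier of the adaptive model. Ties in $\arg\max$ are broken by a fixed measurable rule. Suppose that $T_c=0$. Then there is a constant $C$ that does not depend on $T$ (in settings 1 and 3 it depends only on $\kappa$ and $\sigma$; in setting 2 only on $\mathcal X,k,\kappa,\sigma,\delta,a,b,r$) such that for every $T\ge1$, for each of the two algorithms, with probability at least $1-\delta$, $$R_T\le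 C\sqrt{T\,\beta'_T\,\gamma_T},$$ and on the same event, for each model of the algorithm, every observation satisfies the plateau condition $|y_t-g(x_t)|\le L(x_t)$, the RCGP posterior means and variances after $0,1,\dots,T$ rounds are those of the standard GP, and the robust multiplier $\sqrt{\beta_t}$ equals $\sqrt{\beta'_t}$. -/

import Mathlib

open MeasureTheory ProbabilityTheory

namespace RCGP

noncomputable section

/-! ### Gaussian process regression

Data are two sequences `x`, `y` indexed by the rounds `1, 2, …`; a posterior conditions on the data
of a finite set `S` of rounds. -/

section Posterior

variable {X : Type*}

/-- Gram matrix of the queries of the rounds in `S`. -/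
def gram (k : X → X → ℝ) (x : ℕ → X) (S : Finset ℕ) : Matrix S S ℝ :=
  Matrix.of fun i j => k (x i) (x j)

/-- Vector of covariances between `z` and the queries of the rounds in `S`. -/
def kvec (k : X → X → ℝ) (x : ℕ → X) (S : Finset ℕ) (z : X) : S → ℝ :=
  fun i => k z (x i)

/-- Standard GP posterior mean (zero prior mean). -/
def gpMean (k : X → X → ℝ) (σ : ℝ) (x : ℕ → X) (y : ℕ → ℝ) (S : Finset ℕ) (z : X) : ℝ :=
  kvec k x S z ⬝ᵥ
    Matrix.mulVec (gram k x S + σ ^ 2 • (1 : Matrix S S ℝ))⁻¹ (fun i : S => y i)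

/-- Standard GP posterior variance. -/
def gpVar (k : X → X → ℝ) (σ : ℝ) (x : ℕ → X) (S : Finset ℕ) (z : X) : ℝ :=
  k z z - kvec k x S z ⬝ᵥ
    Matrix.mulVec (gram k x S + σ ^ 2 • (1 : Matrix S S ℝ))⁻¹ (kvec k x S z)

/-- Standard GP posterior standard deviation. -/
def gpSd (k : X → X → ℝ) (σ : ℝ) (x : ℕ → X) (S : Finset ℕ) (z : X) : ℝ :=
  √(gpVar k σ x S z)

/-- The plateau inverse multi-quadric weight of an observation `u` with center `g`,
half-width `L` and shape `c`. -/
def pimq (σ c L g u : ℝ) : ℝ :=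
  if |u - g| ≤ L then σ / √2
  else σ / √2 * (1 + (|u - g| - L) ^ 2 / c ^ 2) ^ (-(1 / 2) : ℝ)

/-- The correction `σ² ∂_y log (w(y)²)`. -/
def corrTerm (σ : ℝ) (w : ℝ → ℝ) (u : ℝ) : ℝ :=
  σ ^ 2 * deriv (fun v => Real.log (w v ^ 2)) u

/-- The diagonal matrix `J_w`; `w i` is the weight function used for the observation of round `i`,
as a function of the observed value. -/
def Jw (σ : ℝ) (w : ℕ → ℝ → ℝ) (y : ℕ → ℝ) (S : Finset ℕ) : Matrix S S ℝ :=
  Matrix.diagonal fun i : S => σ ^ 2 / (2 * w i (y i) ^ 2)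

/-- RCGP posterior mean. -/
def rcgpMean (k : X → X → ℝ) (σ : ℝ) (w : ℕ → ℝ → ℝ) (x : ℕ → X) (y : ℕ → ℝ)
    (S : Finset ℕ) (z : X) : ℝ :=
  kvec k x S z ⬝ᵥ
    Matrix.mulVec (gram k x S + σ ^ 2 • Jw σ w y S)⁻¹
      (fun i : S => y i - corrTerm σ (w i) (y i))

/-- RCGP posterior variance. -/
def rcgpVar (k : X → X → ℝ) (σ : ℝ) (w : ℕ → ℝ → ℝ) (x : ℕ → X) (y : ℕ → ℝ)
    (S : Finset ℕ) (z : X) : ℝ :=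
  k z z - kvec k x S z ⬝ᵥ
    Matrix.mulVec (gram k x S + σ ^ 2 • Jw σ w y S)⁻¹ (kvec k x S z)

/-- Maximum information gain `γ_n` of `n` noisy evaluations (repetitions allowed). -/
def maxInfoGain (k : X → X → ℝ) (σ : ℝ) (n : ℕ) : ℝ :=
  ⨆ z : Fin n → X, (1 / 2 : ℝ) * Real.log
    (1 + (σ ^ 2)⁻¹ • (Matrix.of fun i j => k (z i) (z j)) : Matrix (Fin n) (Fin n) ℝ).det

end Posterior

/-! ### The two algorithms -/

section Algorithms

variable {X : Type*}

/-- Inputs of the algorithms: kernel, kernel bound `κ`, noise level `σ`, shape `c` of the weight,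
bound `B` on the objective (`B = B_f √κ`), noise bound `N = N_T(δ/2)`, GP-UCB parameters
`β t = β'_t(δ/2)`, and horizon `T`. -/
structure Inputs (X : Type*) where
  k : X → X → ℝ
  κ : ℝ
  σ : ℝ
  c : ℝ
  B : ℝ
  N : ℝ
  β : ℕ → ℝ
  T : ℕ

/-- What happens in the rounds `t = 1, 2, …`: queries, observations, and corruptions. -/
structure Trajectory (X : Type*) where
  x : ℕ → X
  y : ℕ → ℝ
  corr : ℕ → ℝ

/-- The trajectory with queries `x` and observations `y_t = f(x_t) + ε_t + c_t`. -/
def observe (f : X → ℝ) (ε corr : ℕ → ℝ) (x : ℕ → X) : Trajectory X where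
  x := x
  y := fun t => f (x t) + ε t + corr t
  corr := corr

open Classical in
/-- The uncorrupted rounds up to round `n`. -/
def uncorrupted (corr : ℕ → ℝ) (n : ℕ) : Finset ℕ :=
  (Finset.Icc 1 n).filter fun t => corr t = 0

open Classical in
/-- The number `T_c` of corrupted rounds among `1, …, T`. -/
def numCorrupt (corr : ℕ → ℝ) (T : ℕ) : ℕ :=
  ((Finset.Icc 1 T).filter fun t => corr t ≠ 0).card

/-- Posterior mean given the uncorrupted data up to round `n`. -/
def ucMean (I : Inputs X) (τ : Trajectory X) (n : ℕ) (z : X) : ℝ :=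
  gpMean I.k I.σ τ.x τ.y (uncorrupted τ.corr n) z

/-- Posterior standard deviation given the uncorrupted data up to round `n`. -/
def ucSd (I : Inputs X) (τ : Trajectory X) (n : ℕ) (z : X) : ℝ :=
  gpSd I.k I.σ τ.x (uncorrupted τ.corr n) z

/-- The deviation constant `C_w = √2 C₁ / σ²` with
`C₁ = sup_{z, u} |w(z,u) (u - m_w(z,u) - μ(z))|`. -/
def devConst (σ : ℝ) (w : X → ℝ → ℝ) (μ : X → ℝ) : ℝ :=
  √2 * (⨆ p : X × ℝ, |w p.1 p.2 * (p.2 - corrTerm σ (w p.1) p.2 - μ p.1)|) / σ ^ 2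

/-- Half-width of the plateau of the fixed-center model. -/
def fixedWidth (I : Inputs X) : ℝ := I.B + I.N

/-- Weight function of the fixed-center model, which is also the anchor model: center `0`. -/
def fixedWeight (I : Inputs X) (u : ℝ) : ℝ := pimq I.σ I.c (fixedWidth I) 0 u

/-- Posterior mean of the fixed-center (anchor) model after round `n`. -/
def fixedMean (I : Inputs X) (τ : Trajectory X) (n : ℕ) (z : X) : ℝ :=
  rcgpMean I.k I.σ (fun _ => fixedWeight I) τ.x τ.y (Finset.Icc 1 n) z

/-- Posterior variance of the fixed-center (anchor) model after round `n`. -/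
def fixedVar (I : Inputs X) (τ : Trajectory X) (n : ℕ) (z : X) : ℝ :=
  rcgpVar I.k I.σ (fun _ => fixedWeight I) τ.x τ.y (Finset.Icc 1 n) z

/-- Robust multiplier `√β_t` of the fixed-center (anchor) model. -/
def fixedMult (I : Inputs X) (τ : Trajectory X) (t : ℕ) : ℝ :=
  √(I.β t) + devConst I.σ (fun _ => fixedWeight I) (ucMean I τ (t - 1)) *
    √(numCorrupt τ.corr I.T)

/-- `τ` is a run of FC-RCGP-UCB; `sel t g` is the maximizer of `g` that is queried in round `t`. -/
def IsFCRun (I : Inputs X) (sel : ℕ → (X → ℝ) → X) (τ : Trajectory X) : Prop :=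
  ∀ t ∈ Finset.Icc 1 I.T, τ.x t =
    sel t fun z => fixedMean I τ (t - 1) z + fixedMult I τ t * ucSd I τ (t - 1) z

/-- Weight function of the adaptive model in round `t`, with half-width `L t z` at `z`: the center
is the anchor posterior mean after round `t - 1`. -/
def adaptWeight (I : Inputs X) (τ : Trajectory X) (L : ℕ → X → ℝ) (t : ℕ) (z : X) (u : ℝ) : ℝ :=
  pimq I.σ I.c (L t z) (fixedMean I τ (t - 1) z) u

/-- Posterior mean of the adaptive model after round `n`. -/
def adaptMean (I : Inputs X) (τ : Trajectory X) (L : ℕ → X → ℝ) (n : ℕ) (z : X) : ℝ :=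
  rcgpMean I.k I.σ (fun i => adaptWeight I τ L i (τ.x i)) τ.x τ.y (Finset.Icc 1 n) z

/-- Posterior variance of the adaptive model after round `n`. -/
def adaptVar (I : Inputs X) (τ : Trajectory X) (L : ℕ → X → ℝ) (n : ℕ) (z : X) : ℝ :=
  rcgpVar I.k I.σ (fun i => adaptWeight I τ L i (τ.x i)) τ.x τ.y (Finset.Icc 1 n) z

/-- Robust multiplier of the adaptive model. -/
def adaptMult (I : Inputs X) (τ : Trajectory X) (L : ℕ → X → ℝ) (t : ℕ) : ℝ :=
  √(I.β t) + devConst I.σ (adaptWeight I τ L (t - 1)) (ucMean I τ (t - 1)) *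
    √(numCorrupt τ.corr I.T)

/-- The plateau half-widths that the adaptive model may use: either the constant
`√β_{A,T} √κ + N`, or `√β_{A,t} σ'_{uc,t-1}(z) + N`, where `σ'_{uc,n}` is the posterior standard
deviation given an arbitrary subset of the uncorrupted data up to round `n` from which `⌈ρ n⌉`
data points were removed. -/
def IsAdaptWidth (I : Inputs X) (τ : Trajectory X) (L : ℕ → X → ℝ) : Prop :=
  (∀ t z, L t z = fixedMult I τ I.T * √I.κ + I.N) ∨
  ∃ (ρ : ℝ) (S : ℕ → Finset ℕ), 0 < ρ ∧ ρ < 1 ∧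
    (∀ n, S n ⊆ uncorrupted τ.corr n ∧ (S n).card = (uncorrupted τ.corr n).card - ⌈ρ * n⌉₊) ∧
    ∀ t z, L t z = fixedMult I τ t * gpSd I.k I.σ τ.x (S (t - 1)) z + I.N

/-- `τ` is a run of A2-RCGP-UCB with plateau half-widths `L` of the adaptive model. -/
def IsA2Run (I : Inputs X) (sel : ℕ → (X → ℝ) → X) (L : ℕ → X → ℝ) (τ : Trajectory X) : Prop :=
  IsAdaptWidth I τ L ∧ ∀ t ∈ Finset.Icc 1 I.T, τ.x t =
    sel t fun z => adaptMean I τ L (t - 1) z + adaptMult I τ L t * ucSd I τ (t - 1) z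

/-- A measurable rule that picks, in each round, a maximizer of a continuous acquisition function.
Measurability refers to the σ-algebra generated by the evaluations. -/
structure IsArgmaxRule [TopologicalSpace X] [MeasurableSpace X]
    (sel : ℕ → (X → ℝ) → X) : Prop where
  isMax : ∀ t (g : X → ℝ), Continuous g → ∀ z, g z ≤ g (sel t g)
  measurable : ∀ t, Measurable fun g : {g : X → ℝ // Continuous g} => sel t g

/-- Cumulative regret. -/
def regret (f : X → ℝ) (x : ℕ → X) (T : ℕ) : ℝ :=
  ∑ t ∈ Finset.Icc 1 T, ((⨆ z, f z) - f (x t))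

/-- The bound `R_T ≤ C √(T β'_T γ_T)`. -/
def RegretBound (I : Inputs X) (f : X → ℝ) (τ : Trajectory X) (C : ℝ) : Prop :=
  regret f τ.x I.T ≤ C * √(I.T * I.β I.T * maxInfoGain I.k I.σ I.T)

/-- The fixed-center (anchor) model is a standard GP during the whole run: every observation lies in
the plateau, the RCGP posteriors are the GP posteriors, and the robust multiplier is that of
GP-UCB. -/
def FixedIsGP (I : Inputs X) (τ : Trajectory X) : Prop :=
  (∀ t ∈ Finset.Icc 1 I.T, |τ.y t - 0| ≤ fixedWidth I) ∧
  (∀ n ≤ I.T, ∀ z,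
    fixedMean I τ n z = gpMean I.k I.σ τ.x τ.y (Finset.Icc 1 n) z ∧
    fixedVar I τ n z = gpVar I.k I.σ τ.x (Finset.Icc 1 n) z) ∧
  ∀ t ∈ Finset.Icc 1 I.T, fixedMult I τ t = √(I.β t)

/-- The same for the adaptive model. -/
def AdaptIsGP (I : Inputs X) (τ : Trajectory X) (L : ℕ → X → ℝ) : Prop :=
  (∀ t ∈ Finset.Icc 1 I.T, |τ.y t - fixedMean I τ (t - 1) (τ.x t)| ≤ L t (τ.x t)) ∧
  (∀ n ≤ I.T, ∀ z,
    adaptMean I τ L n z = gpMean I.k I.σ τ.x τ.y (Finset.Icc 1 n) z ∧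
    adaptVar I τ L n z = gpVar I.k I.σ τ.x (Finset.Icc 1 n) z) ∧
  ∀ t ∈ Finset.Icc 1 I.T, adaptMult I τ L t = √(I.β t)

end Algorithms

/-! ### The guarantee -/

section Guarantee

variable {X Ω : Type*} [TopologicalSpace X] [MeasurableSpace X] [MeasurableSpace Ω]

/-- Without corruptions and with probability at least `1 - δ`, every run of FC-RCGP-UCB and every
run of A2-RCGP-UCB has regret at most `C √(T β'_T γ_T)`, and all its models coincide with standard
GPs. The objective `f` may be random; `B` is a bound on the realized objective, so it may be random
too. The probability of failure is an outer measure, hence nothing has to be measurable here. -/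
def ZeroCost (P : Measure Ω) (k : X → X → ℝ) (κ σ δ N : ℝ) (β : ℕ → ℝ) (T : ℕ)
    (f : Ω → X → ℝ) (ε : ℕ → Ω → ℝ) (C : ℝ) : Prop :=
  ∀ (sel : ℕ → (X → ℝ) → X), IsArgmaxRule sel →
  ∀ (c : ℝ), 0 < c →
  ∀ (B : Ω → ℝ), (∀ᵐ ω ∂P, ∀ z, |f ω z| ≤ B ω) →
  ∀ (I : Ω → Inputs X), (∀ ω, I ω = ⟨k, κ, σ, c, B ω, N, β, T⟩) →
  ∀ (corr : Ω → ℕ → ℝ), (∀ᵐ ω ∂P, numCorrupt (corr ω) T = 0) →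
  ∀ (x : Ω → ℕ → X) (τ : Ω → Trajectory X),
    (∀ ω, τ ω = observe (f ω) (fun t => ε t ω) (corr ω) (x ω)) →
    ((∀ᵐ ω ∂P, IsFCRun (I ω) sel (τ ω)) →
      P {ω | ¬ (RegretBound (I ω) (f ω) (τ ω) C ∧ FixedIsGP (I ω) (τ ω))} ≤ ENNReal.ofReal δ) ∧
    (∀ (L : Ω → ℕ → X → ℝ), (∀ᵐ ω ∂P, IsA2Run (I ω) sel (L ω) (τ ω)) →
      P {ω | ¬ (RegretBound (I ω) (f ω) (τ ω) C ∧ FixedIsGP (I ω) (τ ω) ∧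
        AdaptIsGP (I ω) (τ ω) (L ω))} ≤ ENNReal.ofReal δ)

end Guarantee

/-! ### The three settings -/

/-- `f` is a sample of the centered Gaussian process with covariance `k`, and the noise is i.i.d.
`N(0, σ²)` and independent of `f`. -/
structure IsGPSample {X Ω : Type*} [MeasurableSpace Ω] (P : Measure Ω) (k : X → X → ℝ) (σ : ℝ)
    (f : Ω → X → ℝ) (ε : ℕ → Ω → ℝ) : Prop where
  measurable_f : ∀ z, Measurable fun ω => f ω z
  gaussian : IsGaussianProcess (fun z ω => f ω z) P
  mean : ∀ z, ∫ ω, f ω z ∂P = 0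
  cov : ∀ z z', cov[fun ω => f ω z, fun ω => f ω z'; P] = k z z'
  measurable_noise : ∀ t, Measurable (ε t)
  law_noise : ∀ t, P.map (ε t) = gaussianReal 0 (Real.toNNReal (σ ^ 2))
  iIndep_noise : iIndepFun ε P
  indep : IndepFun f (fun ω t => ε t ω) P

/-- Bounded martingale difference noise: `|ε_t| ≤ σ` almost surely, and `ε_t` is centered given the
past. -/
structure IsBoundedNoise {Ω : Type*} [MeasurableSpace Ω] (P : Measure Ω) (σ : ℝ)
    (ε : ℕ → Ω → ℝ) : Prop where
  measurable : ∀ t, Measurable (ε t)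
  bounded : ∀ t, ∀ᵐ ω ∂P, |ε t ω| ≤ σ
  centered : ∀ t, 1 ≤ t →
    P[ε t | ⨆ i ∈ Finset.Ico 1 t, MeasurableSpace.comap (ε i) inferInstance] =ᵐ[P] 0

/-- The sample paths are almost surely differentiable on the convex domain `D ⊆ ℝᵈ`, with
`P(sup_D |∂f/∂x_j| > L) ≤ a exp(-(L/b)²)`. -/
def HasDerivTails {Ω : Type*} [MeasurableSpace Ω] {d : ℕ} (P : Measure Ω)
    (D : Set (EuclideanSpace ℝ (Fin d))) (f : Ω → D → ℝ) (a b : ℝ) : Prop :=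
  ∃ (F : Ω → EuclideanSpace ℝ (Fin d) → ℝ)
    (F' : Ω → EuclideanSpace ℝ (Fin d) → EuclideanSpace ℝ (Fin d) →L[ℝ] ℝ),
    (∀ ω (z : D), F ω z = f ω z) ∧
    (∀ᵐ ω ∂P, ∀ z ∈ D, HasFDerivWithinAt (F ω) (F' ω z) D z) ∧
    ∀ (j : Fin d) (L : ℝ), 0 < L →
      P {ω | ∃ z ∈ D, L < |F' ω z (EuclideanSpace.single j 1)|} ≤
        ENNReal.ofReal (a * Real.exp (-(L / b) ^ 2))

/-- Noise bound `N_T(δ')` for Gaussian noise. -/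
def gaussNoiseBound (σ : ℝ) (T : ℕ) (δ' : ℝ) : ℝ := σ * √(2 * Real.log (T / δ'))

/-- GP-UCB parameter `β'_t(δ')` for a finite domain with `m` points. -/
def betaFinite (m : ℕ) (δ' : ℝ) (t : ℕ) : ℝ :=
  2 * Real.log (m * t ^ 2 * Real.pi ^ 2 / (6 * δ'))

/-- GP-UCB parameter `β'_t(δ')` for a convex domain in `[0, r]ᵈ`. -/
def betaConvex (d : ℕ) (a b r δ' : ℝ) (t : ℕ) : ℝ :=
  2 * Real.log (t ^ 2 * (2 * Real.pi ^ 2) / (3 * δ')) +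
    2 * d * Real.log (t ^ 2 * d * b * r * √(Real.log (4 * d * a / δ')))

/-- GP-UCB parameter `β'_t(δ')` for `‖f‖² ≤ Bf` in the RKHS. -/
def betaRKHS {X : Type*} (k : X → X → ℝ) (σ Bf δ' : ℝ) (t : ℕ) : ℝ :=
  2 * Bf + 300 * maxInfoGain k σ t * Real.log (t / δ') ^ 3

end

end RCGP

/-! Without corruptions every round is uncorrupted and the factor `√T_c = 0` removes the deviation
constant, so a robust model can differ from a GP only through its weights. On the plateau the weight
is `σ/√2`, hence `J_w = 1`, and the correction term vanishes, even at the edge of the plateau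
(`corrTerm_pimq_eq_zero`). It therefore suffices that every observation lies in the plateau of every
model; the algorithms then run GP-UCB.

For the fixed center this is `|f| ≤ B` together with the noise bound. For the adaptive model it is
an induction over the rounds (`isA2Run_reduction`): as long as earlier observations are in the
plateau, the next query is that of GP-UCB; the GP-UCB confidence bound at this query and the noise
bound put the observation within `√β_t σ_{t-1} + N` of the anchor mean, and both admissible
half-widths are at least that large. So everything follows from one bad event defined by GP-UCB
alone (`zeroCost_of_ucb`). The regret bound is the usual one: the instantaneous regret is at most
twice the confidence width, and Cauchy-Schwarz with `sum_gpVar_le` bounds the widths by the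
information gain.

What remains are the confidence bounds of GP-UCB with probability at least `1 - δ`. In the RKHS
setting the error is at most `(‖h‖ + √V) σ_n`, with a self-normalized quadratic form `V` of the
noise (`abs_sub_gpMean_le`). The process `exp(V/2 - infoGain)` is dominated by a supermartingale
argument, because the one-step likelihood ratio is convex in bounded noise and lies below a chord of
value at most `1` at zero (`exp_likelihood_le`). Markov's inequality gives the tail of `V`; when the
information gain is small, the kernel is rescaled first.

In the Gaussian settings the queries depend on `f` through the data. The law of the adaptively
collected observations has an explicit density with respect to pure noise (`lintegral_response`),
and for given observations this density is the same as that of the fixed design they select. A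
posterior tail bound valid for every fixed design and every observation vector
(`lintegral_abs_sub_gpMean_gt_le`) can thus be integrated to give the adaptive bound
(`measure_response_gt_le`). A union bound over the points finishes the finite case; on a convex
domain it runs over a grid growing with `t` together with the query itself, and the discretization
errors `2/t²` sum to a constant absorbed into `C`. -/

namespace RCGP

noncomputable section

/-! ### Kernel ridge regression through a feature map -/

section LinearAlgebra

open Matrix

variable {X H : Type*} [NormedAddCommGroup H] [InnerProductSpace ℝ H]
  {k : X → X → ℝ} {φ : X → H} {σ : ℝ}

/-- The regularized Gram matrix `K + σ² I`. -/
def regGram (k : X → X → ℝ) (σ : ℝ) (x : ℕ → X) (S : Finset ℕ) : Matrix S S ℝ :=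
  gram k x S + σ ^ 2 • (1 : Matrix S S ℝ)

lemma regGram_apply (x : ℕ → X) (S : Finset ℕ) (i j : S) :
    regGram k σ x S i j = k (x i) (x j) + if (i : ℕ) = j then σ ^ 2 else 0 := by
  rcases eq_or_ne i j with rfl | h
  · simp [regGram, gram]
  · have h' : (i : ℕ) ≠ j := fun e => h (Subtype.ext e)
    simp [regGram, gram, h, h']

/-- The linear combination of the features of the queries with coefficients `c`. -/
def feat (φ : X → H) (x : ℕ → X) (S : Finset ℕ) (c : S → ℝ) : H :=
  ∑ i : S, c i • φ (x i)

/-- The coefficients `(K + σ² I)⁻¹ k(z)` of the posterior mean. -/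
def gpCoeff (k : X → X → ℝ) (σ : ℝ) (x : ℕ → X) (S : Finset ℕ) (z : X) : S → ℝ :=
  (regGram k σ x S)⁻¹ *ᵥ kvec k x S z

lemma regGram_isSymm (hk : ∀ z z', k z z' = inner ℝ (φ z) (φ z')) (x : ℕ → X) (S : Finset ℕ) :
    (regGram k σ x S).IsSymm := by
  ext i j
  simp only [regGram, gram, Matrix.transpose_apply, Matrix.add_apply, Matrix.of_apply,
    Matrix.smul_apply, hk, real_inner_comm, Matrix.one_apply, eq_comm]

lemma inner_feat (hk : ∀ z z', k z z' = inner ℝ (φ z) (φ z')) (x : ℕ → X) (S : Finset ℕ)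
    (z : X) (c : S → ℝ) : inner ℝ (φ z) (feat φ x S c) = kvec k x S z ⬝ᵥ c := by
  simp only [feat, inner_sum, inner_smul_right, dotProduct, kvec, hk]
  exact Finset.sum_congr rfl fun i _ => mul_comm _ _

lemma inner_feat_feat (hk : ∀ z z', k z z' = inner ℝ (φ z) (φ z')) (x : ℕ → X) (S : Finset ℕ)
    (b c : S → ℝ) :
    inner ℝ (feat φ x S b) (feat φ x S c) = b ⬝ᵥ (gram k x S *ᵥ c) := by
  rw [feat, sum_inner]
  simp only [inner_smul_left, inner_feat hk]
  rfl

/-- The form splits into an inner product of features and a Euclidean one. All positivity below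
comes from the feature map through this identity. -/
lemma dotProduct_regGram (hk : ∀ z z', k z z' = inner ℝ (φ z) (φ z')) (x : ℕ → X)
    (S : Finset ℕ) (b c : S → ℝ) :
    b ⬝ᵥ (regGram k σ x S *ᵥ c) =
      inner ℝ (feat φ x S b) (feat φ x S c) + σ ^ 2 * (b ⬝ᵥ c) := by
  rw [inner_feat_feat hk, regGram, Matrix.add_mulVec, dotProduct_add, Matrix.smul_mulVec,
    Matrix.one_mulVec, dotProduct_smul, smul_eq_mul]

lemma regGram_posDef (hk : ∀ z z', k z z' = inner ℝ (φ z) (φ z')) (hσ : 0 < σ) (x : ℕ → X)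
    (S : Finset ℕ) : (regGram k σ x S).PosDef := by
  refine Matrix.PosDef.of_dotProduct_mulVec_pos ?_ fun c hc => ?_
  · rw [Matrix.IsHermitian, Matrix.conjTranspose_eq_transpose_of_trivial,
      (regGram_isSymm hk x S).eq]
  · rw [star_trivial, dotProduct_regGram hk, real_inner_self_eq_norm_sq]
    have : 0 < c ⬝ᵥ c := by
      have := Matrix.dotProduct_star_self_pos_iff (v := c)
      simpa using this.2 hc
    positivity

lemma isUnit_det_regGram (hk : ∀ z z', k z z' = inner ℝ (φ z) (φ z')) (hσ : 0 < σ) (x : ℕ → X)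
    (S : Finset ℕ) : IsUnit (regGram k σ x S).det :=
  (regGram_posDef hk hσ x S).det_pos.ne'.isUnit

lemma regGram_mulVec_inv (hk : ∀ z z', k z z' = inner ℝ (φ z) (φ z')) (hσ : 0 < σ) (x : ℕ → X)
    (S : Finset ℕ) (v : S → ℝ) : regGram k σ x S *ᵥ ((regGram k σ x S)⁻¹ *ᵥ v) = v := by
  rw [Matrix.mulVec_mulVec, Matrix.mul_nonsing_inv _ (isUnit_det_regGram hk hσ x S),
    Matrix.one_mulVec]

lemma inv_mulVec_eq_of_regGram_mulVec (hk : ∀ z z', k z z' = inner ℝ (φ z) (φ z')) (hσ : 0 < σ)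
    (x : ℕ → X) (S : Finset ℕ) {v y : S → ℝ} (h : regGram k σ x S *ᵥ v = y) :
    (regGram k σ x S)⁻¹ *ᵥ y = v := by
  rw [← h, Matrix.mulVec_mulVec, Matrix.nonsing_inv_mul _ (isUnit_det_regGram hk hσ x S),
    Matrix.one_mulVec]

lemma dotProduct_inv_comm (hk : ∀ z z', k z z' = inner ℝ (φ z) (φ z'))
    (x : ℕ → X) (S : Finset ℕ) (v w : S → ℝ) :
    ((regGram k σ x S)⁻¹ *ᵥ v) ⬝ᵥ w = v ⬝ᵥ ((regGram k σ x S)⁻¹ *ᵥ w) := by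
  have : ((regGram k σ x S)⁻¹)ᵀ = (regGram k σ x S)⁻¹ := by
    rw [Matrix.transpose_nonsing_inv, (regGram_isSymm hk x S).eq]
  conv_lhs => rw [← this, Matrix.mulVec_transpose]
  rw [← Matrix.dotProduct_mulVec]

lemma gpMean_eq_gpCoeff (hk : ∀ z z', k z z' = inner ℝ (φ z) (φ z')) (x : ℕ → X) (y : ℕ → ℝ)
    (S : Finset ℕ) (z : X) : gpMean k σ x y S z = gpCoeff k σ x S z ⬝ᵥ fun i : S => y i :=
  (dotProduct_inv_comm hk x S _ _).symm

/-- The posterior variance is the minimum of a regularized least squares problem. -/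
lemma norm_sub_feat_sq (hk : ∀ z z', k z z' = inner ℝ (φ z) (φ z')) (hσ : 0 < σ) (x : ℕ → X)
    (S : Finset ℕ) (z : X) (c : S → ℝ) :
    ‖φ z - feat φ x S c‖ ^ 2 + σ ^ 2 * (c ⬝ᵥ c) = gpVar k σ x S z +
      (c - gpCoeff k σ x S z) ⬝ᵥ (regGram k σ x S *ᵥ (c - gpCoeff k σ x S z)) := by
  -- Completing the square: `gpCoeff` solves the normal equations, so it is the critical point of
  -- the quadratic in `c`.
  have h1 : regGram k σ x S *ᵥ gpCoeff k σ x S z = kvec k x S z := regGram_mulVec_inv hk hσ x S _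
  have h2 : gpVar k σ x S z = k z z - kvec k x S z ⬝ᵥ gpCoeff k σ x S z := rfl
  have h3 : gpCoeff k σ x S z ⬝ᵥ (regGram k σ x S *ᵥ c) = c ⬝ᵥ kvec k x S z := by
    rw [← h1, dotProduct_regGram hk, dotProduct_regGram hk, real_inner_comm,
      dotProduct_comm c]
  rw [Matrix.mulVec_sub, h1, sub_dotProduct, dotProduct_sub, dotProduct_sub, h3,
    dotProduct_regGram hk, norm_sub_sq_real, inner_feat hk, h2, ← real_inner_self_eq_norm_sq,
    ← real_inner_self_eq_norm_sq, ← hk, dotProduct_comm c (kvec k x S z),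
    dotProduct_comm (gpCoeff k σ x S z) (kvec k x S z)]
  ring

lemma gpVar_le (hk : ∀ z z', k z z' = inner ℝ (φ z) (φ z')) (hσ : 0 < σ) (x : ℕ → X)
    (S : Finset ℕ) (z : X) (c : S → ℝ) :
    gpVar k σ x S z ≤ ‖φ z - feat φ x S c‖ ^ 2 + σ ^ 2 * (c ⬝ᵥ c) := by
  rw [norm_sub_feat_sq hk hσ]
  have := (regGram_posDef hk hσ x S).posSemidef.dotProduct_mulVec_nonneg
    (c - gpCoeff k σ x S z)
  rw [star_trivial] at this
  linarith

lemma gpVar_eq (hk : ∀ z z', k z z' = inner ℝ (φ z) (φ z')) (hσ : 0 < σ) (x : ℕ → X)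
    (S : Finset ℕ) (z : X) :
    gpVar k σ x S z = ‖φ z - feat φ x S (gpCoeff k σ x S z)‖ ^ 2 +
      σ ^ 2 * (gpCoeff k σ x S z ⬝ᵥ gpCoeff k σ x S z) := by
  simp [norm_sub_feat_sq hk hσ]

lemma gpVar_nonneg (hk : ∀ z z', k z z' = inner ℝ (φ z) (φ z')) (hσ : 0 < σ) (x : ℕ → X)
    (S : Finset ℕ) (z : X) : 0 ≤ gpVar k σ x S z := by
  rw [gpVar_eq hk hσ]
  have : 0 ≤ gpCoeff k σ x S z ⬝ᵥ gpCoeff k σ x S z :=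
    Finset.sum_nonneg fun i _ => mul_self_nonneg _
  positivity

lemma gpVar_le_diag (hk : ∀ z z', k z z' = inner ℝ (φ z) (φ z')) (hσ : 0 < σ) (x : ℕ → X)
    (S : Finset ℕ) (z : X) : gpVar k σ x S z ≤ k z z := by
  refine (gpVar_le hk hσ x S z 0).trans ?_
  simp [feat, hk]

/-- Optimal coefficients for fewer data, extended by zero, are admissible in the least squares
problem with more data, so its minimum is no larger. -/
lemma gpVar_anti (hk : ∀ z z', k z z' = inner ℝ (φ z) (φ z')) (hσ : 0 < σ) (x : ℕ → X)
    {S S' : Finset ℕ} (h : S ⊆ S') (z : X) : gpVar k σ x S' z ≤ gpVar k σ x S z := by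
  set c := gpCoeff k σ x S z
  let c' : ℕ → ℝ := fun i => if hi : i ∈ S then c ⟨i, hi⟩ else 0
  have hc' : ∀ i : S, c' i = c i := fun i => by simp [c']
  refine (gpVar_le hk hσ x S' z fun i => c' i).trans (le_of_eq ?_)
  rw [gpVar_eq hk hσ]
  congr 2
  · congr 2
    simp only [feat]
    rw [Finset.sum_coe_sort S' fun i => c' i • φ (x i), ← Finset.sum_subset h,
      ← Finset.sum_coe_sort S]
    · exact Finset.sum_congr rfl fun i _ => by rw [hc']
    · intro i _ hi
      simp [c', hi]
  · simp only [dotProduct]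
    rw [Finset.sum_coe_sort S' fun i => c' i * c' i, ← Finset.sum_subset h,
      ← Finset.sum_coe_sort S]
    · exact Finset.sum_congr rfl fun i _ => by rw [hc']
    · intro i _ hi
      simp [c', hi]

lemma gpSd_anti (hk : ∀ z z', k z z' = inner ℝ (φ z) (φ z')) (hσ : 0 < σ) (x : ℕ → X)
    {S S' : Finset ℕ} (h : S ⊆ S') (z : X) : gpSd k σ x S' z ≤ gpSd k σ x S z :=
  Real.sqrt_le_sqrt (gpVar_anti hk hσ x h z)

lemma sum_insert_coe {M : Type*} [AddCommMonoid M] {S : Finset ℕ} {t : ℕ} (ht : t ∉ S)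
    (F : ↥(insert t S) → M) :
    ∑ j, F j = F ⟨t, Finset.mem_insert_self t S⟩ +
      ∑ i : S, F ⟨i, Finset.mem_insert_of_mem i.2⟩ := by
  rw [← (Finset.subtypeInsertEquivOption ht).symm.sum_comp, Fintype.sum_option]
  rfl

/-- Quadratic form of the inverse of the regularized Gram matrix after one more observation. -/
lemma inv_quadForm_insert (hk : ∀ z z', k z z' = inner ℝ (φ z) (φ z')) (hσ : 0 < σ)
    (x : ℕ → X) (y : ℕ → ℝ) {S : Finset ℕ} {t : ℕ} (ht : t ∉ S) :
    (fun i : ↥(insert t S) => y i) ⬝ᵥ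
        ((regGram k σ x (insert t S))⁻¹ *ᵥ fun i : ↥(insert t S) => y i) =
      (fun i : S => y i) ⬝ᵥ ((regGram k σ x S)⁻¹ *ᵥ fun i : S => y i) +
        (y t - gpMean k σ x y S (x t)) ^ 2 / (σ ^ 2 + gpVar k σ x S (x t)) := by
  set q := σ ^ 2 + gpVar k σ x S (x t) with hq
  have hq0 : 0 < q := by have := gpVar_nonneg hk hσ x S (x t); positivity
  set r := (y t - gpMean k σ x y S (x t)) / q with hr
  set a := (regGram k σ x S)⁻¹ *ᵥ fun i : S => y i with ha
  set b := gpCoeff k σ x S (x t) with hb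
  have hA : regGram k σ x S *ᵥ a = fun i : S => y i := regGram_mulVec_inv hk hσ x S _
  have hB : regGram k σ x S *ᵥ b = kvec k x S (x t) := regGram_mulVec_inv hk hσ x S _
  have hkb : kvec k x S (x t) ⬝ᵥ b = k (x t) (x t) - gpVar k σ x S (x t) := by
    change _ = k (x t) (x t) - (k (x t) (x t) - kvec k x S (x t) ⬝ᵥ b)
    ring
  have hka : kvec k x S (x t) ⬝ᵥ a = gpMean k σ x y S (x t) := rfl
  -- Block elimination: the old solution `a` is corrected along `b`, and the new coordinate is the
  -- prediction error divided by the Schur complement `q`.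
  let v : ↥(insert t S) → ℝ := fun j => if h : (j : ℕ) ∈ S then a ⟨j, h⟩ - r * b ⟨j, h⟩ else r
  have hvt : v ⟨t, Finset.mem_insert_self t S⟩ = r := by simp [v, ht]
  have hvS : ∀ i : S, v ⟨i, Finset.mem_insert_of_mem i.2⟩ = a i - r * b i := fun i => by simp [v]
  have hentry : ∀ i j : S, regGram k σ x (insert t S) ⟨i, Finset.mem_insert_of_mem i.2⟩
      ⟨j, Finset.mem_insert_of_mem j.2⟩ = regGram k σ x S i j := fun i j => by
    simp only [regGram_apply]
  have hnt : ∀ i : S, (i : ℕ) ≠ t := fun i h => ht (h ▸ i.2)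
  have hsolve : regGram k σ x (insert t S) *ᵥ v = fun i : ↥(insert t S) => y i := by
    ext ⟨j, hj⟩
    rw [Matrix.mulVec, dotProduct, sum_insert_coe ht]
    simp only [hvt, hvS]
    rcases Finset.mem_insert.1 hj with rfl | hjS
    · have e1 : ∀ i : S, regGram k σ x (insert j S) ⟨j, hj⟩ ⟨i, Finset.mem_insert_of_mem i.2⟩ =
          kvec k x S (x j) i := fun i => by
        simp [regGram_apply, kvec, (hnt i).symm]
      have e2 : regGram k σ x (insert j S) ⟨j, hj⟩ ⟨j, Finset.mem_insert_self j S⟩ =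
          k (x j) (x j) + σ ^ 2 := by
        simp [regGram_apply]
      have e3 : ∑ i : S, kvec k x S (x j) i * (a i - r * b i) =
          kvec k x S (x j) ⬝ᵥ a - r * (kvec k x S (x j) ⬝ᵥ b) := by
        simp only [dotProduct, mul_sub, Finset.sum_sub_distrib, Finset.mul_sum]
        congr 1
        exact Finset.sum_congr rfl fun i _ => by ring
      simp only [e1, e2]
      rw [e3, hka, hkb]
      have : r * q = y j - gpMean k σ x y S (x j) := by rw [hr]; field_simp
      rw [hq] at this
      linarith
    · have e1 : ∀ i : S, regGram k σ x (insert t S) ⟨j, hj⟩ ⟨i, Finset.mem_insert_of_mem i.2⟩ =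
          regGram k σ x S ⟨j, hjS⟩ i := fun i => hentry ⟨j, hjS⟩ i
      have e2 : regGram k σ x (insert t S) ⟨j, hj⟩ ⟨t, Finset.mem_insert_self t S⟩ =
          kvec k x S (x t) ⟨j, hjS⟩ := by
        simp [regGram_apply, kvec, hnt ⟨j, hjS⟩, hk, real_inner_comm]
      have e3 : ∑ i : S, regGram k σ x S ⟨j, hjS⟩ i * (a i - r * b i) =
          (regGram k σ x S *ᵥ a) ⟨j, hjS⟩ - r * (regGram k σ x S *ᵥ b) ⟨j, hjS⟩ := by
        simp only [Matrix.mulVec, dotProduct, mul_sub, Finset.sum_sub_distrib, Finset.mul_sum]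
        congr 1
        exact Finset.sum_congr rfl fun i _ => by ring
      simp only [e1, e2]
      rw [e3, hA, hB]
      ring
  rw [inv_mulVec_eq_of_regGram_mulVec hk hσ x _ hsolve, dotProduct, sum_insert_coe ht]
  simp only [hvt, hvS]
  have e4 : ∑ i : S, y i * (a i - r * b i) =
      (fun i : S => y i) ⬝ᵥ a - r * (b ⬝ᵥ fun i : S => y i) := by
    simp only [dotProduct, mul_sub, Finset.sum_sub_distrib, Finset.mul_sum]
    congr 1
    exact Finset.sum_congr rfl fun i _ => by ring
  rw [e4, ← gpMean_eq_gpCoeff hk, hr]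
  field_simp
  ring

/-- Schur complement formula for the determinant of the regularized Gram matrix. -/
lemma det_regGram_insert (hk : ∀ z z', k z z' = inner ℝ (φ z) (φ z')) (hσ : 0 < σ)
    (x : ℕ → X) {S : Finset ℕ} {t : ℕ} (ht : t ∉ S) :
    (regGram k σ x (insert t S)).det =
      (regGram k σ x S).det * (σ ^ 2 + gpVar k σ x S (x t)) := by
  have hnt : ∀ i : S, (i : ℕ) ≠ t := fun i h => ht (h ▸ i.2)
  let e : S ⊕ Unit ≃ ↥(insert t S) :=
    (Equiv.optionEquivSumPUnit S).symm.trans (Finset.subtypeInsertEquivOption ht).symm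
  have e1 : ∀ i : S, ((e (Sum.inl i) : ↥(insert t S)) : ℕ) = i := fun i => rfl
  have e2 : ∀ u, ((e (Sum.inr u) : ↥(insert t S)) : ℕ) = t := fun u => rfl
  have hblock : (regGram k σ x (insert t S)).submatrix e e =
      Matrix.fromBlocks (regGram k σ x S) (Matrix.replicateCol Unit (kvec k x S (x t)))
        (Matrix.replicateRow Unit (kvec k x S (x t)))
        (Matrix.of fun _ _ => k (x t) (x t) + σ ^ 2) := by
    ext i j
    rcases i with i | i <;> rcases j with j | j <;>
      simp [regGram_apply, kvec, e1, e2, hnt, (hnt _).symm, hk, real_inner_comm]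
  let := Matrix.invertibleOfIsUnitDet _ (isUnit_det_regGram hk hσ x S)
  rw [← Matrix.det_submatrix_equiv_self e, hblock, Matrix.det_fromBlocks₁₁]
  congr 1
  rw [Matrix.det_unique, Matrix.invOf_eq_nonsing_inv]
  have : ((Matrix.replicateRow Unit (kvec k x S (x t)) * (regGram k σ x S)⁻¹ *
      Matrix.replicateCol Unit (kvec k x S (x t))) default default : ℝ) =
      kvec k x S (x t) ⬝ᵥ gpCoeff k σ x S (x t) := by
    rw [Matrix.mul_assoc]
    rfl
  rw [Matrix.sub_apply, this]
  change k (x t) (x t) + σ ^ 2 - _ =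
    σ ^ 2 + (k (x t) (x t) - kvec k x S (x t) ⬝ᵥ gpCoeff k σ x S (x t))
  ring

end LinearAlgebra

/-! ### Continuity and measurability of the posterior -/

section Regularity

open Matrix

variable {X : Type*} {k : X → X → ℝ} {σ : ℝ}

lemma continuous_kvec [TopologicalSpace X] (hk : Continuous fun p : X × X => k p.1 p.2)
    (x : ℕ → X) (S : Finset ℕ) : Continuous (kvec k x S) :=
  continuous_pi fun _ => hk.comp (continuous_id.prodMk continuous_const)

lemma continuous_gpMean [TopologicalSpace X] (hk : Continuous fun p : X × X => k p.1 p.2)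
    (x : ℕ → X) (y : ℕ → ℝ) (S : Finset ℕ) : Continuous (gpMean k σ x y S) :=
  (continuous_kvec hk x S).dotProduct continuous_const

lemma continuous_gpSd [TopologicalSpace X] (hk : Continuous fun p : X × X => k p.1 p.2)
    (x : ℕ → X) (S : Finset ℕ) : Continuous (gpSd k σ x S) :=
  Real.continuous_sqrt.comp ((hk.comp (continuous_id.prodMk continuous_id)).sub
    ((continuous_kvec hk x S).dotProduct
      (continuous_const.matrix_mulVec (continuous_kvec hk x S))))

variable {α : Type*} [MeasurableSpace α] [MeasurableSpace X]

/-- Cramer's rule: determinant and adjugate are continuous in the entries. No invertibility is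
needed, since the inverse of a singular matrix and of the number `0` are both zero by convention. -/
lemma measurable_inv_apply {n : Type*} [Fintype n] [DecidableEq n] {A : α → Matrix n n ℝ}
    (hA : ∀ i j, Measurable fun a => A a i j) (i j : n) : Measurable fun a => (A a)⁻¹ i j := by
  have hA' : Measurable fun a => (fun p : n × n => A a p.1 p.2) :=
    measurable_pi_lambda _ fun p => hA p.1 p.2
  have hdet : Continuous fun B : n × n → ℝ => (Matrix.of fun i j => B (i, j)).det :=
    Continuous.matrix_det (by fun_prop)
  have hadj : Continuous fun B : n × n → ℝ => (Matrix.of fun i j => B (i, j)).adjugate i j :=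
    (Continuous.matrix_adjugate (by fun_prop)).matrix_elem i j
  have := ((hdet.measurable.comp hA').inv).mul (hadj.measurable.comp hA')
  convert this using 2 with a
  simp only [Matrix.inv_def, Ring.inverse_eq_inv', Matrix.smul_apply, smul_eq_mul, Pi.mul_apply,
    Pi.inv_apply, Function.comp]
  rfl

lemma measurable_regGram_inv_apply (hk : Measurable fun p : X × X => k p.1 p.2)
    {S : Finset ℕ} {x : α → ℕ → X}
    (hx : ∀ i ∈ S, Measurable fun a => x a i) (i j : S) :
    Measurable fun a => (regGram k σ (x a) S)⁻¹ i j := by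
  refine measurable_inv_apply (fun i j => ?_) i j
  simp only [regGram, gram, Matrix.add_apply, Matrix.of_apply]
  exact (hk.comp ((hx i i.2).prodMk (hx j j.2))).add_const _

lemma measurable_gpMean (hk : Measurable fun p : X × X => k p.1 p.2)
    {S : Finset ℕ} {x : α → ℕ → X} {y : α → ℕ → ℝ} {z : α → X}
    (hx : ∀ i ∈ S, Measurable fun a => x a i) (hy : ∀ i ∈ S, Measurable fun a => y a i)
    (hz : Measurable z) :
    Measurable fun a => gpMean k σ (x a) (y a) S (z a) := by
  refine Finset.measurable_fun_sum _ fun i _ => Measurable.mul ?_ ?_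
  · exact hk.comp (hz.prodMk (hx i i.2))
  · exact Finset.measurable_fun_sum _ fun j _ =>
      (measurable_regGram_inv_apply hk hx i j).mul (hy j j.2)

lemma measurable_gpVar (hk : Measurable fun p : X × X => k p.1 p.2)
    {S : Finset ℕ} {x : α → ℕ → X} {z : α → X}
    (hx : ∀ i ∈ S, Measurable fun a => x a i) (hz : Measurable z) :
    Measurable fun a => gpVar k σ (x a) S (z a) := by
  refine (hk.comp (hz.prodMk hz)).sub ?_
  refine Finset.measurable_fun_sum _ fun i _ => Measurable.mul ?_ ?_
  · exact hk.comp (hz.prodMk (hx i i.2))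
  · exact Finset.measurable_fun_sum _ fun j _ =>
      (measurable_regGram_inv_apply hk hx i j).mul (hk.comp (hz.prodMk (hx j j.2)))

lemma measurable_gpSd (hk : Measurable fun p : X × X => k p.1 p.2)
    {S : Finset ℕ} {x : α → ℕ → X} {z : α → X}
    (hx : ∀ i ∈ S, Measurable fun a => x a i) (hz : Measurable z) :
    Measurable fun a => gpSd k σ (x a) S (z a) :=
  (measurable_gpVar hk hx hz).sqrt

end Regularity

/-! ### Information gain and the sum of posterior variances -/

section InfoGain

open Matrix

variable {X H : Type*} [NormedAddCommGroup H] [InnerProductSpace ℝ H]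
  {k : X → X → ℝ} {φ : X → H} {σ κ : ℝ}

/-- Information gain of the queries of the rounds in `S`. -/
def infoGain (k : X → X → ℝ) (σ : ℝ) (x : ℕ → X) (S : Finset ℕ) : ℝ :=
  1 / 2 * Real.log (1 + (σ ^ 2)⁻¹ • gram k x S).det

lemma det_regGram (hσ : 0 < σ) (x : ℕ → X) (S : Finset ℕ) :
    (regGram k σ x S).det = (σ ^ 2) ^ S.card * (1 + (σ ^ 2)⁻¹ • gram k x S).det := by
  have : regGram k σ x S = σ ^ 2 • (1 + (σ ^ 2)⁻¹ • gram k x S) := by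
    rw [smul_add, smul_smul, mul_inv_cancel₀ (by positivity), one_smul, regGram, add_comm]
  rw [this, Matrix.det_smul, Fintype.card_coe]

lemma infoGain_empty (x : ℕ → X) : infoGain k σ x ∅ = 0 := by
  simp [infoGain]

/-- Chain rule of information: the determinant gains the Schur complement `σ² + gpVar`, and `σ²` is
factored out of each row. -/
lemma infoGain_insert (hk : ∀ z z', k z z' = inner ℝ (φ z) (φ z')) (hσ : 0 < σ)
    (x : ℕ → X) {S : Finset ℕ} {t : ℕ} (ht : t ∉ S) :
    infoGain k σ x (insert t S) =
      infoGain k σ x S + 1 / 2 * Real.log (1 + gpVar k σ x S (x t) / σ ^ 2) := by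
  have hdet : ∀ S : Finset ℕ, 0 < (1 + (σ ^ 2)⁻¹ • gram k x S).det := fun S => by
    have := (regGram_posDef hk hσ x S).det_pos
    rw [det_regGram hσ] at this
    exact pos_of_mul_pos_right this (by positivity)
  have hv := gpVar_nonneg hk hσ x S (x t)
  have h := det_regGram_insert hk hσ x ht
  rw [det_regGram hσ, det_regGram hσ, Finset.card_insert_of_notMem ht] at h
  have h' : (1 + (σ ^ 2)⁻¹ • gram k x (insert t S)).det =
      (1 + (σ ^ 2)⁻¹ • gram k x S).det * (1 + gpVar k σ x S (x t) / σ ^ 2) := by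
    have : (σ ^ 2) ^ (S.card + 1) ≠ 0 := by positivity
    apply mul_left_cancel₀ this
    have h2 : σ ^ 2 * (1 + gpVar k σ x S (x t) / σ ^ 2) = σ ^ 2 + gpVar k σ x S (x t) := by
      field_simp
    rw [h, ← h2, pow_succ]
    ring
  rw [infoGain, h', Real.log_mul (hdet S).ne' (by positivity), mul_add, infoGain]

lemma infoGain_nonneg (hk : ∀ z z', k z z' = inner ℝ (φ z) (φ z')) (hσ : 0 < σ)
    (x : ℕ → X) (S : Finset ℕ) : 0 ≤ infoGain k σ x S := by
  induction S using Finset.induction_on with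
  | empty => rw [infoGain_empty]
  | insert t S ht ih =>
    rw [infoGain_insert hk hσ x ht]
    have := gpVar_nonneg hk hσ x S (x t)
    have : 0 ≤ Real.log (1 + gpVar k σ x S (x t) / σ ^ 2) :=
      Real.log_nonneg (le_add_of_nonneg_right (by positivity))
    linarith

lemma infoGain_le_sum (hk : ∀ z z', k z z' = inner ℝ (φ z) (φ z')) (hσ : 0 < σ)
    (x : ℕ → X) (S : Finset ℕ) : infoGain k σ x S ≤ ∑ i ∈ S, 1 / 2 * (k (x i) (x i) / σ ^ 2) := by
  induction S using Finset.induction_on with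
  | empty => rw [infoGain_empty, Finset.sum_empty]
  | insert t S ht ih =>
    rw [infoGain_insert hk hσ x ht, Finset.sum_insert ht, add_comm]
    have h0 := gpVar_nonneg hk hσ x S (x t)
    refine add_le_add (mul_le_mul_of_nonneg_left ?_ (by norm_num)) ih
    have h1 : gpVar k σ x S (x t) / σ ^ 2 ≤ k (x t) (x t) / σ ^ 2 := by
      gcongr
      exact gpVar_le_diag hk hσ x S (x t)
    have := Real.log_le_sub_one_of_pos (x := 1 + gpVar k σ x S (x t) / σ ^ 2) (by positivity)
    linarith

/-- The information gain of `n` points, as in the definition of `maxInfoGain`. -/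
lemma infoGain_eq_of_equiv (x : ℕ → X) {S : Finset ℕ} {n : ℕ} (e : S ≃ Fin n) (z : Fin n → X)
    (hz : ∀ i : S, z (e i) = x i) :
    (1 / 2 : ℝ) * Real.log
      (1 + (σ ^ 2)⁻¹ • (Matrix.of fun i j => k (z i) (z j)) : Matrix (Fin n) (Fin n) ℝ).det =
      infoGain k σ x S := by
  rw [infoGain, ← Matrix.det_submatrix_equiv_self e]
  congr 3
  ext i j
  simp [gram, hz, Matrix.one_apply]

lemma exists_infoGain_eq [Nonempty X] {S : Finset ℕ} {n : ℕ} (hS : S.card = n) (z : Fin n → X) :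
    ∃ x : ℕ → X, (1 / 2 : ℝ) * Real.log
      (1 + (σ ^ 2)⁻¹ • (Matrix.of fun i j => k (z i) (z j)) : Matrix (Fin n) (Fin n) ℝ).det =
      infoGain k σ x S := by
  let e := S.equivFinOfCardEq hS
  refine ⟨fun i => if h : i ∈ S then z (e ⟨i, h⟩) else Classical.arbitrary X,
    infoGain_eq_of_equiv _ e z fun i => ?_⟩
  simp

/-- Needed because a real supremum over an unbounded family is `0` by convention; without it no
single design could be compared with `maxInfoGain`. -/
lemma bddAbove_infoGain [Nonempty X] (hk : ∀ z z', k z z' = inner ℝ (φ z) (φ z')) (hσ : 0 < σ)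
    (hκ : ∀ z z', |k z z'| ≤ κ) (n : ℕ) :
    BddAbove (Set.range fun z : Fin n → X => (1 / 2 : ℝ) * Real.log
      (1 + (σ ^ 2)⁻¹ • (Matrix.of fun i j => k (z i) (z j)) : Matrix (Fin n) (Fin n) ℝ).det) := by
  refine ⟨∑ _i ∈ Finset.range n, 1 / 2 * (κ / σ ^ 2), ?_⟩
  rintro _ ⟨z, rfl⟩
  obtain ⟨x, hx⟩ := exists_infoGain_eq (k := k) (σ := σ) (Finset.card_range n) z
  simp only [hx]
  refine (infoGain_le_sum hk hσ x _).trans (Finset.sum_le_sum fun i _ => ?_)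
  have := (le_abs_self _).trans (hκ (x i) (x i))
  gcongr

lemma infoGain_le_maxInfoGain [Nonempty X] (hk : ∀ z z', k z z' = inner ℝ (φ z) (φ z'))
    (hσ : 0 < σ) (hκ : ∀ z z', |k z z'| ≤ κ) (x : ℕ → X) (S : Finset ℕ) :
    infoGain k σ x S ≤ maxInfoGain k σ S.card := by
  rw [← infoGain_eq_of_equiv x S.equivFin (fun i => x (S.equivFin.symm i)) (by simp)]
  exact le_ciSup (bddAbove_infoGain hk hσ hκ S.card) _

lemma maxInfoGain_mono [Nonempty X] (hk : ∀ z z', k z z' = inner ℝ (φ z) (φ z')) (hσ : 0 < σ)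
    (hκ : ∀ z z', |k z z'| ≤ κ) : Monotone (maxInfoGain k σ) := by
  refine monotone_nat_of_le_succ fun n => ciSup_le fun z => ?_
  obtain ⟨x, hx⟩ := exists_infoGain_eq (k := k) (σ := σ) (Finset.card_range n) z
  rw [hx]
  have h := infoGain_le_maxInfoGain hk hσ hκ x (Finset.range (n + 1))
  rw [Finset.card_range] at h
  refine le_trans ?_ h
  rw [Finset.range_add_one, infoGain_insert hk hσ x Finset.notMem_range_self]
  have := gpVar_nonneg hk hσ x (Finset.range n) (x n)
  have : 0 ≤ Real.log (1 + gpVar k σ x (Finset.range n) (x n) / σ ^ 2) :=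
    Real.log_nonneg (le_add_of_nonneg_right (by positivity))
  linarith

lemma maxInfoGain_nonneg [Nonempty X] (hk : ∀ z z', k z z' = inner ℝ (φ z) (φ z')) (hσ : 0 < σ)
    (hκ : ∀ z z', |k z z'| ≤ κ) (n : ℕ) : 0 ≤ maxInfoGain k σ n := by
  have h := infoGain_le_maxInfoGain hk hσ hκ (fun _ => Classical.arbitrary X) (Finset.range n)
  rw [Finset.card_range] at h
  exact (infoGain_nonneg hk hσ _ _).trans h

/-- The information gain of `n` evaluations at the same point. -/
lemma log_le_maxInfoGain [Nonempty X] (hk : ∀ z z', k z z' = inner ℝ (φ z) (φ z')) (hσ : 0 < σ)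
    (hκ : ∀ z z', |k z z'| ≤ κ) (n : ℕ) (z : X) :
    1 / 2 * Real.log (1 + n * k z z / σ ^ 2) ≤ maxInfoGain k σ n := by
  refine le_trans (le_of_eq ?_) (le_ciSup (bddAbove_infoGain hk hσ hκ n) fun _ => z)
  -- The Gram matrix of a repeated point has rank one, so the matrix determinant lemma applies.
  have : ((σ ^ 2)⁻¹ • (Matrix.of fun _ _ => k z z) : Matrix (Fin n) (Fin n) ℝ) =
      (Matrix.replicateCol Unit (fun _ => k z z / σ ^ 2) : Matrix (Fin n) Unit ℝ) *
        (Matrix.replicateRow Unit 1 : Matrix Unit (Fin n) ℝ) := by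
    ext i j
    simp [Matrix.mul_apply, div_eq_inv_mul]
  simp only [this]
  rw [Matrix.det_one_add_replicateCol_mul_replicateRow]
  simp [dotProduct, mul_div_assoc]

lemma Icc_one_succ (n : ℕ) : Finset.Icc 1 (n + 1) = insert (n + 1) (Finset.Icc 1 n) := by
  ext i
  simp only [Finset.mem_Icc, Finset.mem_insert]
  omega

lemma succ_notMem_Icc (n : ℕ) : n + 1 ∉ Finset.Icc 1 n := by simp

/-- The sum of the posterior variances at the queries is bounded by the information gain. -/
lemma sum_gpVar_le (hk : ∀ z z', k z z' = inner ℝ (φ z) (φ z')) (hσ : 0 < σ)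
    (hκ : ∀ z z', |k z z'| ≤ κ) (x : ℕ → X) (n : ℕ) :
    ∑ t ∈ Finset.Icc 1 n, gpVar k σ x (Finset.Icc 1 (t - 1)) (x t) ≤
      2 * (σ ^ 2 + κ) * infoGain k σ x (Finset.Icc 1 n) := by
  induction n with
  | zero => simp [infoGain_empty]
  | succ n ih =>
    rw [Icc_one_succ, Finset.sum_insert (succ_notMem_Icc n),
      infoGain_insert hk hσ x (succ_notMem_Icc n), Nat.add_sub_cancel]
    set v := gpVar k σ x (Finset.Icc 1 n) (x (n + 1))
    have h0 : 0 ≤ v := gpVar_nonneg hk hσ x _ _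
    have h1 : v ≤ κ := (gpVar_le_diag hk hσ x _ _).trans ((le_abs_self _).trans (hκ _ _))
    -- From `1 - 1/u ≤ log u` at `u = 1 + v/σ²` comes `v/(σ² + v) ≤ log u`; then `v ≤ κ` in the
    -- denominator. This is the source of the factor `σ² + κ`.
    have h2 : v ≤ (σ ^ 2 + κ) * Real.log (1 + v / σ ^ 2) := by
      have h3 := Real.one_sub_inv_le_log_of_pos (x := 1 + v / σ ^ 2) (by positivity)
      have h4 : 1 - (1 + v / σ ^ 2)⁻¹ = v / (σ ^ 2 + v) := by
        field_simp
        ring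
      rw [h4] at h3
      calc v = (σ ^ 2 + v) * (v / (σ ^ 2 + v)) := by field_simp
        _ ≤ (σ ^ 2 + κ) * Real.log (1 + v / σ ^ 2) := by
          have := h0.trans h1
          gcongr
    linarith

end InfoGain

/-! ### On the plateau RCGP is GP regression -/

section Plateau

open Matrix

variable {X : Type*} {k : X → X → ℝ} {σ c L g u : ℝ}

lemma pimq_of_le (h : |u - g| ≤ L) : pimq σ c L g u = σ / √2 := if_pos h

/-- Moving from a plateau point `u` to `v` leaves the plateau by at most `|v - u|`, and the
log-weight falls only quadratically in that overshoot. A quadratic bound forces derivative zero,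
also when `u` sits on the edge where the formula switches. -/
lemma log_pimq_sq_sub_abs_le (hσ : 0 < σ) (hu : |u - g| ≤ L) (v : ℝ) :
    |Real.log (pimq σ c L g v ^ 2) - Real.log (pimq σ c L g u ^ 2)| ≤ (c ^ 2)⁻¹ * (v - u) ^ 2 := by
  rw [pimq_of_le hu]
  by_cases hv : |v - g| ≤ L
  · rw [pimq_of_le hv, sub_self, abs_zero]
    positivity
  · set s := |v - g| - L with hs
    have hs0 : 0 < s := sub_pos.2 (not_le.1 hv)
    have hs1 : s ≤ |v - u| := by
      have : |v - g| ≤ |v - u| + |u - g| := abs_sub_le _ _ _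
      linarith
    have hp : 0 < 1 + s ^ 2 / c ^ 2 := by positivity
    have h1 : pimq σ c L g v ^ 2 = (σ / √2) ^ 2 * (1 + s ^ 2 / c ^ 2)⁻¹ := by
      rw [pimq, if_neg hv, mul_pow, ← Real.rpow_natCast (_ ^ (-(1 / 2) : ℝ)),
        ← Real.rpow_mul hp.le]
      norm_num [Real.rpow_neg_one]
    rw [h1, Real.log_mul (by positivity) (by positivity), add_sub_cancel_left, Real.log_inv,
      abs_neg, abs_of_nonneg (Real.log_nonneg (le_add_of_nonneg_right (by positivity)))]
    calc Real.log (1 + s ^ 2 / c ^ 2) ≤ s ^ 2 / c ^ 2 := by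
          have := Real.log_le_sub_one_of_pos hp
          linarith
      _ ≤ |v - u| ^ 2 / c ^ 2 := by gcongr
      _ = (c ^ 2)⁻¹ * (v - u) ^ 2 := by rw [sq_abs, div_eq_inv_mul]

/-- The correction vanishes on the closed plateau. -/
lemma corrTerm_pimq_eq_zero (hσ : 0 < σ) (hu : |u - g| ≤ L) : corrTerm σ (pimq σ c L g) u = 0 := by
  have h : HasFDerivAt (fun v => Real.log (pimq σ c L g v ^ 2) - Real.log (pimq σ c L g u ^ 2))
      (0 : ℝ →L[ℝ] ℝ) u := by
    refine Asymptotics.IsBigO.hasFDerivAt (n := 2) (Asymptotics.IsBigO.of_bound (c ^ 2)⁻¹ ?_)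
      (by norm_num)
    refine Filter.Eventually.of_forall fun v => ?_
    rw [Real.norm_eq_abs, Real.norm_eq_abs, Real.norm_eq_abs, sq_abs, abs_sq]
    exact log_pimq_sq_sub_abs_le hσ hu v
  have h' : HasDerivAt (fun v => Real.log (pimq σ c L g v ^ 2)) 0 u := by
    simpa using h.hasDerivAt.add_const (Real.log (pimq σ c L g u ^ 2))
  rw [corrTerm, h'.deriv, mul_zero]

variable {w : ℕ → ℝ → ℝ} {x : ℕ → X} {y : ℕ → ℝ} {S : Finset ℕ}

lemma Jw_eq_one (hσ : 0 < σ)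
    (hw : ∀ i ∈ S, ∃ L g, w i = pimq σ c L g ∧ |y i - g| ≤ L) : Jw σ w y S = 1 := by
  rw [Jw, ← Matrix.diagonal_one]
  congr 1
  ext i
  obtain ⟨L, g, hw, hy⟩ := hw i i.2
  rw [hw, pimq_of_le hy, div_pow, Real.sq_sqrt (by norm_num)]
  field_simp

lemma rcgpMean_eq_gpMean (hσ : 0 < σ)
    (hw : ∀ i ∈ S, ∃ L g, w i = pimq σ c L g ∧ |y i - g| ≤ L) (z : X) :
    rcgpMean k σ w x y S z = gpMean k σ x y S z := by
  rw [rcgpMean, gpMean, Jw_eq_one hσ hw]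
  congr 2
  ext i
  obtain ⟨L, g, hw, hy⟩ := hw i i.2
  rw [hw, corrTerm_pimq_eq_zero hσ hy, sub_zero]

lemma rcgpVar_eq_gpVar (hσ : 0 < σ)
    (hw : ∀ i ∈ S, ∃ L g, w i = pimq σ c L g ∧ |y i - g| ≤ L) (z : X) :
    rcgpVar k σ w x y S z = gpVar k σ x S z := by
  rw [rcgpVar, gpVar, Jw_eq_one hσ hw]

end Plateau

/-! ### Designs, and GP-UCB as a function of its observations -/

section Design

variable {X : Type*} {k : X → X → ℝ} {σ : ℝ} {β : ℕ → ℝ} {sel : ℕ → (X → ℝ) → X}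

lemma gpMean_congr {x x' : ℕ → X} {y y' : ℕ → ℝ} {S : Finset ℕ} (hx : ∀ i ∈ S, x i = x' i)
    (hy : ∀ i ∈ S, y i = y' i) : gpMean k σ x y S = gpMean k σ x' y' S := by
  ext z
  have h1 : kvec k x S = kvec k x' S := by
    ext z i
    simp [kvec, hx i i.2]
  have h2 : gram k x S = gram k x' S := by
    ext i j
    simp [gram, hx i i.2, hx j j.2]
  have h3 : (fun i : S => y i) = fun i : S => y' i := funext fun i => hy i i.2
  rw [gpMean, gpMean, h1, h2, h3]

lemma gpVar_congr {x x' : ℕ → X} {S : Finset ℕ} (hx : ∀ i ∈ S, x i = x' i) :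
    gpVar k σ x S = gpVar k σ x' S := by
  ext z
  have h1 : kvec k x S = kvec k x' S := by
    ext z i
    simp [kvec, hx i i.2]
  have h2 : gram k x S = gram k x' S := by
    ext i j
    simp [gram, hx i i.2, hx j j.2]
  rw [gpVar, gpVar, h1, h2]

lemma gpSd_congr {x x' : ℕ → X} {S : Finset ℕ} (hx : ∀ i ∈ S, x i = x' i) :
    gpSd k σ x S = gpSd k σ x' S := by
  ext z
  rw [gpSd, gpSd, gpVar_congr hx]

/-- The acquisition function of GP-UCB after round `n`. -/
def ucb (k : X → X → ℝ) (σ : ℝ) (β : ℕ → ℝ) (x : ℕ → X) (y : ℕ → ℝ) (n : ℕ) (z : X) : ℝ :=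
  gpMean k σ x y (Finset.Icc 1 n) z + √(β (n + 1)) * gpSd k σ x (Finset.Icc 1 n) z

lemma ucb_congr {x x' : ℕ → X} {y y' : ℕ → ℝ} {n : ℕ} (hx : ∀ i ∈ Finset.Icc 1 n, x i = x' i)
    (hy : ∀ i ∈ Finset.Icc 1 n, y i = y' i) : ucb k σ β x y n = ucb k σ β x' y' n := by
  ext z
  rw [ucb, ucb, gpMean_congr hx hy, gpSd_congr hx]

/-- The queries of GP-UCB up to round `n` when the observations are `y`. -/
def ucbPath (sel : ℕ → (X → ℝ) → X) (k : X → X → ℝ) (σ : ℝ) (β : ℕ → ℝ) (y : ℕ → ℝ) :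
    ℕ → ℕ → X
  | 0 => fun _ => sel 0 0
  | n + 1 => Function.update (ucbPath sel k σ β y n) (n + 1)
      (sel (n + 1) (ucb k σ β (ucbPath sel k σ β y n) y n))

/-- The query of GP-UCB in round `t` when the observations are `y`. -/
def ucbQuery (sel : ℕ → (X → ℝ) → X) (k : X → X → ℝ) (σ : ℝ) (β : ℕ → ℝ) (y : ℕ → ℝ) (t : ℕ) : X :=
  ucbPath sel k σ β y t t

lemma ucbPath_of_le (y : ℕ → ℝ) {t n : ℕ} (h : t ≤ n) :
    ucbPath sel k σ β y n t = ucbQuery sel k σ β y t := by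
  induction n, h using Nat.le_induction with
  | base => rfl
  | succ n h ih => rw [ucbPath, Function.update_of_ne (by omega), ih]

lemma ucbQuery_succ (y : ℕ → ℝ) (n : ℕ) :
    ucbQuery sel k σ β y (n + 1) =
      sel (n + 1) (ucb k σ β (ucbQuery sel k σ β y) y n) := by
  rw [ucbQuery, ucbPath, Function.update_self]
  congr 1
  exact ucb_congr (fun i hi => ucbPath_of_le y (Finset.mem_Icc.1 hi).2) fun _ _ => rfl

/-- A design is nonanticipative if the query of round `n + 1` depends on the observations of the
rounds `1, …, n` only. -/
def IsNonanticipative (d : (ℕ → ℝ) → ℕ → X) : Prop :=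
  ∀ y y' n, (∀ i ∈ Finset.Icc 1 n, y i = y' i) → d y (n + 1) = d y' (n + 1)

lemma IsNonanticipative.congr {d : (ℕ → ℝ) → ℕ → X} (hd : IsNonanticipative d) {y y' : ℕ → ℝ}
    {n : ℕ} (h : ∀ i ∈ Finset.Icc 1 n, y i = y' i) : ∀ i ∈ Finset.Icc 1 (n + 1), d y i = d y' i := by
  intro i hi
  obtain ⟨j, rfl⟩ : ∃ j, i = j + 1 := ⟨i - 1, by have := (Finset.mem_Icc.1 hi).1; omega⟩
  refine hd y y' j fun l hl => h l ?_
  simp only [Finset.mem_Icc] at *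
  omega

lemma isNonanticipative_ucbQuery : IsNonanticipative (ucbQuery sel k σ β) := by
  intro y y' n
  induction n using Nat.strong_induction_on with
  | _ n ih =>
    intro h
    rw [ucbQuery_succ, ucbQuery_succ, ucb_congr (fun i hi => ?_) h]
    obtain ⟨j, rfl⟩ : ∃ j, i = j + 1 := ⟨i - 1, by have := (Finset.mem_Icc.1 hi).1; omega⟩
    rw [Finset.mem_Icc] at hi
    refine ih j (by omega) fun l hl => h l ?_
    simp only [Finset.mem_Icc] at *
    omega

lemma continuous_ucb [TopologicalSpace X] (hk : Continuous fun p : X × X => k p.1 p.2)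
    (x : ℕ → X) (y : ℕ → ℝ) (n : ℕ) : Continuous (ucb k σ β x y n) :=
  (continuous_gpMean hk x y _).add (continuous_const.mul (continuous_gpSd hk x _))

/-- Each query is the measurable selection rule applied to a random acquisition function, whose
evaluations are measurable by strong induction over the earlier queries. -/
lemma measurable_ucbQuery [TopologicalSpace X] [MeasurableSpace X]
    (hk : Continuous fun p : X × X => k p.1 p.2) (hk' : Measurable fun p : X × X => k p.1 p.2)
    (hsel : IsArgmaxRule sel) (t : ℕ) : Measurable fun y => ucbQuery sel k σ β y t := by
  induction t using Nat.strong_induction_on with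
  | _ t ih =>
    rcases t with _ | n
    · exact measurable_const
    · simp only [ucbQuery_succ]
      have h1 : Measurable fun y : ℕ → ℝ =>
          (⟨ucb k σ β (ucbQuery sel k σ β y) y n, continuous_ucb hk _ y n⟩ :
            {g : X → ℝ // Continuous g}) := by
        refine Measurable.subtype_mk (measurable_pi_lambda _ fun z => ?_)
        have hx : ∀ i ∈ Finset.Icc 1 n, Measurable fun y => ucbQuery sel k σ β y i :=
          fun i hi => ih i (by rw [Finset.mem_Icc] at hi; omega)
        exact (measurable_gpMean hk' hx (fun i _ => measurable_pi_apply i) measurable_const).add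
          (measurable_const.mul (measurable_gpSd hk' hx measurable_const))
      exact (hsel.measurable (n + 1)).comp h1

/-- The observations when the queries of a design `d` are answered for `n` rounds according to the
objective `g`, with noise `e`; the entries after round `n` are pure noise. -/
def response (d : (ℕ → ℝ) → ℕ → X) (g : X → ℝ) (e : ℕ → ℝ) : ℕ → ℕ → ℝ
  | 0 => e
  -- At stage `n` the entry `n + 1` is still pure noise. One round is therefore the translation of a
  -- single coordinate by a function of the earlier ones, the form in which the change of measure is
  -- carried out.
  | n + 1 => Function.update (response d g e n) (n + 1)
      (response d g e n (n + 1) + g (d (response d g e n) (n + 1)))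

lemma response_of_lt (d : (ℕ → ℝ) → ℕ → X) (g : X → ℝ) (e : ℕ → ℝ) {n i : ℕ} (h : n < i) :
    response d g e n i = e i := by
  induction n with
  | zero => rfl
  | succ n ih => rw [response, Function.update_of_ne (by omega), ih (by omega)]

lemma response_of_le (d : (ℕ → ℝ) → ℕ → X) (g : X → ℝ) (e : ℕ → ℝ) {n m i : ℕ} (h : i ≤ n)
    (hnm : n ≤ m) : response d g e m i = response d g e n i := by
  induction m, hnm using Nat.le_induction with
  | base => rfl
  | succ m hm ih => rw [response, Function.update_of_ne (by omega), ih]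

lemma response_succ {d : (ℕ → ℝ) → ℕ → X} (hd : IsNonanticipative d) (g : X → ℝ) (e : ℕ → ℝ)
    {n m : ℕ} (h : n + 1 ≤ m) :
    response d g e m (n + 1) = g (d (response d g e m) (n + 1)) + e (n + 1) := by
  rw [response_of_le d g e le_rfl h, response, Function.update_self,
    response_of_lt d g e (Nat.lt_succ_self n), add_comm]
  congr 2
  refine hd _ _ n fun i hi => ?_
  exact (response_of_le d g e (Finset.mem_Icc.1 hi).2 (by omega)).symm

lemma measurable_response {α : Type*} [MeasurableSpace α] [MeasurableSpace X]
    {d : (ℕ → ℝ) → ℕ → X} (hd : ∀ t, Measurable fun y => d y t) {g : α → X → ℝ}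
    (hg : Measurable fun p : α × X => g p.1 p.2) {e : α → ℕ → ℝ} (he : Measurable e) (n : ℕ) :
    Measurable fun a => response d (g a) (e a) n := by
  induction n with
  | zero => exact he
  | succ n ih =>
    refine measurable_pi_lambda _ fun i => ?_
    simp only [response]
    rcases eq_or_ne i (n + 1) with rfl | h
    · simp only [Function.update_self]
      exact ((measurable_pi_apply _).comp ih).add
        (hg.comp (measurable_id.prodMk ((hd (n + 1)).comp ih)))
    · simp only [Function.update_of_ne h]
      exact (measurable_pi_apply i).comp ih

/-- A run of GP-UCB is determined by the objective and the noise. -/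
lemma eq_ucbQuery_of_run {g : X → ℝ} {e : ℕ → ℝ} {x : ℕ → X} {y : ℕ → ℝ} {n T : ℕ} (hnT : n ≤ T)
    (hy : ∀ t ∈ Finset.Icc 1 n, y t = g (x t) + e t)
    (hx : ∀ t ∈ Finset.Icc 1 n, x t = sel t (ucb k σ β x y (t - 1))) :
    ∀ t ∈ Finset.Icc 1 n, x t = ucbQuery sel k σ β (response (ucbQuery sel k σ β) g e T) t ∧
      y t = response (ucbQuery sel k σ β) g e T t := by
  intro t
  induction t using Nat.strong_induction_on with
  | _ t ih =>
    intro ht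
    obtain ⟨j, rfl⟩ : ∃ j, t = j + 1 := ⟨t - 1, by have := (Finset.mem_Icc.1 ht).1; omega⟩
    have hj := Finset.mem_Icc.1 ht
    have h1 : x (j + 1) =
        ucbQuery sel k σ β (response (ucbQuery sel k σ β) g e T) (j + 1) := by
      rw [hx _ ht, ucbQuery_succ, Nat.add_sub_cancel, ucb_congr]
      · exact fun i hi => (ih i (by rw [Finset.mem_Icc] at hi; omega)
          (by simp only [Finset.mem_Icc] at *; omega)).1
      · exact fun i hi => (ih i (by rw [Finset.mem_Icc] at hi; omega)
          (by simp only [Finset.mem_Icc] at *; omega)).2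
    exact ⟨h1, by rw [hy _ ht, response_succ isNonanticipative_ucbQuery g e (by omega), ← h1]⟩

end Design

/-! ### Reduction of both algorithms to GP-UCB, and its regret -/

section Reduction

variable {X H : Type*} [NormedAddCommGroup H] [InnerProductSpace ℝ H]
  {k : X → X → ℝ} {φ : X → H} {κ σ c B N : ℝ} {β : ℕ → ℝ} {T : ℕ}
  {sel : ℕ → (X → ℝ) → X} {f : X → ℝ} {e corr : ℕ → ℝ} {x : ℕ → X}

lemma corr_eq_zero_of_numCorrupt (h : numCorrupt corr T = 0) {t : ℕ} (ht : t ∈ Finset.Icc 1 T) :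
    corr t = 0 := by
  by_contra hc
  rw [numCorrupt, Finset.card_eq_zero] at h
  exact Finset.notMem_empty t (h ▸ Finset.mem_filter.2 ⟨ht, hc⟩)

lemma uncorrupted_eq_Icc (h : numCorrupt corr T = 0) {n : ℕ} (hn : n ≤ T) :
    uncorrupted corr n = Finset.Icc 1 n :=
  Finset.filter_true_of_mem fun i hi => corr_eq_zero_of_numCorrupt h
    (by simp only [Finset.mem_Icc] at *; omega)

lemma observe_y (h : numCorrupt corr T = 0) {t : ℕ} (ht : t ∈ Finset.Icc 1 T) :
    (observe f e corr x).y t = f (x t) + e t := by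
  simp [observe, corr_eq_zero_of_numCorrupt h ht]

/-- The deviation constant is multiplied by `√0`, so neither its value nor the finiteness of its
supremum matters. -/
lemma fixedMult_eq (h : numCorrupt corr T = 0) (t : ℕ) :
    fixedMult ⟨k, κ, σ, c, B, N, β, T⟩ (observe f e corr x) t = √(β t) := by
  simp [fixedMult, observe, h]

lemma adaptMult_eq (h : numCorrupt corr T = 0) (L : ℕ → X → ℝ) (t : ℕ) :
    adaptMult ⟨k, κ, σ, c, B, N, β, T⟩ (observe f e corr x) L t = √(β t) := by
  simp [adaptMult, observe, h]

lemma observe_y_mem_plateau (h : numCorrupt corr T = 0) (hf : ∀ z, |f z| ≤ B)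
    (he : ∀ t ∈ Finset.Icc 1 T, |e t| ≤ N) {t : ℕ} (ht : t ∈ Finset.Icc 1 T) :
    |(observe f e corr x).y t - 0| ≤ B + N := by
  rw [observe_y h ht, sub_zero]
  exact (abs_add_le _ _).trans (add_le_add (hf _) (he t ht))

lemma fixedIsGP (hσ : 0 < σ) (h : numCorrupt corr T = 0) (hf : ∀ z, |f z| ≤ B)
    (he : ∀ t ∈ Finset.Icc 1 T, |e t| ≤ N) :
    FixedIsGP ⟨k, κ, σ, c, B, N, β, T⟩ (observe f e corr x) := by
  have hw : ∀ n ≤ T, ∀ i ∈ Finset.Icc 1 n, ∃ L g,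
      fixedWeight (⟨k, κ, σ, c, B, N, β, T⟩ : Inputs X) = pimq σ c L g ∧
        |(observe f e corr x).y i - g| ≤ L := fun n hn i hi =>
    ⟨B + N, 0, rfl, observe_y_mem_plateau h hf he (Finset.Icc_subset_Icc_right hn hi)⟩
  exact ⟨fun t ht => observe_y_mem_plateau h hf he ht,
    fun n hn z => ⟨rcgpMean_eq_gpMean hσ (hw n hn) z, rcgpVar_eq_gpVar hσ (hw n hn) z⟩,
    fun t _ => fixedMult_eq h t⟩

lemma ucSd_eq (h : numCorrupt corr T = 0) {n : ℕ} (hn : n ≤ T) (z : X) :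
    ucSd ⟨k, κ, σ, c, B, N, β, T⟩ (observe f e corr x) n z = gpSd k σ x (Finset.Icc 1 n) z := by
  rw [ucSd]
  exact congrArg (fun S => gpSd k σ x S z) (uncorrupted_eq_Icc h hn)

/-- The confidence bounds of GP-UCB at its own queries. -/
def IsConfident (sel : ℕ → (X → ℝ) → X) (k : X → X → ℝ) (σ : ℝ) (β : ℕ → ℝ) (T : ℕ) (f : X → ℝ)
    (y : ℕ → ℝ) : Prop :=
  ∀ t ∈ Finset.Icc 1 T,
    |f (ucbQuery sel k σ β y t) -
        gpMean k σ (ucbQuery sel k σ β y) y (Finset.Icc 1 (t - 1)) (ucbQuery sel k σ β y t)| ≤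
      √(β t) * gpSd k σ (ucbQuery sel k σ β y) (Finset.Icc 1 (t - 1)) (ucbQuery sel k σ β y t)

/-- The observations of GP-UCB with objective `f` and noise `e`. -/
def ucbResponse (sel : ℕ → (X → ℝ) → X) (k : X → X → ℝ) (σ : ℝ) (β : ℕ → ℝ) (T : ℕ) (f : X → ℝ)
    (e : ℕ → ℝ) : ℕ → ℝ :=
  response (ucbQuery sel k σ β) f e T

lemma eq_ucbQuery_of_isFCRun (hσ : 0 < σ) (h : numCorrupt corr T = 0) (hf : ∀ z, |f z| ≤ B)
    (he : ∀ t ∈ Finset.Icc 1 T, |e t| ≤ N)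
    (hrun : IsFCRun ⟨k, κ, σ, c, B, N, β, T⟩ sel (observe f e corr x)) :
    ∀ t ∈ Finset.Icc 1 T, x t = ucbQuery sel k σ β (ucbResponse sel k σ β T f e) t := by
  refine fun t ht => (eq_ucbQuery_of_run (y := (observe f e corr x).y) le_rfl
    (fun t ht => observe_y h ht) (fun t ht => ?_) t ht).1
  refine (hrun t ht).trans (congrArg (sel t) (funext fun z => ?_))
  have ht' := Finset.mem_Icc.1 ht
  rw [((fixedIsGP hσ h hf he).2.1 (t - 1) (by change t - 1 ≤ T; omega) z).1, fixedMult_eq h,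
    ucSd_eq h (by omega), ucb, Nat.sub_add_cancel ht'.1]
  rfl

variable {L : ℕ → X → ℝ}

/-- Under the confidence bounds, the half-widths of the adaptive model are large enough. -/
lemma le_adaptWidth (hk : ∀ z z', k z z' = inner ℝ (φ z) (φ z')) (hσ : 0 < σ)
    (hκ : ∀ z z', |k z z'| ≤ κ) (hβ : MonotoneOn β (Set.Ici 1))
    (h : numCorrupt corr T = 0)
    (hL : IsAdaptWidth ⟨k, κ, σ, c, B, N, β, T⟩ (observe f e corr x) L)
    {t : ℕ} (ht : t ∈ Finset.Icc 1 T) (z : X) :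
    √(β t) * gpSd k σ x (Finset.Icc 1 (t - 1)) z + N ≤ L t z := by
  have ht' := Finset.mem_Icc.1 ht
  -- The constant width is large enough because `β` increases and variances are at most `κ`; the
  -- other one because discarding data only increases the standard deviation.
  rcases hL with hL | ⟨ρ, S, _, _, hS, hL⟩
  · rw [hL, fixedMult_eq h]
    change _ ≤ √(β T) * √κ + N
    gcongr
    · exact Real.sqrt_nonneg _
    · exact hβ ht'.1 (le_trans ht'.1 ht'.2) ht'.2
    · refine Real.sqrt_le_sqrt ?_
      exact (gpVar_le_diag hk hσ x _ z).trans ((le_abs_self _).trans (hκ z z))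
  · rw [hL, fixedMult_eq h]
    change _ ≤ √(β t) * gpSd k σ x (S (t - 1)) z + N
    gcongr
    refine gpSd_anti hk hσ x ?_ z
    rw [← uncorrupted_eq_Icc h (by omega : t - 1 ≤ T)]
    exact (hS (t - 1)).1

lemma adaptMean_eq (hσ : 0 < σ) {τ : Trajectory X} {n : ℕ}
    (hp : ∀ t ∈ Finset.Icc 1 n,
      |τ.y t - fixedMean ⟨k, κ, σ, c, B, N, β, T⟩ τ (t - 1) (τ.x t)| ≤ L t (τ.x t)) (z : X) :
    adaptMean ⟨k, κ, σ, c, B, N, β, T⟩ τ L n z = gpMean k σ τ.x τ.y (Finset.Icc 1 n) z :=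
  rcgpMean_eq_gpMean (c := c) hσ (fun i hi => ⟨_, _, rfl, hp i hi⟩) z

lemma adaptVar_eq (hσ : 0 < σ) {τ : Trajectory X} {n : ℕ}
    (hp : ∀ t ∈ Finset.Icc 1 n,
      |τ.y t - fixedMean ⟨k, κ, σ, c, B, N, β, T⟩ τ (t - 1) (τ.x t)| ≤ L t (τ.x t)) (z : X) :
    adaptVar ⟨k, κ, σ, c, B, N, β, T⟩ τ L n z = gpVar k σ τ.x (Finset.Icc 1 n) z :=
  rcgpVar_eq_gpVar (c := c) hσ (fun i hi => ⟨_, _, rfl, hp i hi⟩) z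

lemma isA2Run_reduction (hk : ∀ z z', k z z' = inner ℝ (φ z) (φ z')) (hσ : 0 < σ)
    (hκ : ∀ z z', |k z z'| ≤ κ) (hβ : MonotoneOn β (Set.Ici 1))
    (h : numCorrupt corr T = 0) (hf : ∀ z, |f z| ≤ B) (he : ∀ t ∈ Finset.Icc 1 T, |e t| ≤ N)
    (hconf : IsConfident sel k σ β T f (ucbResponse sel k σ β T f e))
    (hrun : IsA2Run ⟨k, κ, σ, c, B, N, β, T⟩ sel L (observe f e corr x)) :
    AdaptIsGP ⟨k, κ, σ, c, B, N, β, T⟩ (observe f e corr x) L ∧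
    ∀ t ∈ Finset.Icc 1 T, x t = ucbQuery sel k σ β (ucbResponse sel k σ β T f e) t := by
  set I : Inputs X := ⟨k, κ, σ, c, B, N, β, T⟩ with hI
  set τ := observe f e corr x with hτ
  set Y := ucbResponse sel k σ β T f e with hY
  have hGP := fixedIsGP (k := k) (κ := κ) (c := c) (β := β) (x := x) hσ h hf he
  -- Plateau membership and agreement with GP-UCB are proved together. The first up to round `n`
  -- makes the adaptive posterior a GP, hence fixes query `n + 1`; the confidence bound at exactly
  -- this query then gives plateau membership in round `n + 1`.
  have key : ∀ n ≤ T, (∀ t ∈ Finset.Icc 1 n,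
      |τ.y t - fixedMean I τ (t - 1) (τ.x t)| ≤ L t (τ.x t)) ∧
      ∀ t ∈ Finset.Icc 1 n, x t = ucbQuery sel k σ β Y t := by
    intro n
    induction n with
    | zero => simp
    | succ n ih =>
      intro hn
      obtain ⟨ihp, -⟩ := ih (by omega)
      have hrun' : ∀ t ∈ Finset.Icc 1 (n + 1), x t = sel t (ucb k σ β x τ.y (t - 1)) := by
        intro t ht
        have ht' := Finset.mem_Icc.1 ht
        refine (hrun.2 t (Finset.mem_Icc.2 ⟨ht'.1, ht'.2.trans hn⟩)).trans
          (congrArg (sel t) (funext fun z => ?_))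
        rw [adaptMean_eq hσ (fun i hi => ihp i ?_), adaptMult_eq h, ucSd_eq h (by omega), ucb,
          Nat.sub_add_cancel ht'.1]
        · rfl
        · simp only [Finset.mem_Icc] at *
          omega
      have hxy : ∀ t ∈ Finset.Icc 1 (n + 1), x t = ucbQuery sel k σ β Y t ∧ τ.y t = Y t :=
        eq_ucbQuery_of_run (g := f) (e := e) hn (fun t ht => observe_y h
          (Finset.Icc_subset_Icc_right hn ht)) hrun'
      refine ⟨fun t ht => ?_, fun t ht => (hxy t ht).1⟩
      have htT := Finset.Icc_subset_Icc_right hn ht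
      have ht' := Finset.mem_Icc.1 ht
      have h1 : ∀ i ∈ Finset.Icc 1 (t - 1), i ∈ Finset.Icc 1 (n + 1) := fun i hi => by
        simp only [Finset.mem_Icc] at *
        omega
      have h2 := hconf t htT
      rw [← gpMean_congr (x := x) (y := τ.y) (fun i hi => (hxy i (h1 i hi)).1)
        (fun i hi => (hxy i (h1 i hi)).2), ← gpSd_congr (x := x)
        (fun i hi => (hxy i (h1 i hi)).1), ← (hxy t ht).1] at h2
      have h3 := le_adaptWidth hk hσ hκ hβ h hrun.1 htT (x t)
      rw [(hGP.2.1 (t - 1) (by change t - 1 ≤ T; omega) _).1, observe_y h htT]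
      have h4 : f (x t) + e t - gpMean k σ x τ.y (Finset.Icc 1 (t - 1)) (x t) =
        (f (x t) - gpMean k σ x τ.y (Finset.Icc 1 (t - 1)) (x t)) + e t := by ring
      refine le_trans ?_ h3
      change |f (x t) + e t - gpMean k σ x τ.y (Finset.Icc 1 (t - 1)) (x t)| ≤ _
      rw [h4]
      exact (abs_add_le _ _).trans (add_le_add h2 (he t htT))
  have hp := fun n hn => (key n hn).1
  refine ⟨⟨hp T le_rfl, fun n hn z => ⟨?_, ?_⟩, fun t _ => adaptMult_eq h L t⟩, (key T le_rfl).2⟩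
  · exact adaptMean_eq hσ (hp n hn) z
  · exact adaptVar_eq hσ (hp n hn) z

/-- The regret of GP-UCB, when the instantaneous regret is controlled by the posterior standard
deviation at the query up to a summable error. -/
lemma regret_le [Nonempty X] (hk : ∀ z z', k z z' = inner ℝ (φ z) (φ z')) (hσ : 0 < σ)
    (hκ : ∀ z z', |k z z'| ≤ κ) (hβ : MonotoneOn β (Set.Ici 1)) {η : ℝ} (hη : 0 ≤ η)
    (hgap : ∀ t ∈ Finset.Icc 1 T, ∀ z, f z - f (x t) ≤
      2 * √(β t) * gpSd k σ x (Finset.Icc 1 (t - 1)) (x t) + η / t ^ 2) :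
    regret f x T ≤ √(8 * (σ ^ 2 + κ)) * √(T * β T * maxInfoGain k σ T) + 2 * η := by
  have hκ0 : 0 ≤ κ := (abs_nonneg _).trans (hκ (Classical.arbitrary X) (Classical.arbitrary X))
  set s : ℕ → ℝ := fun t => gpSd k σ x (Finset.Icc 1 (t - 1)) (x t)
  have h1 : regret f x T ≤ ∑ t ∈ Finset.Icc 1 T, (2 * √(β T) * s t + η / t ^ 2) := by
    refine Finset.sum_le_sum fun t ht => ?_
    have ht' := Finset.mem_Icc.1 ht
    rw [sub_le_iff_le_add]
    refine ciSup_le fun z => ?_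
    have := hgap t ht z
    have hb : 2 * √(β t) * s t ≤ 2 * √(β T) * s t := by
      have : 0 ≤ s t := Real.sqrt_nonneg _
      gcongr
      exact hβ ht'.1 (le_trans ht'.1 ht'.2) ht'.2
    linarith
  have h2 : ∑ t ∈ Finset.Icc 1 T, s t ≤ √T * √(2 * (σ ^ 2 + κ) * maxInfoGain k σ T) := by
    rw [← Real.sqrt_mul (by positivity)]
    refine Real.le_sqrt_of_sq_le ?_
    refine (sq_sum_le_card_mul_sum_sq (s := Finset.Icc 1 T) (f := s)).trans ?_
    rw [Nat.card_Icc, Nat.add_sub_cancel]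
    gcongr
    have h3 : ∀ t, s t ^ 2 = gpVar k σ x (Finset.Icc 1 (t - 1)) (x t) := fun t =>
      Real.sq_sqrt (gpVar_nonneg hk hσ x _ _)
    simp only [h3]
    refine (sum_gpVar_le hk hσ hκ x T).trans ?_
    have h4 := infoGain_le_maxInfoGain hk hσ hκ x (Finset.Icc 1 T)
    rw [Nat.card_Icc, Nat.add_sub_cancel] at h4
    gcongr
  -- The sum of `1/t²` is at most `2`, whence the additive `2 * η`.
  have h5 : ∑ t ∈ Finset.Icc 1 T, η / (t : ℝ) ^ 2 ≤ 2 * η := by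
    have h6 : ∑ t ∈ Finset.Icc 1 T, ((t : ℝ) ^ 2)⁻¹ ≤ 2 := by
      have h7 := sum_Ioo_inv_sq_le (α := ℝ) 0 (T + 1)
      have h8 : Finset.Ioo 0 (T + 1) = Finset.Icc 1 T := by
        ext i
        simp only [Finset.mem_Ioo, Finset.mem_Icc]
        omega
      rw [h8] at h7
      simpa using h7
    simp only [div_eq_mul_inv]
    rw [← Finset.mul_sum]
    nlinarith
  refine h1.trans ?_
  rw [Finset.sum_add_distrib, ← Finset.mul_sum]
  have hγ := maxInfoGain_nonneg hk hσ hκ T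
  rcases le_or_gt (β T) 0 with hb | hb
  -- A nonpositive `β T` makes the widths vanish by the convention for square roots; the product
  -- rule for roots used afterwards needs `β T > 0`.
  · rw [Real.sqrt_eq_zero_of_nonpos hb]
    have : 0 ≤ √(8 * (σ ^ 2 + κ)) * √(T * β T * maxInfoGain k σ T) := by positivity
    linarith
  have h9 : 2 * √(β T) * (√T * √(2 * (σ ^ 2 + κ) * maxInfoGain k σ T)) =
      √(8 * (σ ^ 2 + κ)) * √(T * β T * maxInfoGain k σ T) := by
    have : (2 : ℝ) = √4 := by
      rw [show (4 : ℝ) = 2 ^ 2 by norm_num, Real.sqrt_sq (by norm_num)]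
    rw [← Real.sqrt_mul (by positivity), ← Real.sqrt_mul (by positivity)]
    nth_rewrite 1 [this]
    rw [← Real.sqrt_mul (by positivity), ← Real.sqrt_mul (by positivity)]
    congr 1
    ring
  have h10 : 2 * √(β T) * ∑ t ∈ Finset.Icc 1 T, s t ≤
      2 * √(β T) * (√T * √(2 * (σ ^ 2 + κ) * maxInfoGain k σ T)) := by gcongr
  linarith

lemma regret_congr {x' : ℕ → X} (hx : ∀ t ∈ Finset.Icc 1 T, x t = x' t) :
    regret f x T = regret f x' T :=
  Finset.sum_congr rfl fun t ht => by rw [hx t ht]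

end Reduction

/-! ### Transfer of the GP-UCB guarantee -/

section ZeroCost

variable {X Ω H : Type*} [TopologicalSpace X] [MeasurableSpace X] [MeasurableSpace Ω]
  [NormedAddCommGroup H] [InnerProductSpace ℝ H]
  {k : X → X → ℝ} {φ : X → H} {κ σ δ N : ℝ} {β : ℕ → ℝ} {T : ℕ} {P : Measure Ω}
  {f : Ω → X → ℝ} {ε : ℕ → Ω → ℝ} {C : ℝ}

/-- The guarantee follows from noise bounds, confidence bounds and a regret bound for GP-UCB. -/
lemma zeroCost_of_ucb (hk : ∀ z z', k z z' = inner ℝ (φ z) (φ z')) (hσ : 0 < σ)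
    (hκ : ∀ z z', |k z z'| ≤ κ) (hβ : MonotoneOn β (Set.Ici 1))
    (hbad : ∀ sel : ℕ → (X → ℝ) → X, IsArgmaxRule sel → ∃ E : Set Ω, P E ≤ ENNReal.ofReal δ ∧
      ∀ᵐ ω ∂P, ω ∉ E → (∀ t ∈ Finset.Icc 1 T, |ε t ω| ≤ N) ∧
        IsConfident sel k σ β T (f ω) (ucbResponse sel k σ β T (f ω) fun t => ε t ω) ∧
        regret (f ω) (ucbQuery sel k σ β (ucbResponse sel k σ β T (f ω) fun t => ε t ω)) T ≤
          C * √(T * β T * maxInfoGain k σ T)) :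
    ZeroCost P k κ σ δ N β T f ε C := by
  intro sel hsel c _ B hB I hI corr hcorr x τ hτ
  -- The bad event is fixed before the run, the corruptions and the bound `B` enter. These need not
  -- be measurable: the failure set is merely contained in `E` up to a null set.
  obtain ⟨E, hE, hgood⟩ := hbad sel hsel
  obtain rfl : I = fun ω => ⟨k, κ, σ, c, B ω, N, β, T⟩ := funext hI
  obtain rfl : τ = fun ω => observe (f ω) (fun t => ε t ω) (corr ω) (x ω) := funext hτ
  constructor
  · intro hrun
    refine (measure_mono_ae ?_).trans hE
    filter_upwards [hB, hcorr, hrun, hgood] with ω h1 h2 h3 h4 hω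
    by_contra hωE
    obtain ⟨h5, -, h7⟩ := h4 hωE
    refine hω ⟨?_, fixedIsGP hσ h2 h1 h5⟩
    exact (regret_congr (eq_ucbQuery_of_isFCRun hσ h2 h1 h5 h3)).trans_le h7
  · intro L hrun
    refine (measure_mono_ae ?_).trans hE
    filter_upwards [hB, hcorr, hrun, hgood] with ω h1 h2 h3 h4 hω
    by_contra hωE
    obtain ⟨h5, h6, h7⟩ := h4 hωE
    obtain ⟨h8, h9⟩ := isA2Run_reduction hk hσ hκ hβ h2 h1 h5 h6 h3
    exact hω ⟨(regret_congr h9).trans_le h7, fixedIsGP hσ h2 h1 h5, h8⟩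

end ZeroCost

/-! ### The self-normalized quadratic form of the noise -/

section NoiseForm

open Matrix

variable {X H : Type*} [NormedAddCommGroup H] [InnerProductSpace ℝ H]
  {k : X → X → ℝ} {φ : X → H} {σ κ : ℝ}

/-- The quadratic form `εᵀ K (K + σ² I)⁻¹ ε / σ²` of the noise. -/
def noiseForm (k : X → X → ℝ) (σ : ℝ) (x : ℕ → X) (e : ℕ → ℝ) (S : Finset ℕ) : ℝ :=
  (∑ i ∈ S, e i ^ 2) / σ ^ 2 -
    (fun i : S => e i) ⬝ᵥ ((regGram k σ x S)⁻¹ *ᵥ fun i : S => e i)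

lemma noiseForm_empty (x : ℕ → X) (e : ℕ → ℝ) : noiseForm k σ x e ∅ = 0 := by
  simp [noiseForm]

lemma noiseForm_insert (hk : ∀ z z', k z z' = inner ℝ (φ z) (φ z')) (hσ : 0 < σ)
    (x : ℕ → X) (e : ℕ → ℝ) {S : Finset ℕ} {t : ℕ} (ht : t ∉ S) :
    noiseForm k σ x e (insert t S) = noiseForm k σ x e S + (e t ^ 2 / σ ^ 2 -
      (e t - gpMean k σ x e S (x t)) ^ 2 / (σ ^ 2 + gpVar k σ x S (x t))) := by
  rw [noiseForm, noiseForm, inv_quadForm_insert hk hσ x e ht, Finset.sum_insert ht]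
  ring

lemma noiseForm_le (hk : ∀ z z', k z z' = inner ℝ (φ z) (φ z')) (hσ : 0 < σ)
    (x : ℕ → X) (e : ℕ → ℝ) (S : Finset ℕ) :
    noiseForm k σ x e S ≤ (∑ i ∈ S, e i ^ 2) / σ ^ 2 := by
  have h := (regGram_posDef hk hσ x S).inv.posSemidef.dotProduct_mulVec_nonneg
    (fun i : S => e i)
  rw [star_trivial] at h
  rw [noiseForm]
  linarith

/-- The coefficients of the kernel ridge regression of the noise. -/
def noiseCoeff (k : X → X → ℝ) (σ : ℝ) (x : ℕ → X) (e : ℕ → ℝ) (S : Finset ℕ) : S → ℝ :=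
  (regGram k σ x S)⁻¹ *ᵥ fun i : S => e i

/-- The values of the kernel ridge regression of the noise at the queries. -/
def noiseFit (k : X → X → ℝ) (σ : ℝ) (x : ℕ → X) (e : ℕ → ℝ) (S : Finset ℕ) : S → ℝ :=
  gram k x S *ᵥ noiseCoeff k σ x e S

lemma noise_eq (hk : ∀ z z', k z z' = inner ℝ (φ z) (φ z')) (hσ : 0 < σ)
    (x : ℕ → X) (e : ℕ → ℝ) (S : Finset ℕ) :
    (fun i : S => e i) = noiseFit k σ x e S + σ ^ 2 • noiseCoeff k σ x e S := by
  rw [← regGram_mulVec_inv hk hσ x S fun i : S => e i]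
  change regGram k σ x S *ᵥ noiseCoeff k σ x e S = _
  rw [regGram, Matrix.add_mulVec, Matrix.smul_mulVec, Matrix.one_mulVec]
  rfl

/-- Writing `e = w + σ² a` with `a = (K + σ²)⁻¹ e` and `w = K a`, the form becomes a squared norm in
`H ⊕ ℝ^S`. It is the partner of `gpVar_eq` in a Cauchy-Schwarz estimate. -/
lemma noiseForm_eq (hk : ∀ z z', k z z' = inner ℝ (φ z) (φ z')) (hσ : 0 < σ)
    (x : ℕ → X) (e : ℕ → ℝ) (S : Finset ℕ) :
    noiseForm k σ x e S = ‖feat φ x S (noiseCoeff k σ x e S)‖ ^ 2 +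
      noiseFit k σ x e S ⬝ᵥ noiseFit k σ x e S / σ ^ 2 := by
  have h1 : ∑ i ∈ S, e i ^ 2 = (fun i : S => e i) ⬝ᵥ (fun i : S => e i) := by
    rw [← Finset.sum_coe_sort]
    exact Finset.sum_congr rfl fun i _ => pow_two _
  have h2 : ‖feat φ x S (noiseCoeff k σ x e S)‖ ^ 2 =
      noiseCoeff k σ x e S ⬝ᵥ noiseFit k σ x e S := by
    rw [← real_inner_self_eq_norm_sq, inner_feat_feat hk, noiseFit]
  have h3 : (fun i : S => e i) ⬝ᵥ ((regGram k σ x S)⁻¹ *ᵥ fun i : S => e i) =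
      (fun i : S => e i) ⬝ᵥ noiseCoeff k σ x e S := rfl
  rw [noiseForm, h1, h2, h3, noise_eq hk hσ x e S]
  simp only [add_dotProduct, dotProduct_add, smul_dotProduct, dotProduct_smul, smul_eq_mul]
  rw [dotProduct_comm (noiseFit k σ x e S) (noiseCoeff k σ x e S)]
  field_simp
  ring

lemma noiseForm_nonneg (hk : ∀ z z', k z z' = inner ℝ (φ z) (φ z')) (hσ : 0 < σ)
    (x : ℕ → X) (e : ℕ → ℝ) (S : Finset ℕ) : 0 ≤ noiseForm k σ x e S := by
  rw [noiseForm_eq hk hσ]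
  have : 0 ≤ noiseFit k σ x e S ⬝ᵥ noiseFit k σ x e S :=
    Finset.sum_nonneg fun i _ => mul_self_nonneg _
  positivity

/-- Cauchy-Schwarz across the two summands, each already bounded by its own Cauchy-Schwarz
inequality. -/
lemma add_sq_le_of_sq_le {A B a b p q : ℝ} (ha : 0 ≤ a) (hb : 0 ≤ b) (hp : 0 ≤ p) (hq : 0 ≤ q)
    (hA : A ^ 2 ≤ a * p) (hB : B ^ 2 ≤ b * q) : (A + B) ^ 2 ≤ (a + b) * (p + q) := by
  have h1 : (A * B) ^ 2 ≤ (a * q) * (b * p) := by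
    have := mul_le_mul hA hB (sq_nonneg _) (by positivity)
    nlinarith
  have h2 : 2 * (A * B) ≤ a * q + b * p := by
    refine (abs_le_of_sq_le_sq' ?_ (by positivity)).2
    nlinarith [sq_nonneg (a * q - b * p)]
  nlinarith

/-- Deterministic confidence bound for kernel ridge regression. -/
lemma abs_sub_gpMean_le (hk : ∀ z z', k z z' = inner ℝ (φ z) (φ z')) (hσ : 0 < σ) (h : H)
    {x : ℕ → X} {y e : ℕ → ℝ} {S : Finset ℕ} (hy : ∀ i ∈ S, y i = inner ℝ (φ (x i)) h + e i)
    (z : X) :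
    |inner ℝ (φ z) h - gpMean k σ x y S z| ≤
      (‖h‖ + √(noiseForm k σ x e S)) * gpSd k σ x S z := by
  set c := gpCoeff k σ x S z
  set u := φ z - feat φ x S c
  set g := feat φ x S (noiseCoeff k σ x e S)
  set w := noiseFit k σ x e S
  have hcc : 0 ≤ c ⬝ᵥ c := Finset.sum_nonneg fun i _ => mul_self_nonneg _
  have hww : 0 ≤ w ⬝ᵥ w := Finset.sum_nonneg fun i _ => mul_self_nonneg _
  have hvar : gpVar k σ x S z = ‖u‖ ^ 2 + σ ^ 2 * (c ⬝ᵥ c) := gpVar_eq hk hσ x S z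
  have hmean : gpMean k σ x y S z = inner ℝ (feat φ x S c) h + c ⬝ᵥ fun i : S => e i := by
    rw [gpMean_eq_gpCoeff hk, feat, sum_inner]
    simp only [dotProduct, ← Finset.sum_add_distrib, inner_smul_left]
    refine Finset.sum_congr rfl fun i _ => ?_
    rw [hy i i.2, mul_add]
    rfl
  -- By symmetry of the inverse, the noise part of the mean is `⟨φ z, g⟩`; splitting `φ z = u + feat
  -- c` pairs `(u, c)` with `(g, w)`.
  have hce : (c ⬝ᵥ fun i : S => e i) = inner ℝ u g + c ⬝ᵥ w := by
    rw [inner_sub_left, inner_feat_feat hk, inner_feat hk]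
    change (c ⬝ᵥ fun i : S => e i) = kvec k x S z ⬝ᵥ noiseCoeff k σ x e S - c ⬝ᵥ w + c ⬝ᵥ w
    rw [sub_add_cancel]
    exact dotProduct_inv_comm hk x S _ _
  have h1 : |inner ℝ u h| ≤ ‖h‖ * gpSd k σ x S z := by
    refine (abs_real_inner_le_norm u h).trans ?_
    rw [mul_comm]
    gcongr
    refine Real.le_sqrt_of_sq_le ?_
    rw [hvar]
    have : 0 ≤ σ ^ 2 * (c ⬝ᵥ c) := by positivity
    linarith
  have h2 : |inner ℝ u g + c ⬝ᵥ w| ≤ √(noiseForm k σ x e S) * gpSd k σ x S z := by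
    rw [gpSd, ← Real.sqrt_mul (noiseForm_nonneg hk hσ x e S), hvar, noiseForm_eq hk hσ, mul_comm]
    refine Real.abs_le_sqrt (add_sq_le_of_sq_le (by positivity) (by positivity) (by positivity)
      (by positivity) ?_ ?_)
    · rw [← mul_pow, sq_le_sq, abs_of_nonneg (by positivity : 0 ≤ ‖u‖ * ‖g‖)]
      exact abs_real_inner_le_norm u g
    · have := Finset.sum_mul_sq_le_sq_mul_sq Finset.univ c w
      have h3 : σ ^ 2 * c ⬝ᵥ c * (w ⬝ᵥ w / σ ^ 2) = (c ⬝ᵥ c) * (w ⬝ᵥ w) := by field_simp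
      rw [h3]
      simpa only [dotProduct, pow_two] using this
  rw [hmean, hce]
  have h3 : inner ℝ (φ z) h - (inner ℝ (feat φ x S c) h + (inner ℝ u g + c ⬝ᵥ w)) =
      inner ℝ u h - (inner ℝ u g + c ⬝ᵥ w) := by
    rw [show inner ℝ u h = inner ℝ (φ z) h - inner ℝ (feat φ x S c) h from inner_sub_left _ _ _]
    ring
  rw [h3, add_mul]
  exact (abs_sub _ _).trans (add_le_add h1 h2)

lemma norm_feat_noise_sq (hk : ∀ z z', k z z' = inner ℝ (φ z) (φ z')) (hσ : 0 < σ)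
    (x : ℕ → X) (e : ℕ → ℝ) (S : Finset ℕ) :
    ‖feat φ x S fun i => e i‖ ^ 2 = ‖feat φ x S (noiseFit k σ x e S)‖ ^ 2 +
      2 * σ ^ 2 * (noiseFit k σ x e S ⬝ᵥ noiseFit k σ x e S) +
      σ ^ 4 * ‖feat φ x S (noiseCoeff k σ x e S)‖ ^ 2 := by
  have h1 : feat φ x S (fun i => e i) =
      feat φ x S (noiseFit k σ x e S) + σ ^ 2 • feat φ x S (noiseCoeff k σ x e S) := by
    rw [noise_eq hk hσ x e S]
    simp only [feat, Pi.add_apply, Pi.smul_apply, smul_eq_mul, add_smul, mul_smul,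
      Finset.sum_add_distrib, Finset.smul_sum]
  rw [h1, norm_add_sq_real, inner_smul_right, inner_feat_feat hk, norm_smul, mul_pow,
    Real.norm_eq_abs, sq_abs]
  change _ + 2 * (σ ^ 2 * noiseFit k σ x e S ⬝ᵥ noiseFit k σ x e S) + _ = _
  ring

/-- In the expansion of the right side all terms are nonnegative, and two of them already dominate
the left side. -/
lemma noiseForm_le_norm_feat (hk : ∀ z z', k z z' = inner ℝ (φ z) (φ z')) (hσ : 0 < σ)
    (x : ℕ → X) (e : ℕ → ℝ) (S : Finset ℕ) :
    σ ^ 4 * noiseForm k σ x e S ≤ ‖feat φ x S fun i => e i‖ ^ 2 := by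
  rw [norm_feat_noise_sq hk hσ, noiseForm_eq hk hσ]
  have hww : 0 ≤ noiseFit k σ x e S ⬝ᵥ noiseFit k σ x e S :=
    Finset.sum_nonneg fun i _ => mul_self_nonneg _
  have h1 : σ ^ 4 * (noiseFit k σ x e S ⬝ᵥ noiseFit k σ x e S / σ ^ 2) =
      σ ^ 2 * (noiseFit k σ x e S ⬝ᵥ noiseFit k σ x e S) := by field_simp
  rw [mul_add, h1]
  have : 0 ≤ σ ^ 2 * (noiseFit k σ x e S ⬝ᵥ noiseFit k σ x e S) := by positivity
  have := sq_nonneg ‖feat φ x S (noiseFit k σ x e S)‖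
  linarith

lemma norm_feat_sq_le (hk : ∀ z z', k z z' = inner ℝ (φ z) (φ z')) (x : ℕ → X) (S : Finset ℕ)
    (c : S → ℝ) : ‖feat φ x S c‖ ^ 2 ≤ (c ⬝ᵥ c) * ∑ i ∈ S, k (x i) (x i) := by
  have h1 : ‖feat φ x S c‖ ≤ ∑ i : S, |c i| * ‖φ (x i)‖ := by
    refine (norm_sum_le _ _).trans (le_of_eq (Finset.sum_congr rfl fun i _ => ?_))
    rw [norm_smul, Real.norm_eq_abs]
  refine (pow_le_pow_left₀ (norm_nonneg _) h1 2).trans ?_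
  refine (Finset.sum_mul_sq_le_sq_mul_sq _ _ _).trans (le_of_eq ?_)
  rw [← Finset.sum_coe_sort S]
  simp only [dotProduct, hk, real_inner_self_eq_norm_sq, pow_two, abs_mul_abs_self]

lemma noiseFit_sq_le (hk : ∀ z z', k z z' = inner ℝ (φ z) (φ z')) (x : ℕ → X)
    (e : ℕ → ℝ) (S : Finset ℕ) :
    noiseFit k σ x e S ⬝ᵥ noiseFit k σ x e S ≤
      ‖feat φ x S (noiseCoeff k σ x e S)‖ ^ 2 * ∑ i ∈ S, k (x i) (x i) := by
  rw [← Finset.sum_coe_sort S, Finset.mul_sum]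
  refine Finset.sum_le_sum fun i _ => ?_
  have h1 : noiseFit k σ x e S i = inner ℝ (φ (x i)) (feat φ x S (noiseCoeff k σ x e S)) := by
    rw [inner_feat hk]
    rfl
  rw [h1, hk]
  have := real_inner_mul_inner_self_le (φ (x i)) (feat φ x S (noiseCoeff k σ x e S))
  rw [real_inner_self_eq_norm_sq (feat φ x S (noiseCoeff k σ x e S))] at this
  linarith

/-- A converse when the trace is at most `4σ²`. Then `‖Φw‖² ≤ 4σ²|w|²` leaves `6σ²|w|² + σ⁴‖g‖²`,
and moving one `σ²|w|² ≤ 4σ⁴‖g‖²` to the second term gives `5` on both. -/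
lemma norm_feat_le_noiseForm (hk : ∀ z z', k z z' = inner ℝ (φ z) (φ z')) (hσ : 0 < σ)
    {x : ℕ → X} (e : ℕ → ℝ) {S : Finset ℕ} (htr : ∑ i ∈ S, k (x i) (x i) ≤ 4 * σ ^ 2) :
    ‖feat φ x S fun i => e i‖ ^ 2 ≤ 5 * (σ ^ 4 * noiseForm k σ x e S) := by
  rw [norm_feat_noise_sq hk hσ, noiseForm_eq hk hσ]
  set w := noiseFit k σ x e S
  set g := feat φ x S (noiseCoeff k σ x e S)
  have hww : 0 ≤ w ⬝ᵥ w := Finset.sum_nonneg fun i _ => mul_self_nonneg _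
  have h1 : σ ^ 4 * (w ⬝ᵥ w / σ ^ 2) = σ ^ 2 * (w ⬝ᵥ w) := by field_simp
  have h2 : ‖feat φ x S w‖ ^ 2 ≤ (w ⬝ᵥ w) * (4 * σ ^ 2) :=
    (norm_feat_sq_le hk x S w).trans (mul_le_mul_of_nonneg_left htr hww)
  have h3 : w ⬝ᵥ w ≤ ‖g‖ ^ 2 * (4 * σ ^ 2) :=
    (noiseFit_sq_le hk x e S).trans (mul_le_mul_of_nonneg_left htr (sq_nonneg _))
  have h4 : σ ^ 2 * (w ⬝ᵥ w) ≤ σ ^ 2 * (‖g‖ ^ 2 * (4 * σ ^ 2)) := by gcongr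
  rw [mul_add, h1]
  nlinarith

/-- Comparison of the noise forms of a kernel and of a multiple of it. -/
lemma noiseForm_le_noiseForm_smul (hk : ∀ z z', k z z' = inner ℝ (φ z) (φ z')) (hσ : 0 < σ)
    {x : ℕ → X} (e : ℕ → ℝ) {S : Finset ℕ} {r : ℝ} (hr : 0 < r)
    (htr : ∑ i ∈ S, r * k (x i) (x i) ≤ 4 * σ ^ 2) :
    r * noiseForm k σ x e S ≤ 5 * noiseForm (fun z z' => r * k z z') σ x e S := by
  have hk' : ∀ z z', r * k z z' = inner ℝ (√r • φ z) (√r • φ z') := fun z z' => by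
    rw [inner_smul_left, inner_smul_right, ← mul_assoc, hk]
    simp [Real.mul_self_sqrt hr.le]
  have h1 := norm_feat_le_noiseForm (φ := fun z => √r • φ z) hk' hσ e htr
  have h2 : feat (fun z => √r • φ z) x S (fun i => e i) = √r • feat φ x S fun i => e i := by
    simp only [feat, Finset.smul_sum]
    exact Finset.sum_congr rfl fun i _ => smul_comm _ _ _
  rw [h2, norm_smul, mul_pow, Real.norm_eq_abs, sq_abs, Real.sq_sqrt hr.le] at h1
  have h3 := noiseForm_le_norm_feat hk hσ x e S
  have h4 : 0 < σ ^ 4 := by positivity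
  have h5 : r * (σ ^ 4 * noiseForm k σ x e S) ≤ r * ‖feat φ x S fun i => e i‖ ^ 2 := by gcongr
  refine le_of_mul_le_mul_left ?_ h4
  linarith

end NoiseForm

/-! ### One-step exponential inequality for bounded noise -/

section ExpBound

/-- The chord of a likelihood ratio on `[-σ, σ]`. -/
def chordSlope (σ m s : ℝ) : ℝ :=
  (Real.exp (1 / 2 * (1 - (σ - m) ^ 2 / (σ ^ 2 + s)) - 1 / 2 * Real.log (1 + s / σ ^ 2)) -
    Real.exp (1 / 2 * (1 - (-σ - m) ^ 2 / (σ ^ 2 + s)) - 1 / 2 * Real.log (1 + s / σ ^ 2))) / (2 * σ)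

/-- The bound is affine in the noise, so only its conditional mean zero is used afterwards. The
ratio is convex on `[-σ, σ]` and hence below its chord, and the chord is at most `1` at zero. -/
lemma exp_likelihood_le {σ m s e : ℝ} (hσ : 0 < σ) (hs : 0 ≤ s) (he : |e| ≤ σ) :
    Real.exp (1 / 2 * (e ^ 2 / σ ^ 2 - (e - m) ^ 2 / (σ ^ 2 + s)) -
      1 / 2 * Real.log (1 + s / σ ^ 2)) ≤ 1 + chordSlope σ m s * e := by
  set l := 1 / 2 * Real.log (1 + s / σ ^ 2) with hl
  set q : ℝ → ℝ := fun v => 1 / 2 * (v ^ 2 / σ ^ 2 - (v - m) ^ 2 / (σ ^ 2 + s)) - l with hq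
  have hqp : q σ = 1 / 2 * (1 - (σ - m) ^ 2 / (σ ^ 2 + s)) - l := by
    simp only [hq]; field_simp
  have hqm : q (-σ) = 1 / 2 * (1 - (-σ - m) ^ 2 / (σ ^ 2 + s)) - l := by
    simp only [hq, neg_sq]; field_simp
  obtain ⟨he1, he2⟩ := abs_le.1 he
  set p := (1 + e / σ) / 2 with hp
  have hp0 : 0 ≤ p := by
    have : -1 ≤ e / σ := by rw [le_div_iff₀ hσ]; linarith
    rw [hp]; linarith
  have hp1 : 0 ≤ 1 - p := by
    have : e / σ ≤ 1 := by rw [div_le_iff₀ hσ]; linarith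
    rw [hp]; linarith
  have hep : e = p * σ + (1 - p) * (-σ) := by rw [hp]; field_simp; ring
  -- The exponent is a quadratic in the noise with leading coefficient `(1/σ² - 1/(σ² + s))/2 ≥ 0`.
  have hconv : q e ≤ p * q σ + (1 - p) * q (-σ) := by
    have h1 : p * q σ + (1 - p) * q (-σ) - q e =
        2 * (p * (1 - p)) * σ ^ 2 * (1 / σ ^ 2 - 1 / (σ ^ 2 + s)) := by
      rw [hep]
      simp only [hq]
      field_simp
      ring
    have h2 : 1 / (σ ^ 2 + s) ≤ 1 / σ ^ 2 := by
      gcongr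
      linarith
    have h3 : 0 ≤ 2 * (p * (1 - p)) * σ ^ 2 * (1 / σ ^ 2 - 1 / (σ ^ 2 + s)) :=
      mul_nonneg (by positivity) (sub_nonneg.2 h2)
    linarith
  have hexp : Real.exp (q e) ≤ p * Real.exp (q σ) + (1 - p) * Real.exp (q (-σ)) := by
    refine (Real.exp_le_exp.2 hconv).trans ?_
    exact convexOn_exp.2 (Set.mem_univ _) (Set.mem_univ _) hp0 hp1 (by ring)
  -- The chord at zero is the expectation under a random sign of size `σ`. The bound `cosh x ≤
  -- exp(x²/2)` reduces it to the Gaussian computation: the logarithm absorbs `s/r`, and `m²/r`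
  -- absorbs the exponent from `cosh`.
  have hmid : 1 / 2 * (Real.exp (q σ) + Real.exp (q (-σ))) ≤ 1 := by
    set r := σ ^ 2 + s with hr
    have hr0 : 0 < r := by positivity
    have h1 : Real.exp (q σ) + Real.exp (q (-σ)) =
        2 * (Real.exp (1 / 2 * (1 - (σ ^ 2 + m ^ 2) / r) - l) * Real.cosh (m * σ / r)) := by
      rw [hqp, hqm, Real.cosh_eq]
      rw [show 1 / 2 * (1 - (σ - m) ^ 2 / r) - l =
        (1 / 2 * (1 - (σ ^ 2 + m ^ 2) / r) - l) + m * σ / r by field_simp; ring,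
        show 1 / 2 * (1 - (-σ - m) ^ 2 / r) - l =
        (1 / 2 * (1 - (σ ^ 2 + m ^ 2) / r) - l) + -(m * σ / r) by field_simp; ring,
        Real.exp_add, Real.exp_add (1 / 2 * (1 - (σ ^ 2 + m ^ 2) / r) - l)]
      ring
    have h2 := Real.cosh_le_exp_half_sq (m * σ / r)
    have h3 : Real.exp (1 / 2 * (1 - (σ ^ 2 + m ^ 2) / r) - l) * Real.cosh (m * σ / r) ≤
        Real.exp ((1 / 2 * (1 - (σ ^ 2 + m ^ 2) / r) - l) + (m * σ / r) ^ 2 / 2) := by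
      rw [Real.exp_add]
      gcongr
    have h4 : (1 / 2 * (1 - (σ ^ 2 + m ^ 2) / r) - l) + (m * σ / r) ^ 2 / 2 ≤ 0 := by
      have h5 : s / r ≤ 2 * l := by
        have h6 := Real.one_sub_inv_le_log_of_pos (x := 1 + s / σ ^ 2) (by positivity)
        have h7 : 1 - (1 + s / σ ^ 2)⁻¹ = s / r := by
          rw [hr]
          field_simp
          ring
        rw [h7] at h6
        rw [hl]
        linarith
      have h8 : (m * σ / r) ^ 2 ≤ m ^ 2 / r := by
        rw [div_pow, div_le_div_iff₀ (by positivity) hr0]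
        have : m ^ 2 * (r * s) ≥ 0 := by positivity
        have e1 : r = σ ^ 2 + s := hr
        nlinarith
      have h9 : 1 - (σ ^ 2 + m ^ 2) / r = s / r - m ^ 2 / r := by
        rw [hr]
        field_simp
        ring
      rw [h9]
      linarith
    have h5 := Real.exp_le_one_iff.2 h4
    rw [h1]
    linarith
  have hfin : p * Real.exp (q σ) + (1 - p) * Real.exp (q (-σ)) =
      1 / 2 * (Real.exp (q σ) + Real.exp (q (-σ))) + chordSlope σ m s * e := by
    rw [chordSlope, ← hl, ← hqp, ← hqm, hp]
    field_simp
    ring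
  change Real.exp (q e) ≤ _
  linarith

lemma abs_chordSlope_le {σ m s : ℝ} (hσ : 0 < σ) (hs : 0 ≤ s) :
    |chordSlope σ m s| ≤ Real.exp (1 / 2) / (2 * σ) := by
  have h : ∀ v : ℝ, Real.exp (1 / 2 * (1 - (v - m) ^ 2 / (σ ^ 2 + s)) -
      1 / 2 * Real.log (1 + s / σ ^ 2)) ≤ Real.exp (1 / 2) := fun v => by
    rw [Real.exp_le_exp]
    have h1 : 0 ≤ (v - m) ^ 2 / (σ ^ 2 + s) := by positivity
    have h2 : 0 ≤ Real.log (1 + s / σ ^ 2) :=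
      Real.log_nonneg (le_add_of_nonneg_right (by positivity))
    linarith
  rw [chordSlope, abs_div, abs_of_pos (by positivity : 0 < 2 * σ)]
  gcongr
  exact abs_sub_le_of_nonneg_of_le (Real.exp_pos _).le (h _) (Real.exp_pos _).le (h _)

end ExpBound

/-! ### Designs driven by the noise, for a fixed objective -/

section ResponseCongr

variable {X : Type*}

lemma response_congr {d : (ℕ → ℝ) → ℕ → X} (hd : IsNonanticipative d) (g : X → ℝ)
    {e e' : ℕ → ℝ} {n : ℕ} (T : ℕ) (h : ∀ i ∈ Finset.Icc 1 n, e i = e' i) :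
    ∀ i ∈ Finset.Icc 1 n, response d g e T i = response d g e' T i := by
  intro i
  induction i using Nat.strong_induction_on with
  | _ i ih =>
    intro hi
    obtain ⟨j, rfl⟩ : ∃ j, i = j + 1 := ⟨i - 1, by have := (Finset.mem_Icc.1 hi).1; omega⟩
    rcases le_or_gt (j + 1) T with hjT | hjT
    · rw [response_succ hd g e hjT, response_succ hd g e' hjT, h _ hi,
        hd _ (response d g e' T) j fun l hl => ih l ?_ ?_]
      · rw [Finset.mem_Icc] at hl; omega
      · simp only [Finset.mem_Icc] at *; omega
    · rw [response_of_lt d g e hjT, response_of_lt d g e' hjT, h _ hi]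

/-- The queries of a design as a function of the noise. -/
def noiseDesign (d : (ℕ → ℝ) → ℕ → X) (g : X → ℝ) (T : ℕ) (e : ℕ → ℝ) : ℕ → X :=
  d (response d g e T)

lemma IsNonanticipative.noiseDesign {d : (ℕ → ℝ) → ℕ → X} (hd : IsNonanticipative d) (g : X → ℝ)
    (T : ℕ) : IsNonanticipative (noiseDesign d g T) :=
  fun _ _ n h => hd _ _ n (response_congr hd g T h)

end ResponseCongr

/-! ### The likelihood mixture and its one-step bound -/

section Likelihood

variable {X H : Type*} [NormedAddCommGroup H] [InnerProductSpace ℝ H]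
  {k : X → X → ℝ} {φ : X → H} {σ : ℝ} {q : (ℕ → ℝ) → ℕ → X}

lemma gram_congr {x x' : ℕ → X} {S : Finset ℕ} (hx : ∀ i ∈ S, x i = x' i) :
    gram k x S = gram k x' S := by
  ext i j
  simp [gram, hx i i.2, hx j j.2]

/-- The mixture of likelihood ratios as a function of the noise. -/
def noiseLikelihood (k : X → X → ℝ) (σ : ℝ) (q : (ℕ → ℝ) → ℕ → X) (n : ℕ) (e : ℕ → ℝ) : ℝ :=
  Real.exp (1 / 2 * noiseForm k σ (q e) e (Finset.Icc 1 n) -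
    infoGain k σ (q e) (Finset.Icc 1 n))

/-- The slope in the noise of round `n + 1` of the bound on the next likelihood. -/
def likelihoodSlope (k : X → X → ℝ) (σ : ℝ) (q : (ℕ → ℝ) → ℕ → X) (n : ℕ) (e : ℕ → ℝ) : ℝ :=
  noiseLikelihood k σ q n e * chordSlope σ
    (gpMean k σ (q e) e (Finset.Icc 1 n) (q e (n + 1)))
    (gpVar k σ (q e) (Finset.Icc 1 n) (q e (n + 1)))

lemma noiseLikelihood_congr (hq : IsNonanticipative q) {n : ℕ} {e e' : ℕ → ℝ}
    (h : ∀ i ∈ Finset.Icc 1 n, e i = e' i) :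
    noiseLikelihood k σ q n e = noiseLikelihood k σ q n e' := by
  have hx : ∀ i ∈ Finset.Icc 1 n, q e i = q e' i := fun i hi =>
    hq.congr h i (Finset.Icc_subset_Icc_right n.le_succ hi)
  have he : (fun i : ↥(Finset.Icc 1 n) => e i) = fun i : ↥(Finset.Icc 1 n) => e' i :=
    funext fun i => h i i.2
  rw [noiseLikelihood, noiseLikelihood, noiseForm, noiseForm, infoGain, infoGain, regGram, regGram,
    gram_congr hx, he, Finset.sum_congr rfl fun i hi => by rw [h i hi]]

lemma noiseLikelihood_le (hk : ∀ z z', k z z' = inner ℝ (φ z) (φ z')) (hσ : 0 < σ) {n : ℕ}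
    {e : ℕ → ℝ} (he : ∀ i, |e i| ≤ σ) : noiseLikelihood k σ q n e ≤ Real.exp (n / 2) := by
  refine Real.exp_le_exp.2 ?_
  have h1 := infoGain_nonneg hk hσ (q e) (Finset.Icc 1 n)
  have h2 := noiseForm_le hk hσ (q e) e (Finset.Icc 1 n)
  have h3 : (∑ i ∈ Finset.Icc 1 n, e i ^ 2) / σ ^ 2 ≤ n := by
    rw [div_le_iff₀ (by positivity)]
    refine (Finset.sum_le_card_nsmul _ _ (σ ^ 2) fun i _ => ?_).trans (le_of_eq ?_)
    · exact sq_le_sq' (abs_le.1 (he i)).1 (abs_le.1 (he i)).2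
    · simp
  linarith

lemma noiseLikelihood_succ_le (hk : ∀ z z', k z z' = inner ℝ (φ z) (φ z')) (hσ : 0 < σ) {n : ℕ}
    {e : ℕ → ℝ} (he : |e (n + 1)| ≤ σ) :
    noiseLikelihood k σ q (n + 1) e ≤ noiseLikelihood k σ q n e +
      likelihoodSlope k σ q n e * e (n + 1) := by
  have hs := gpVar_nonneg hk hσ (q e) (Finset.Icc 1 n) (q e (n + 1))
  have h1 := exp_likelihood_le (m := gpMean k σ (q e) e (Finset.Icc 1 n) (q e (n + 1))) hσ hs he
  rw [noiseLikelihood, Icc_one_succ, noiseForm_insert hk hσ _ _ (succ_notMem_Icc n),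
    infoGain_insert hk hσ _ (succ_notMem_Icc n)]
  rw [show ∀ a b c d : ℝ, 1 / 2 * (a + b) - (c + d) = (1 / 2 * a - c) + (1 / 2 * b - d) by
    intros; ring, Real.exp_add]
  refine (mul_le_mul_of_nonneg_left h1 (Real.exp_pos _).le).trans (le_of_eq ?_)
  rw [likelihoodSlope, noiseLikelihood]
  ring

lemma likelihoodSlope_congr (hq : IsNonanticipative q) {n : ℕ} {e e' : ℕ → ℝ}
    (h : ∀ i ∈ Finset.Icc 1 n, e i = e' i) :
    likelihoodSlope k σ q n e = likelihoodSlope k σ q n e' := by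
  have hx : ∀ i ∈ Finset.Icc 1 n, q e i = q e' i := fun i hi =>
    hq.congr h i (Finset.Icc_subset_Icc_right n.le_succ hi)
  rw [likelihoodSlope, likelihoodSlope, noiseLikelihood_congr hq h, gpMean_congr hx h,
    gpVar_congr hx, hq e e' n h]

lemma noiseLikelihood_nonneg (n : ℕ) (e : ℕ → ℝ) : 0 ≤ noiseLikelihood k σ q n e :=
  (Real.exp_pos _).le

/-- Serves only integrability and the extraction of the slope from a conditional expectation, so
growth in `n` is harmless. -/
lemma abs_likelihoodSlope_le (hk : ∀ z z', k z z' = inner ℝ (φ z) (φ z')) (hσ : 0 < σ) {n : ℕ}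
    {e : ℕ → ℝ} (he : ∀ i, |e i| ≤ σ) :
    |likelihoodSlope k σ q n e| ≤ Real.exp (n / 2) * (Real.exp (1 / 2) / (2 * σ)) := by
  rw [likelihoodSlope, abs_mul, abs_of_nonneg (noiseLikelihood_nonneg n e)]
  exact mul_le_mul (noiseLikelihood_le hk hσ he)
    (abs_chordSlope_le hσ (gpVar_nonneg hk hσ _ _ _)) (abs_nonneg _) (Real.exp_pos _).le

end Likelihood

/-! ### Supermartingale property and self-normalized tail -/

section Supermartingale

variable {X H : Type*} [NormedAddCommGroup H] [InnerProductSpace ℝ H] [MeasurableSpace X]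
  {k : X → X → ℝ} {φ : X → H} {σ κ : ℝ} {α : Type*} [MeasurableSpace α]

lemma measurable_infoGain (hk : Measurable fun p : X × X => k p.1 p.2)
    {S : Finset ℕ} {x : α → ℕ → X} (hx : ∀ i ∈ S, Measurable fun a => x a i) :
    Measurable fun a => infoGain k σ (x a) S := by
  have hA' : Measurable fun a => (fun p : S × S => k (x a p.1) (x a p.2)) :=
    measurable_pi_lambda _ fun p => hk.comp ((hx _ p.1.2).prodMk (hx _ p.2.2))
  have hdet : Continuous fun B : S × S → ℝ =>
      (1 + (σ ^ 2)⁻¹ • (Matrix.of fun i j => B (i, j) : Matrix S S ℝ)).det :=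
    Continuous.matrix_det (by fun_prop)
  exact ((hdet.measurable.comp hA').log).const_mul _

lemma measurable_noiseForm (hk : Measurable fun p : X × X => k p.1 p.2)
    {S : Finset ℕ} {x : α → ℕ → X} {e : α → ℕ → ℝ} (hx : ∀ i ∈ S, Measurable fun a => x a i)
    (he : ∀ i ∈ S, Measurable fun a => e a i) :
    Measurable fun a => noiseForm k σ (x a) (e a) S := by
  refine Measurable.sub ((Finset.measurable_fun_sum _ fun i hi => (he i hi).pow_const 2).div_const _)
    ?_
  refine Finset.measurable_fun_sum _ fun i _ => (he i i.2).mul ?_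
  exact Finset.measurable_fun_sum _ fun j _ =>
      (measurable_regGram_inv_apply hk hx i j).mul (he j j.2)

variable {Ω : Type*} [MeasurableSpace Ω] {P : Measure Ω} [IsProbabilityMeasure P]
  {ε : ℕ → Ω → ℝ}

/-- The σ-algebra of the noise of the rounds `1, …, n`. -/
abbrev pastNoise (ε : ℕ → Ω → ℝ) (n : ℕ) : MeasurableSpace Ω :=
  ⨆ i ∈ Finset.Ico 1 (n + 1), MeasurableSpace.comap (ε i) inferInstance

/-- The noise of round `n + 1` is orthogonal to bounded functions of the past noise. -/
lemma IsBoundedNoise.integral_mul_eq_zero (hε : IsBoundedNoise P σ ε) {ζ : (ℕ → ℝ) → ℝ} {n : ℕ}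
    (hζ : Measurable ζ) (hdep : ∀ e e', (∀ i ∈ Finset.Icc 1 n, e i = e' i) → ζ e = ζ e')
    {M : ℝ} (hM : ∀ᵐ ω ∂P, |ζ fun i => ε i ω| ≤ M) :
    ∫ ω, (ζ fun i => ε i ω) * ε (n + 1) ω ∂P = 0 := by
  have hFle : pastNoise ε n ≤ inferInstanceAs (MeasurableSpace Ω) :=
    iSup₂_le fun i _ => (hε.measurable i).comap_le
  have hmeas : Measurable[pastNoise ε n] fun ω => ζ fun i => ε i ω := by
    -- Zeroing all coordinates outside rounds `1, …, n` does not change the value and exhibits it as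
    -- a function of the past noise.
    have h1 : (fun ω => ζ fun i => ε i ω) =
        fun ω => ζ fun i => if i ∈ Finset.Icc 1 n then ε i ω else 0 := by
      ext ω
      exact hdep _ _ fun i hi => by rw [if_pos hi]
    rw [h1]
    refine @Measurable.comp _ _ _ (pastNoise ε n) _ _ _ _ hζ
      (@measurable_pi_lambda _ _ _ (pastNoise ε n) _ _ fun i => ?_)
    by_cases hi : i ∈ Finset.Icc 1 n
    · simp only [if_pos hi]
      have hle : MeasurableSpace.comap (ε i) inferInstance ≤ pastNoise ε n :=
        le_iSup₂_of_le i (by simp only [Finset.mem_Icc, Finset.mem_Ico] at *; omega) le_rfl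
      exact (comap_measurable (ε i)).mono hle le_rfl
    · simp only [if_neg hi]
      exact @measurable_const _ _ _ (pastNoise ε n) _
  have hint : Integrable (ε (n + 1)) P :=
    Integrable.of_bound (hε.measurable _).aestronglyMeasurable σ
      ((hε.bounded (n + 1)).mono fun ω h => by simpa using h)
  have hpull := condExp_stronglyMeasurable_mul_of_bound hFle hmeas.stronglyMeasurable hint M
    (hM.mono fun ω h => by simpa using h)
  have hcent : P[ε (n + 1) | pastNoise ε n] =ᵐ[P] 0 := hε.centered (n + 1) (by omega)
  have h2 := integral_condExp hFle (μ := P)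
    (f := (fun ω => ζ fun i => ε i ω) * ε (n + 1))
  calc ∫ ω, (ζ fun i => ε i ω) * ε (n + 1) ω ∂P
      = ∫ ω, (P[(fun ω => ζ fun i => ε i ω) * ε (n + 1) | pastNoise ε n]) ω ∂P := h2.symm
    _ = ∫ _, (0 : ℝ) ∂P := by
        refine integral_congr_ae ?_
        filter_upwards [hpull, hcent] with ω h3 h4
        rw [h3, Pi.mul_apply, h4]
        simp
    _ = 0 := by simp

variable {q : (ℕ → ℝ) → ℕ → X}

lemma measurable_noiseLikelihood (hkm : Measurable fun p : X × X => k p.1 p.2)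
    (hq : ∀ t, Measurable fun e => q e t) (n : ℕ) : Measurable (noiseLikelihood k σ q n) :=
  ((((measurable_noiseForm hkm (fun i _ => hq i) fun i _ => measurable_pi_apply i).const_mul _).sub
    (measurable_infoGain hkm fun i _ => hq i))).exp

lemma measurable_chordSlope {m s : α → ℝ} (hm : Measurable m) (hs : Measurable s) :
    Measurable fun a => chordSlope σ (m a) (s a) := by
  unfold chordSlope
  fun_prop

lemma measurable_likelihoodSlope (hkm : Measurable fun p : X × X => k p.1 p.2)
    (hqm : ∀ t, Measurable fun e => q e t) (n : ℕ) : Measurable (likelihoodSlope k σ q n) := by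
  have hm : Measurable fun e => gpMean k σ (q e) e (Finset.Icc 1 n) (q e (n + 1)) :=
    measurable_gpMean hkm (fun i _ => hqm i) (fun i _ => measurable_pi_apply i) (hqm _)
  have hs : Measurable fun e => gpVar k σ (q e) (Finset.Icc 1 n) (q e (n + 1)) :=
    measurable_gpVar hkm (fun i _ => hqm i) (hqm _)
  unfold likelihoodSlope
  exact (measurable_noiseLikelihood hkm hqm n).mul (measurable_chordSlope hm hs)

lemma integral_noiseLikelihood_le (hk : ∀ z z', k z z' = inner ℝ (φ z) (φ z')) (hσ : 0 < σ)
    (hkm : Measurable fun p : X × X => k p.1 p.2) (hq : IsNonanticipative q)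
    (hqm : ∀ t, Measurable fun e => q e t) (hε : IsBoundedNoise P σ ε) (n : ℕ) :
    Integrable (fun ω => noiseLikelihood k σ q n fun i => ε i ω) P ∧
      ∫ ω, noiseLikelihood k σ q n (fun i => ε i ω) ∂P ≤ 1 := by
  have hbd : ∀ᵐ ω ∂P, ∀ i, |ε i ω| ≤ σ := ae_all_iff.2 hε.bounded
  have hεm : Measurable fun ω i => ε i ω := measurable_pi_lambda _ hε.measurable
  have hle : ∀ n, ∀ᵐ ω ∂P, |noiseLikelihood k σ q n fun i => ε i ω| ≤ Real.exp (n / 2) := fun n =>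
    hbd.mono fun ω h => by
      rw [abs_of_nonneg (noiseLikelihood_nonneg _ _)]
      exact noiseLikelihood_le hk hσ h
  have hint : ∀ n, Integrable (fun ω => noiseLikelihood k σ q n fun i => ε i ω) P := fun n =>
    Integrable.of_bound ((measurable_noiseLikelihood hkm hqm n).comp hεm).aestronglyMeasurable _
      (hle n)
  refine ⟨hint n, ?_⟩
  induction n with
  | zero => simp [noiseLikelihood, noiseForm_empty, infoGain_empty]
  | succ n ih =>
    have hslope : Measurable (likelihoodSlope k σ q n) :=
      measurable_likelihoodSlope hkm hqm n
    have hζb : ∀ᵐ ω ∂P, |likelihoodSlope k σ q n fun i => ε i ω| ≤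
        Real.exp (n / 2) * (Real.exp (1 / 2) / (2 * σ)) :=
      hbd.mono fun ω h => abs_likelihoodSlope_le hk hσ h
    have hzero := hε.integral_mul_eq_zero hslope (fun e e' h => likelihoodSlope_congr hq h) hζb
    have hint2 : Integrable (fun ω => (likelihoodSlope k σ q n fun i => ε i ω) * ε (n + 1) ω) P := by
      refine Integrable.of_bound ((hslope.comp hεm).mul (hε.measurable _)).aestronglyMeasurable
        (Real.exp (n / 2) * (Real.exp (1 / 2) / (2 * σ)) * σ) ?_
      filter_upwards [hζb, hbd] with ω h1 h2
      rw [norm_mul]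
      exact mul_le_mul h1 (h2 _) (norm_nonneg _) ((abs_nonneg _).trans h1)
    calc ∫ ω, noiseLikelihood k σ q (n + 1) (fun i => ε i ω) ∂P
        ≤ ∫ ω, (noiseLikelihood k σ q n (fun i => ε i ω) +
            (likelihoodSlope k σ q n fun i => ε i ω) * ε (n + 1) ω) ∂P := by
          refine integral_mono_ae (hint _) ((hint n).add hint2) ?_
          exact hbd.mono fun ω h => noiseLikelihood_succ_le hk hσ (h (n + 1))
      _ = ∫ ω, noiseLikelihood k σ q n (fun i => ε i ω) ∂P := by
          rw [integral_add (hint n) hint2, hzero, add_zero]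
      _ ≤ 1 := ih

/-- Self-normalized tail bound. -/
lemma measure_noiseForm_gt_le (hk : ∀ z z', k z z' = inner ℝ (φ z) (φ z')) (hσ : 0 < σ)
    (hkm : Measurable fun p : X × X => k p.1 p.2) (hq : IsNonanticipative q)
    (hqm : ∀ t, Measurable fun e => q e t) (hε : IsBoundedNoise P σ ε) (n : ℕ) (l : ℝ) :
    P {ω | 2 * l + 2 * infoGain k σ (q fun i => ε i ω) (Finset.Icc 1 n) <
      noiseForm k σ (q fun i => ε i ω) (fun i => ε i ω) (Finset.Icc 1 n)} ≤
      ENNReal.ofReal (Real.exp (-l)) := by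
  obtain ⟨hint, hle⟩ := integral_noiseLikelihood_le (P := P) hk hσ hkm hq hqm hε n
  have h1 := mul_meas_ge_le_integral_of_nonneg
    (Filter.Eventually.of_forall fun ω => noiseLikelihood_nonneg _ _) hint (Real.exp l)
  have h2 : P.real {ω | Real.exp l ≤ noiseLikelihood k σ q n fun i => ε i ω} ≤
      Real.exp (-l) := by
    rw [Real.exp_neg, ← one_div, le_div_iff₀ (Real.exp_pos l), mul_comm]
    exact h1.trans hle
  rw [measureReal_def, ← ENNReal.le_ofReal_iff_toReal_le (measure_ne_top _ _)
    (Real.exp_pos _).le] at h2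
  refine (measure_mono fun ω hω => ?_).trans h2
  refine Real.exp_le_exp.2 ?_
  have : 2 * l + 2 * infoGain k σ (q fun i => ε i ω) (Finset.Icc 1 n) <
      noiseForm k σ (q fun i => ε i ω) (fun i => ε i ω) (Finset.Icc 1 n) := hω
  linarith

end Supermartingale

/-! ### The confidence radius in the RKHS setting -/

section RKHSTail

variable {X H : Type*} [NormedAddCommGroup H] [InnerProductSpace ℝ H] [MeasurableSpace X]
  {k : X → X → ℝ} {φ : X → H} {σ κ : ℝ} {Ω : Type*} [MeasurableSpace Ω] {P : Measure Ω}
  [IsProbabilityMeasure P] {ε : ℕ → Ω → ℝ} {q : (ℕ → ℝ) → ℕ → X}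

lemma log_two_le_log_div {δ : ℝ} (hδ : 0 < δ) (hδ2 : δ ≤ 1 / 2) {t : ℝ} (ht : 1 ≤ t) :
    Real.log 2 ≤ Real.log (t / δ) := by
  refine Real.log_le_log (by norm_num) ?_
  rw [le_div_iff₀ hδ]
  linarith

/-- The left logarithm is the price of the union bound with weights `1/(t(t+1))`; since `δ ≤ 1/2`,
its argument is at most `(t/δ)³`. -/
lemma log_union_le {δ : ℝ} (hδ : 0 < δ) (hδ2 : δ ≤ 1 / 2) {t : ℝ} (ht : 1 ≤ t) :
    Real.log (t * (t + 1) / δ) ≤ 3 * Real.log (t / δ) := by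
  have h0 : (3 : ℝ) * Real.log (t / δ) = Real.log ((t / δ) ^ 3) := by
    rw [Real.log_pow]
    norm_num
  rw [h0]
  refine Real.log_le_log (by positivity) ?_
  rw [div_pow, div_le_div_iff₀ hδ (by positivity)]
  have h1 : t + 1 ≤ 2 * t := by linarith
  have h2 : 2 * δ ^ 2 ≤ t := by nlinarith
  calc t * (t + 1) * δ ^ 3 ≤ t * (2 * t) * δ ^ 3 := by gcongr
    _ = t ^ 2 * δ * (2 * δ ^ 2) := by ring
    _ ≤ t ^ 2 * δ * t := by gcongr
    _ = t ^ 3 * δ := by ring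

/-- Lets both `l` and constants be absorbed into `l³`: the constants are slightly below `(log 2)²`
and `(log 2)³`. -/
lemma log_cube_bounds {l : ℝ} (hl : Real.log 2 ≤ l) : 0.48 * l ≤ l ^ 3 ∧ 0.333 ≤ l ^ 3 := by
  have h2 := Real.log_two_gt_d9
  have h1 : 0.6931 ≤ l := by linarith
  have h3 : 0.4803 ≤ l ^ 2 := by nlinarith
  constructor <;> nlinarith

/-- Bound on the noise form in one round, with the radius of GP-UCB. -/
lemma measure_noiseForm_radius_le [Nonempty X] (hk : ∀ z z', k z z' = inner ℝ (φ z) (φ z'))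
    (hσ : 0 < σ) (hκ : ∀ z z', |k z z'| ≤ κ)
    (hkm : Measurable fun p : X × X => k p.1 p.2) (hq : IsNonanticipative q)
    (hqm : ∀ t, Measurable fun e => q e t) (hε : IsBoundedNoise P σ ε) {δ : ℝ} (hδ : 0 < δ)
    (hδ2 : δ ≤ 1 / 2) (n : ℕ) :
    P {ω | 300 * maxInfoGain k σ (n + 1) * Real.log ((n + 1 : ℕ) / δ) ^ 3 <
      2 * noiseForm k σ (q fun i => ε i ω) (fun i => ε i ω) (Finset.Icc 1 n)} ≤
      ENNReal.ofReal (δ / ((n + 1) * (n + 2))) := by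
  set g := maxInfoGain k σ (n + 1) with hg
  set l := Real.log ((n + 1 : ℕ) / δ) with hl
  have ht : (1 : ℝ) ≤ (n + 1 : ℕ) := by push_cast; linarith [(n.cast_nonneg : (0 : ℝ) ≤ n)]
  have hl2 : Real.log 2 ≤ l := log_two_le_log_div hδ hδ2 ht
  obtain ⟨hc1, hc2⟩ := log_cube_bounds hl2
  set m := Real.log ((n + 1 : ℕ) * ((n + 1 : ℕ) + 1) / δ) with hm
  have hm3 : m ≤ 3 * l := log_union_le hδ hδ2 ht
  have hexp : Real.exp (-m) = δ / ((n + 1) * (n + 2)) := by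
    rw [hm, Real.exp_neg, Real.exp_log (by positivity)]
    push_cast
    rw [inv_div]
    ring
  have hg0 : 0 ≤ g := maxInfoGain_nonneg hk hσ hκ _
  rw [← hexp]
  rcases le_or_gt (1 / 2) g with hg2 | hg2
  -- Large information gain: `2V ≤ 4m + 4g ≤ 12 l + 4 g`, and `g ≥ 1/2` allows the first term to be
  -- charged to `g l³`.
  · refine (measure_mono fun ω hω => ?_).trans
      (measure_noiseForm_gt_le (P := P) hk hσ hkm hq hqm hε n m)
    have h1 := infoGain_le_maxInfoGain hk hσ hκ (q fun i => ε i ω) (Finset.Icc 1 n)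
    rw [Nat.card_Icc, Nat.add_sub_cancel] at h1
    have h2 : maxInfoGain k σ n ≤ g := maxInfoGain_mono hk hσ hκ n.le_succ
    have h3 : 300 * g * l ^ 3 <
      2 * noiseForm k σ (q fun i => ε i ω) (fun i => ε i ω) (Finset.Icc 1 n) := hω
    change 2 * m + 2 * _ < _
    nlinarith
  -- Small information gain: the term `m` is not proportional to `g`, so the direct bound fails.
  -- Repeating one point `n + 1` times shows that the kernel itself is of order `g/(n + 1)`; on `[0,
  -- 1]`, `exp x ≤ 1 + 2x` gives the factor `4`.
  · have hdiag : ∀ z, (n + 1) * k z z / σ ^ 2 ≤ 4 * g := fun z => by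
      have h1 := log_le_maxInfoGain hk hσ hκ (n + 1) z
      have hkz : 0 ≤ k z z := by
        rw [hk]
        exact real_inner_self_nonneg
      have h2 : Real.log (1 + (n + 1 : ℕ) * k z z / σ ^ 2) ≤ 2 * g := by linarith
      rw [Real.log_le_iff_le_exp (by positivity)] at h2
      have h3 := Real.exp_bound' (x := 2 * g) (by linarith) (by linarith) (n := 1) (by norm_num)
      norm_num at h3
      push_cast at h2
      linarith
    -- Zero gain means zero features, and then the noise form is nonpositive; otherwise the kernel
    -- can be divided by `g`.
    rcases hg0.eq_or_lt with hg00 | hg00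
    · have hzero : ∀ z, k z z = 0 := fun z => by
        have h1 := hdiag z
        have hkz : 0 ≤ k z z := by
          rw [hk]
          exact real_inner_self_nonneg
        rw [← hg00, mul_zero, div_le_iff₀ (by positivity), zero_mul] at h1
        have : (0 : ℝ) < n + 1 := by positivity
        nlinarith
      have hφ : ∀ z, φ z = 0 := fun z => by
        have h1 := hzero z
        rw [hk] at h1
        exact inner_self_eq_zero.1 h1
      have hempty : {ω | 300 * g * l ^ 3 < 2 * noiseForm k σ (q fun i => ε i ω)
          (fun i => ε i ω) (Finset.Icc 1 n)} = ∅ := by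
        refine Set.eq_empty_of_forall_notMem fun ω hω => ?_
        have h1 := noiseForm_le_norm_feat hk hσ (q fun i => ε i ω) (fun i => ε i ω)
          (Finset.Icc 1 n)
        simp only [feat, hφ, smul_zero, Finset.sum_const_zero, norm_zero] at h1
        have h2 : 300 * g * l ^ 3 <
          2 * noiseForm k σ (q fun i => ε i ω) (fun i => ε i ω) (Finset.Icc 1 n) := hω
        rw [← hg00] at h2
        have : 0 < σ ^ 4 := by positivity
        nlinarith
      rw [hempty, measure_empty]
      exact zero_le
    -- The rescaled kernel has trace at most `4σ²` and information gain at most `2`. Off the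
    -- exceptional event `2 r V ≤ 10 (2m + 4) ≤ 60 l + 40`, which the numerical bounds place below
    -- `300 l³`.
    · set r := g⁻¹ with hr
      have hr0 : 0 < r := inv_pos.2 hg00
      have hrg : r * g = 1 := inv_mul_cancel₀ hg00.ne'
      have hk' : ∀ z z', r * k z z' = inner ℝ (√r • φ z) (√r • φ z') := fun z z' => by
        rw [inner_smul_left, inner_smul_right, ← mul_assoc, hk]
        simp [Real.mul_self_sqrt hr0.le]
      refine (measure_mono fun ω hω => ?_).trans
        (measure_noiseForm_gt_le (P := P) (k := fun z z' => r * k z z') (φ := fun z => √r • φ z)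
          hk' hσ (hkm.const_mul r) hq hqm hε n m)
      set x := q fun i => ε i ω
      have htr : ∑ i ∈ Finset.Icc 1 n, r * k (x i) (x i) ≤ 4 * σ ^ 2 := by
        have h1 : ∀ i ∈ Finset.Icc 1 n, r * k (x i) (x i) ≤ 4 * σ ^ 2 / (n + 1) := fun i _ => by
          rw [le_div_iff₀ (by positivity)]
          have h2 := hdiag (x i)
          rw [div_le_iff₀ (by positivity)] at h2
          have h3 := mul_le_mul_of_nonneg_left h2 hr0.le
          calc r * k (x i) (x i) * (n + 1) = r * ((n + 1) * k (x i) (x i)) := by ring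
            _ ≤ r * (4 * g * σ ^ 2) := h3
            _ = (r * g) * (4 * σ ^ 2) := by ring
            _ = 4 * σ ^ 2 := by rw [hrg, one_mul]
        refine (Finset.sum_le_card_nsmul _ _ _ h1).trans ?_
        rw [Nat.card_Icc, Nat.add_sub_cancel, nsmul_eq_mul, mul_div_assoc', div_le_iff₀
          (by positivity)]
        nlinarith [sq_nonneg σ]
      have h1 := noiseForm_le_noiseForm_smul hk hσ (fun i => ε i ω) hr0 htr
      have h2 := infoGain_le_sum (k := fun z z' => r * k z z') (φ := fun z => √r • φ z) hk' hσ x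
        (Finset.Icc 1 n)
      have h3 : ∑ i ∈ Finset.Icc 1 n, 1 / 2 * (r * k (x i) (x i) / σ ^ 2) ≤ 2 := by
        rw [← Finset.mul_sum, ← Finset.sum_div]
        have : (∑ i ∈ Finset.Icc 1 n, r * k (x i) (x i)) / σ ^ 2 ≤ 4 := by
          rw [div_le_iff₀ (by positivity)]
          exact htr
        linarith
      have h4 : 300 * g * l ^ 3 <
        2 * noiseForm k σ x (fun i => ε i ω) (Finset.Icc 1 n) := hω
      change 2 * m + 2 * infoGain (fun z z' => r * k z z') σ x (Finset.Icc 1 n) <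
        noiseForm (fun z z' => r * k z z') σ x (fun i => ε i ω) (Finset.Icc 1 n)
      have h5 : 300 * l ^ 3 < 2 * (r * noiseForm k σ x (fun i => ε i ω) (Finset.Icc 1 n)) := by
        have h6 := mul_lt_mul_of_pos_left h4 hr0
        calc 300 * l ^ 3 = 300 * (r * g) * l ^ 3 := by rw [hrg]; ring
          _ = r * (300 * g * l ^ 3) := by ring
          _ < _ := h6
          _ = _ := by ring
      linarith

end RKHSTail

/-! ### From confidence bounds to instantaneous regret -/

section Gap

variable {X H : Type*} [NormedAddCommGroup H] [InnerProductSpace ℝ H] [TopologicalSpace X]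
  [MeasurableSpace X] {k : X → X → ℝ} {φ : X → H} {σ κ : ℝ} {β : ℕ → ℝ} {T : ℕ}
  {sel : ℕ → (X → ℝ) → X} {f : X → ℝ} {y : ℕ → ℝ}

lemma ucb_le_ucbQuery (hkc : Continuous fun p : X × X => k p.1 p.2) (hsel : IsArgmaxRule sel)
    (y : ℕ → ℝ) (n : ℕ) (z : X) :
    ucb k σ β (ucbQuery sel k σ β y) y n z ≤
      ucb k σ β (ucbQuery sel k σ β y) y n (ucbQuery sel k σ β y (n + 1)) := by
  rw [ucbQuery_succ y n]
  exact hsel.isMax (n + 1) _ (continuous_ucb hkc _ _ _) z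

/-- Instantaneous regret, given an upper confidence bound at `z` up to an error `ρ`. -/
lemma gap_le (hkc : Continuous fun p : X × X => k p.1 p.2) (hsel : IsArgmaxRule sel)
    (hconf : IsConfident sel k σ β T f y) {t : ℕ} (ht : t ∈ Finset.Icc 1 T) {z : X} {ρ : ℝ}
    (hz : f z ≤ ucb k σ β (ucbQuery sel k σ β y) y (t - 1) z + ρ) :
    f z - f (ucbQuery sel k σ β y t) ≤ 2 * √(β t) *
      gpSd k σ (ucbQuery sel k σ β y) (Finset.Icc 1 (t - 1)) (ucbQuery sel k σ β y t) + ρ := by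
  have h1 := ucb_le_ucbQuery (σ := σ) (β := β) hkc hsel y (t - 1) z
  have h2 := (abs_le.1 (hconf t ht)).1
  have h3 := (Finset.mem_Icc.1 ht).1
  have h4 : ucb k σ β (ucbQuery sel k σ β y) y (t - 1) (ucbQuery sel k σ β y t) =
    gpMean k σ (ucbQuery sel k σ β y) y (Finset.Icc 1 (t - 1)) (ucbQuery sel k σ β y t) + √(β t) *
      gpSd k σ (ucbQuery sel k σ β y) (Finset.Icc 1 (t - 1)) (ucbQuery sel k σ β y t) := by
    rw [ucb, Nat.sub_add_cancel h3]
  rw [Nat.sub_add_cancel h3, h4] at h1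
  linarith

/-- Uniform confidence bounds imply the regret bound. -/
lemma regret_le_of_uniform [Nonempty X] (hk : ∀ z z', k z z' = inner ℝ (φ z) (φ z')) (hσ : 0 < σ)
    (hκ : ∀ z z', |k z z'| ≤ κ) (hβ : MonotoneOn β (Set.Ici 1))
    (hkc : Continuous fun p : X × X => k p.1 p.2) (hsel : IsArgmaxRule sel)
    (h : ∀ t ∈ Finset.Icc 1 T, ∀ z,
      |f z - gpMean k σ (ucbQuery sel k σ β y) y (Finset.Icc 1 (t - 1)) z| ≤
        √(β t) * gpSd k σ (ucbQuery sel k σ β y) (Finset.Icc 1 (t - 1)) z) :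
    IsConfident sel k σ β T f y ∧
      regret f (ucbQuery sel k σ β y) T ≤
        √(8 * (σ ^ 2 + κ)) * √(T * β T * maxInfoGain k σ T) := by
  have hconf : IsConfident sel k σ β T f y := fun t ht => h t ht _
  refine ⟨hconf, ?_⟩
  have := regret_le (f := f) (x := ucbQuery sel k σ β y) (T := T) hk hσ hκ hβ le_rfl
    fun t ht z => by
      rw [zero_div]
      refine gap_le hkc hsel hconf ht ?_
      have h1 := (abs_le.1 (h t ht z)).2
      rw [ucb, Nat.sub_add_cancel (Finset.mem_Icc.1 ht).1]
      linarith
  simpa using this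

end Gap

/-! ### The RKHS setting -/

section RKHS

lemma sum_inv_mul_succ_le (T : ℕ) :
    ∑ n ∈ Finset.range T, (1 : ℝ) / ((n + 1) * (n + 2)) = 1 - 1 / (T + 1) := by
  induction T with
  | zero => simp
  | succ T ih =>
    rw [Finset.sum_range_succ, ih]
    push_cast
    field_simp
    ring

variable {X H : Type*} [NormedAddCommGroup H] [InnerProductSpace ℝ H]
  {k : X → X → ℝ} {φ : X → H} {σ κ : ℝ}

lemma betaRKHS_mono [Nonempty X] (hk : ∀ z z', k z z' = inner ℝ (φ z) (φ z')) (hσ : 0 < σ)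
    (hκ : ∀ z z', |k z z'| ≤ κ) (Bf : ℝ) {δ : ℝ} (hδ : 0 < δ) (hδ2 : δ ≤ 1 / 2) :
    MonotoneOn (betaRKHS k σ Bf δ) (Set.Ici 1) := by
  intro s hs t _ hst
  have hs1 : (1 : ℝ) ≤ s := by exact_mod_cast hs
  have hst' : (s : ℝ) ≤ t := by exact_mod_cast hst
  have h1 : 0 ≤ Real.log (s / δ) :=
    (Real.log_nonneg (by norm_num)).trans (log_two_le_log_div hδ hδ2 hs1)
  have h2 : Real.log (s / δ) ≤ Real.log (t / δ) := Real.log_le_log (by positivity) (by gcongr)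
  have h3 := maxInfoGain_nonneg hk hσ hκ s
  have h4 := maxInfoGain_mono hk hσ hκ hst
  have h5 := h3.trans h4
  rw [betaRKHS, betaRKHS]
  gcongr

variable [TopologicalSpace X]

lemma continuous_featureMap (hk : ∀ z z', k z z' = inner ℝ (φ z) (φ z'))
    (hkc : Continuous fun p : X × X => k p.1 p.2) : Continuous φ := by
  refine continuous_iff_continuousAt.2 fun z₀ => ?_
  rw [ContinuousAt, tendsto_iff_norm_sub_tendsto_zero]
  have h1 : ∀ z, ‖φ z - φ z₀‖ = √(k z z - 2 * k z z₀ + k z₀ z₀) := fun z => by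
    rw [hk, hk, hk, real_inner_self_eq_norm_sq, real_inner_self_eq_norm_sq, ← norm_sub_sq_real,
      Real.sqrt_sq (norm_nonneg _)]
  simp only [h1]
  have h2 : Continuous fun z => √(k z z - 2 * k z z₀ + k z₀ z₀) := by
    have e1 : Continuous fun z => k z z := hkc.comp (continuous_id.prodMk continuous_id)
    have e2 : Continuous fun z => k z z₀ := hkc.comp (continuous_id.prodMk continuous_const)
    fun_prop
  have h3 := h2.tendsto z₀
  have h4 : k z₀ z₀ - 2 * k z₀ z₀ + k z₀ z₀ = 0 := by ring
  simpa [h4] using h3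

variable [MeasurableSpace X] {Ω : Type*} [MeasurableSpace Ω] {P : Measure Ω}
  [IsProbabilityMeasure P] {ε : ℕ → Ω → ℝ}

lemma zeroCost_rkhs [Nonempty X] (hk : ∀ z z', k z z' = inner ℝ (φ z) (φ z')) (hσ : 0 < σ)
    (hκ : ∀ z z', |k z z'| ≤ κ) (hkc : Continuous fun p : X × X => k p.1 p.2)
    (hkm : Measurable fun p : X × X => k p.1 p.2) {h : H}
    (hfm : Measurable fun z => inner ℝ (φ z) h) {Bf : ℝ} (hBf : ‖h‖ ^ 2 ≤ Bf)
    {δ : ℝ} (hδ : 0 < δ) (hδ1 : δ < 1) (hε : IsBoundedNoise P σ ε) (T : ℕ) :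
    ZeroCost P k κ σ δ σ (betaRKHS k σ Bf (δ / 2)) T (fun _ z => inner ℝ (φ z) h) ε
      √(8 * (σ ^ 2 + κ)) := by
  have hδ2 : δ / 2 ≤ 1 / 2 := by linarith
  have hβ := betaRKHS_mono hk hσ hκ Bf (half_pos hδ) hδ2
  refine zeroCost_of_ucb hk hσ hκ hβ fun sel hsel => ?_
  set β := betaRKHS k σ Bf (δ / 2) with hβdef
  set f : X → ℝ := fun z => inner ℝ (φ z) h
  set d := ucbQuery sel k σ β
  have hd : IsNonanticipative d := isNonanticipative_ucbQuery
  have hdm : ∀ t, Measurable fun y => d y t := measurable_ucbQuery hkc hkm hsel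
  -- The objective is deterministic here, so the queries are functions of the noise alone and the
  -- self-normalized bound applies to them.
  set q := noiseDesign d f T
  have hqm : ∀ t, Measurable fun e => q e t := fun t =>
    (hdm t).comp (measurable_response (g := fun _ => f) hdm (hfm.comp measurable_snd)
      measurable_id T)
  set A : ℕ → Set Ω := fun n => {ω | 300 * maxInfoGain k σ (n + 1) *
    Real.log ((n + 1 : ℕ) / (δ / 2)) ^ 3 <
      2 * noiseForm k σ (q fun i => ε i ω) (fun i => ε i ω) (Finset.Icc 1 n)}
  refine ⟨⋃ n ∈ Finset.range T, A n, ?_, ?_⟩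
  · refine (measure_biUnion_finset_le _ _).trans ?_
    refine (Finset.sum_le_sum fun n _ => measure_noiseForm_radius_le hk hσ hκ hkm
      (hd.noiseDesign f T) hqm hε (half_pos hδ) hδ2 n).trans ?_
    rw [← ENNReal.ofReal_sum_of_nonneg fun n _ => by positivity]
    refine ENNReal.ofReal_le_ofReal ?_
    have h1 : ∀ n : ℕ, δ / 2 / (((n : ℝ) + 1) * (n + 2)) =
      δ / 2 * (1 / (((n : ℝ) + 1) * (n + 2))) := fun n => by rw [mul_one_div]
    simp only [h1]
    rw [← Finset.mul_sum, sum_inv_mul_succ_le]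
    have : (0 : ℝ) ≤ 1 / (T + 1) := by positivity
    nlinarith
  · filter_upwards [ae_all_iff.2 hε.bounded] with ω hω hωA
    refine ⟨fun t _ => hω t, regret_le_of_uniform hk hσ hκ hβ hkc hsel fun t ht z => ?_⟩
    obtain ⟨n, rfl⟩ : ∃ n, t = n + 1 := ⟨t - 1, by have := (Finset.mem_Icc.1 ht).1; omega⟩
    have hnT := (Finset.mem_Icc.1 ht).2
    have hV : 2 * noiseForm k σ (q fun i => ε i ω) (fun i => ε i ω) (Finset.Icc 1 n) ≤
        300 * maxInfoGain k σ (n + 1) * Real.log ((n + 1 : ℕ) / (δ / 2)) ^ 3 := by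
      by_contra hcon
      exact hωA (Set.mem_biUnion (Finset.mem_coe.2 (Finset.mem_range.2 hnT)) (not_le.1 hcon))
    rw [Nat.add_sub_cancel]
    have h1 := abs_sub_gpMean_le (S := Finset.Icc 1 n) (x := q fun i => ε i ω)
      (y := response d f (fun i => ε i ω) T) (e := fun i => ε i ω) hk hσ h (fun i hi => by
        obtain ⟨j, rfl⟩ : ∃ j, i = j + 1 := ⟨i - 1, by have := (Finset.mem_Icc.1 hi).1; omega⟩
        have := (Finset.mem_Icc.1 hi).2
        exact response_succ hd f _ (by omega)) z
    refine h1.trans (mul_le_mul_of_nonneg_right ?_ (Real.sqrt_nonneg _))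
    refine Real.le_sqrt_of_sq_le ?_
    have h2 := Real.sq_sqrt (noiseForm_nonneg hk hσ (q fun i => ε i ω) (fun i => ε i ω)
      (Finset.Icc 1 n))
    -- `(‖h‖ + √V)² ≤ 2‖h‖² + 2V` explains both the `2 * Bf` and the factor `2` in the bad events.
    rw [hβdef, betaRKHS]
    nlinarith [sq_nonneg (‖h‖ - √(noiseForm k σ (q fun i => ε i ω) (fun i => ε i ω)
      (Finset.Icc 1 n)))]

end RKHS

/-! ### Translation of Gaussian measures and Gaussian tails -/

section GaussianTranslation

open scoped NNReal ENNReal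

variable {v : ℝ≥0}

/-- The density of `N(a, v)` with respect to `N(0, v)`. -/
def tilt (v : ℝ≥0) (a u : ℝ) : ℝ≥0∞ := ENNReal.ofReal (Real.exp (a * u / v - a ^ 2 / (2 * v)))

lemma measurable_tilt {α : Type*} [MeasurableSpace α] {a u : α → ℝ} (ha : Measurable a)
    (hu : Measurable u) : Measurable fun x => tilt v (a x) (u x) := by
  unfold tilt
  fun_prop

/-- Translation of a centered Gaussian measure. -/
lemma lintegral_add_gaussianReal (hv : v ≠ 0) {F : ℝ → ℝ≥0∞} (hF : Measurable F) (a : ℝ) :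
    ∫⁻ u, F (u + a) ∂gaussianReal 0 v = ∫⁻ u, F u * tilt v a u ∂gaussianReal 0 v := by
  have hv' : (0 : ℝ) < v := by exact_mod_cast pos_iff_ne_zero.2 hv
  have h1 : ∫⁻ u, F (u + a) ∂gaussianReal 0 v = ∫⁻ u, F u ∂gaussianReal a v := by
    have hm : Measurable fun u : ℝ => u + a := by fun_prop
    rw [← lintegral_map hF hm]
    have := gaussianReal_map_add_const (μ := 0) (v := v) a
    rw [zero_add] at this
    exact congrArg (fun m => ∫⁻ u, F u ∂m) this
  have hFt : Measurable fun u => F u * tilt v a u :=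
    hF.mul (measurable_tilt measurable_const measurable_id)
  rw [h1, gaussianReal_of_var_ne_zero _ hv, gaussianReal_of_var_ne_zero _ hv,
    lintegral_withDensity_eq_lintegral_mul _ (measurable_gaussianPDF _ _) hF,
    lintegral_withDensity_eq_lintegral_mul _ (measurable_gaussianPDF _ _) hFt]
  refine lintegral_congr fun u => ?_
  have h2 : gaussianPDF a v u = gaussianPDF 0 v u * tilt v a u := by
    rw [gaussianPDF, gaussianPDF, tilt, ← ENNReal.ofReal_mul (gaussianPDFReal_nonneg _ _ _),
      gaussianPDFReal, gaussianPDFReal, mul_assoc _ (Real.exp _) (Real.exp _), ← Real.exp_add]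
    congr 3
    field_simp
    ring
  simp only [Pi.mul_apply, h2]
  ring

/-- The translation formula moves the half-line to `(0, ∞)`, where the density ratio is at most
`exp(-r²/2v)`. Keeping the mass of `(0, ∞)`, at most one half by symmetry, is what spares a factor
`2` in the two-sided bound. -/
lemma gaussianReal_Ioi_le (hv : v ≠ 0) {r : ℝ} (hr : 0 ≤ r) :
    gaussianReal 0 v (Set.Ioi r) ≤
      ENNReal.ofReal (Real.exp (-(r ^ 2 / (2 * v)))) * gaussianReal 0 v (Set.Ioi 0) := by
  have h1 := lintegral_add_gaussianReal hv
    (F := (Set.Ioi (0 : ℝ)).indicator 1) (measurable_one.indicator measurableSet_Ioi) (-r)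
  have h2 : ∀ u, (Set.Ioi (0 : ℝ)).indicator (1 : ℝ → ℝ≥0∞) (u + -r) =
      (Set.Ioi r).indicator 1 u := fun u => by
    simp [Set.indicator_apply]
  simp only [h2] at h1
  rw [lintegral_indicator_one measurableSet_Ioi] at h1
  rw [h1, ← lintegral_indicator_one measurableSet_Ioi,
    ← lintegral_const_mul _ (measurable_one.indicator measurableSet_Ioi)]
  refine lintegral_mono fun u => ?_
  rw [mul_comm]
  by_cases hu : u ∈ Set.Ioi (0 : ℝ)
  · rw [Set.indicator_of_mem hu]
    gcongr
    refine ENNReal.ofReal_le_ofReal (Real.exp_le_exp.2 ?_)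
    have h3 : 0 ≤ r * u / v := div_nonneg (mul_nonneg hr (le_of_lt hu)) v.2
    rw [neg_sq, neg_mul, neg_div]
    linarith
  · simp [Set.indicator_of_notMem hu]

/-- Two-sided Gaussian tail bound. -/
lemma gaussianReal_abs_gt_le {r : ℝ} (hr : 0 ≤ r) (v : ℝ≥0) :
    gaussianReal 0 v {u | r * √v < |u|} ≤ ENNReal.ofReal (Real.exp (-(r ^ 2 / 2))) := by
  rcases eq_or_ne v 0 with rfl | hv
  · simp
  have hv' : (0 : ℝ) < v := by exact_mod_cast pos_iff_ne_zero.2 hv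
  have hs : 0 ≤ r * √v := by positivity
  have h1 : {u : ℝ | r * √v < |u|} = Set.Ioi (r * √v) ∪ Set.Iio (-(r * √v)) := by
    ext u
    simp [lt_abs, lt_neg]
  have hneg : ∀ s : ℝ, gaussianReal 0 v (Set.Iio (-s)) = gaussianReal 0 v (Set.Ioi s) := fun s => by
    have h2 := gaussianReal_map_neg (μ := 0) (v := v)
    rw [neg_zero] at h2
    rw [← h2, Measure.map_apply measurable_neg measurableSet_Iio, h2]
    congr 1
    ext u
    simp
  have h3 := gaussianReal_Ioi_le hv hs
  have h4 : (r * √v) ^ 2 / (2 * v) = r ^ 2 / 2 := by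
    rw [mul_pow, Real.sq_sqrt hv'.le]
    field_simp
  rw [h4] at h3
  have h5 : gaussianReal 0 v (Set.Ioi 0) + gaussianReal 0 v (Set.Ioi 0) ≤ 1 := by
    have hd : Disjoint (Set.Iio (0 : ℝ)) (Set.Ioi 0) :=
      Set.disjoint_left.2 fun u (h : u < 0) (h' : 0 < u) => lt_asymm h h'
    nth_rewrite 1 [← hneg 0]
    rw [neg_zero, ← measure_union hd measurableSet_Ioi]
    exact prob_le_one
  calc gaussianReal 0 v {u | r * √v < |u|}
      ≤ gaussianReal 0 v (Set.Ioi (r * √v)) + gaussianReal 0 v (Set.Iio (-(r * √v))) := by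
        rw [h1]
        exact measure_union_le _ _
    _ ≤ ENNReal.ofReal (Real.exp (-(r ^ 2 / 2))) *
        (gaussianReal 0 v (Set.Ioi 0) + gaussianReal 0 v (Set.Ioi 0)) := by
        rw [hneg, mul_add]
        exact add_le_add h3 h3
    _ ≤ ENNReal.ofReal (Real.exp (-(r ^ 2 / 2))) := by
        simpa using mul_le_mul_right h5 (ENNReal.ofReal (Real.exp (-(r ^ 2 / 2))))

/-- The law of a sequence of independent `N(0, v)` variables. -/
abbrev noiseLaw (v : ℝ≥0) : Measure (ℕ → ℝ) := Measure.infinitePi fun _ => gaussianReal 0 v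

/-- Resampling one coordinate preserves the law of the noise. -/
lemma lintegral_update_noiseLaw {G : (ℕ → ℝ) → ℝ≥0∞} (hG : Measurable G) (m : ℕ) :
    ∫⁻ y, ∫⁻ u, G (Function.update y m u) ∂gaussianReal 0 v ∂noiseLaw v =
      ∫⁻ y, G y ∂noiseLaw v := by
  have hupd : Measurable fun p : (ℕ → ℝ) × ℝ => Function.update p.1 m p.2 := by
    refine measurable_pi_lambda _ fun i => ?_
    rcases eq_or_ne i m with rfl | h
    · simpa using measurable_snd
    · simp only [Function.update_of_ne h]
      exact (measurable_pi_apply i).comp measurable_fst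
  have h1 : ((noiseLaw v).prod (gaussianReal 0 v)).map
      (fun p : (ℕ → ℝ) × ℝ => Function.update p.1 m p.2) = noiseLaw v := by
    refine Measure.eq_infinitePi _ fun s t ht => ?_
    rw [Measure.map_apply hupd (MeasurableSet.pi s.countable_toSet fun i _ => ht i)]
    by_cases hm : m ∈ s
    · have h2 : (fun p : (ℕ → ℝ) × ℝ => Function.update p.1 m p.2) ⁻¹' (Set.pi s t) =
          (Set.pi ↑(s.erase m) t) ×ˢ t m := by
        ext p
        simp only [Set.mem_preimage, Set.mem_pi, Set.mem_prod, Finset.coe_erase, Set.mem_sdiff,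
          Finset.mem_coe, Set.mem_singleton_iff]
        refine ⟨fun h => ⟨fun i hi => ?_, ?_⟩, fun h i hi => ?_⟩
        · simpa [Function.update_of_ne hi.2] using h i hi.1
        · simpa using h m hm
        · rcases eq_or_ne i m with rfl | him
          · simpa using h.2
          · simpa [Function.update_of_ne him] using h.1 i ⟨hi, him⟩
      rw [h2, Measure.prod_prod, Measure.infinitePi_pi _ fun i _ => ht i,
        ← Finset.prod_erase_mul _ _ hm]
    · have h2 : (fun p : (ℕ → ℝ) × ℝ => Function.update p.1 m p.2) ⁻¹' (Set.pi s t) =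
          (Set.pi ↑s t) ×ˢ Set.univ := by
        ext p
        simp only [Set.mem_preimage, Set.mem_pi, Set.mem_prod, Finset.mem_coe, Set.mem_univ,
          and_true]
        refine forall₂_congr fun i hi => ?_
        rw [Function.update_of_ne (by rintro rfl; exact hm hi)]
      rw [h2, Measure.prod_prod, Measure.infinitePi_pi _ fun i _ => ht i, measure_univ, mul_one]
  rw [lintegral_lintegral (f := fun y u => G (Function.update y m u)) (hG.comp hupd).aemeasurable, ← lintegral_map hG hupd, h1]

/-- Translation of one coordinate of the noise. -/
lemma lintegral_translate_noiseLaw (hv : v ≠ 0) {G : (ℕ → ℝ) → ℝ≥0∞} (hG : Measurable G) (m : ℕ)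
    {a : (ℕ → ℝ) → ℝ} (ha : Measurable a) (ham : ∀ y u, a (Function.update y m u) = a y) :
    ∫⁻ y, G (Function.update y m (y m + a y)) ∂noiseLaw v =
      ∫⁻ y, G y * tilt v (a y) (y m) ∂noiseLaw v := by
  have hupd : ∀ y : ℕ → ℝ, Measurable fun u => Function.update y m u := fun y =>
    measurable_update y
  have h1 : Measurable fun y : ℕ → ℝ => G (Function.update y m (y m + a y)) := by
    refine hG.comp (measurable_pi_lambda _ fun i => ?_)
    rcases eq_or_ne i m with rfl | h
    · simp only [Function.update_self]
      exact (measurable_pi_apply _).add ha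
    · simpa only [Function.update_of_ne h] using measurable_pi_apply i
  have h2 : Measurable fun y : ℕ → ℝ => G y * tilt v (a y) (y m) :=
    hG.mul (measurable_tilt ha (measurable_pi_apply m))
  -- Both sides are averaged over coordinate `m` with the others frozen. The shift is then a
  -- constant, and the one-dimensional formula applies.
  rw [← lintegral_update_noiseLaw h1 m, ← lintegral_update_noiseLaw h2 m]
  refine lintegral_congr fun y => ?_
  simp only [Function.update_self, Function.update_idem, ham]
  exact lintegral_add_gaussianReal hv (hG.comp (hupd y)) (a y)

end GaussianTranslation

/-! ### Density of adaptively collected observations -/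

section Likelihood

open scoped NNReal ENNReal

variable {X : Type*} {v : ℝ≥0}

/-- The likelihood of the observations `e` of `n` rounds for the objective `g`, relative to pure
noise. -/
def likelihood (v : ℝ≥0) (d : (ℕ → ℝ) → ℕ → X) (g : X → ℝ) (n : ℕ) (e : ℕ → ℝ) : ℝ≥0∞ :=
  ∏ i ∈ Finset.Icc 1 n, tilt v (g (d e i)) (e i)

lemma measurable_likelihood [MeasurableSpace X] {α : Type*} [MeasurableSpace α]
    {d : (ℕ → ℝ) → ℕ → X} (hd : ∀ t, Measurable fun y => d y t) {g : α → X → ℝ}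
    (hg : Measurable fun p : α × X => g p.1 p.2) {e : α → ℕ → ℝ} (he : Measurable e) (n : ℕ) :
    Measurable fun a => likelihood v d (g a) n (e a) :=
  Finset.measurable_fun_prod _ fun i _ =>
    measurable_tilt (hg.comp (measurable_id.prodMk ((hd i).comp he)))
      ((measurable_pi_apply i).comp he)

/-- The law of the observations has density `likelihood` with respect to the law of the noise. -/
lemma lintegral_response [MeasurableSpace X] (hv : v ≠ 0) {d : (ℕ → ℝ) → ℕ → X}
    (hd : IsNonanticipative d) (hdm : ∀ t, Measurable fun y => d y t) {g : X → ℝ}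
    (hg : Measurable g) (n : ℕ) {G : (ℕ → ℝ) → ℝ≥0∞} (hG : Measurable G) :
    ∫⁻ e, G (response d g e n) ∂noiseLaw v =
      ∫⁻ e, G e * likelihood v d g n e ∂noiseLaw v := by
  induction n generalizing G with
  | zero => simp [response, likelihood]
  | succ n ih =>
    have ha : Measurable fun y => g (d y (n + 1)) := hg.comp (hdm _)
    have ham : ∀ (y : ℕ → ℝ) (u : ℝ),
        g (d (Function.update y (n + 1) u) (n + 1)) = g (d y (n + 1)) := fun y u => by
      rw [hd _ y n fun i hi => ?_]
      rw [Function.update_of_ne]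
      have := (Finset.mem_Icc.1 hi).2
      omega
    have hΦ : Measurable fun y : ℕ → ℝ =>
        Function.update y (n + 1) (y (n + 1) + g (d y (n + 1))) := by
      refine measurable_pi_lambda _ fun i => ?_
      rcases eq_or_ne i (n + 1) with rfl | h
      · simp only [Function.update_self]
        exact (measurable_pi_apply _).add ha
      · simpa only [Function.update_of_ne h] using measurable_pi_apply i
    have hL : Measurable (likelihood v d g n) :=
      measurable_likelihood (g := fun _ => g) hdm (hg.comp measurable_snd) measurable_id n
    -- The shift in coordinate `n + 1` is invisible to the likelihood of the first `n` rounds,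
    -- because the design is nonanticipative.
    have hLΦ : ∀ y : ℕ → ℝ, likelihood v d g n
        (Function.update y (n + 1) (y (n + 1) + g (d y (n + 1)))) = likelihood v d g n y := by
      intro y
      refine Finset.prod_congr rfl fun i hi => ?_
      have hi' := (Finset.mem_Icc.1 hi).2
      rw [Function.update_of_ne (by omega), hd.congr (y' := y) (n := n) (fun j hj => ?_) i
        (Finset.Icc_subset_Icc_right n.le_succ hi)]
      rw [Function.update_of_ne]
      have := (Finset.mem_Icc.1 hj).2
      omega
    simp only [response]
    rw [ih (G := fun y => G (Function.update y (n + 1) (y (n + 1) + g (d y (n + 1)))))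
      (hG.comp hΦ)]
    have h1 := lintegral_translate_noiseLaw hv (G := fun y => G y * likelihood v d g n y)
      (hG.mul hL) (n + 1) ha ham
    simp only [hLΦ] at h1
    rw [h1]
    refine lintegral_congr fun y => ?_
    rw [likelihood, likelihood, Icc_one_succ, Finset.prod_insert (succ_notMem_Icc n)]
    ring

end Likelihood

/-! ### Gaussian conditioning for a fixed design -/

section Conditioning

open scoped NNReal ENNReal

variable {X Ω : Type*} [MeasurableSpace Ω] {P : Measure Ω} {v : ℝ≥0}
  {k : X → X → ℝ} {σ : ℝ} {f : Ω → X → ℝ}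

/-- Finitely many coordinates of the noise. -/
abbrev finNoiseLaw (v : ℝ≥0) (S : Finset ℕ) : Measure (S → ℝ) :=
  Measure.pi fun _ => gaussianReal 0 v

lemma iIndepFun_finNoiseLaw (S : Finset ℕ) :
    iIndepFun (fun (i : S) (e : S → ℝ) => e i) (finNoiseLaw v S) :=
  iIndepFun_pi (X := fun _ u => u) fun _ => aemeasurable_id

lemma hasLaw_finNoiseLaw (S : Finset ℕ) (i : S) :
    HasLaw (fun e : S → ℝ => e i) (gaussianReal 0 v) (finNoiseLaw v S) where
  aemeasurable := (measurable_pi_apply i).aemeasurable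
  map_eq := (measurePreserving_eval (fun _ : S => gaussianReal 0 v) i).map_eq

lemma hasGaussianLaw_finNoiseLaw (S : Finset ℕ) :
    HasGaussianLaw (fun e : S → ℝ => e) (finNoiseLaw v S) :=
  iIndepFun.hasGaussianLaw (X := fun (i : S) (e : S → ℝ) => e i)
    (fun i => (hasLaw_finNoiseLaw S i).hasGaussianLaw) (iIndepFun_finNoiseLaw S)

lemma covariance_finNoiseLaw (S : Finset ℕ) (i j : S) :
    cov[fun e => e i, fun e => e j; finNoiseLaw v S] = if i = j then (v : ℝ) else 0 := by
  have hm : ∀ i : S, MemLp (fun e : S → ℝ => e i) 2 (finNoiseLaw v S) := fun i =>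
    (hasLaw_finNoiseLaw S i).hasGaussianLaw.memLp_two
  split_ifs with h
  · subst h
    rw [covariance_self (hm i).aemeasurable, (hasLaw_finNoiseLaw S i).variance_eq]
    simp
  · exact ((iIndepFun_finNoiseLaw S).indepFun h).covariance_eq_zero (hm i) (hm j)

/-- The residual of the prediction of `f z` from the noisy observations of `f`. -/
def residual (f : Ω → X → ℝ) (k : X → X → ℝ) (σ : ℝ) (x : ℕ → X) (S : Finset ℕ) (z : X)
    (p : Ω × (S → ℝ)) : ℝ :=
  f p.1 z - ∑ i : S, gpCoeff k σ x S z i * (f p.1 (x i) + p.2 i)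

variable [IsProbabilityMeasure P]

omit [IsProbabilityMeasure P] in
lemma hasGaussianLaw_comp_fst {E : Type*} [NormedAddCommGroup E] [NormedSpace ℝ E]
    [MeasurableSpace E] [BorelSpace E] {S : Finset ℕ} {g : Ω → E} (hg : HasGaussianLaw g P)
    (hgm : Measurable g) :
    HasGaussianLaw (fun p : Ω × (S → ℝ) => g p.1) (P.prod (finNoiseLaw v S)) where
  isGaussian_map := by
    have h : (P.prod (finNoiseLaw v S)).map (fun p => g p.1) = P.map g := by
      rw [show (fun p : Ω × (S → ℝ) => g p.1) = g ∘ Prod.fst from rfl,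
        ← Measure.map_map hgm measurable_fst, Measure.map_fst_prod]
      simp
    rw [h]
    exact hg.isGaussian_map

lemma hasGaussianLaw_comp_snd {S : Finset ℕ} :
    HasGaussianLaw (fun p : Ω × (S → ℝ) => p.2) (P.prod (finNoiseLaw v S)) where
  isGaussian_map := by
    rw [show (fun p : Ω × (S → ℝ) => p.2) = Prod.snd from rfl, Measure.map_snd_prod]
    have := (hasGaussianLaw_finNoiseLaw (v := v) S).isGaussian_map
    simpa using this

/-- Residual and observations are a linear image of finitely many values of `f` and an independent
noise vector. The one-point family over `Unit` fits the independence criterion for families. -/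
lemma hasGaussianLaw_residual (hf : IsGaussianProcess (fun z ω => f ω z) P)
    (hfm : ∀ z, Measurable fun ω => f ω z) (x : ℕ → X) (S : Finset ℕ) (z : X) :
    HasGaussianLaw (fun p => ((fun _ : Unit => residual f k σ x S z p),
      fun i : S => f p.1 (x i) + p.2 i)) (P.prod (finNoiseLaw v S)) := by
  classical
  let I : Finset X := insert z (Finset.univ.image fun i : S => x i)
  have hz : z ∈ I := Finset.mem_insert_self _ _
  have hx : ∀ i : S, x i ∈ I := fun i =>
    Finset.mem_insert_of_mem (Finset.mem_image_of_mem _ (Finset.mem_univ i))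
  have hIm : Measurable fun ω => I.restrict (f ω) := measurable_pi_lambda _ fun i => hfm i
  have hb : HasGaussianLaw (fun p : Ω × (S → ℝ) => (I.restrict (f p.1), p.2))
      (P.prod (finNoiseLaw v S)) := by
    refine IndepFun.hasGaussianLaw (hasGaussianLaw_comp_fst (hf.hasGaussianLaw I) hIm)
      hasGaussianLaw_comp_snd ?_
    exact indepFun_prod hIm measurable_id
  let Y : S → ((I → ℝ) × (S → ℝ) →L[ℝ] ℝ) := fun i =>
    (ContinuousLinearMap.proj (R := ℝ) (φ := fun _ : I => ℝ) ⟨x i, hx i⟩).comp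
      (ContinuousLinearMap.fst ℝ _ _) +
    (ContinuousLinearMap.proj (R := ℝ) (φ := fun _ : S => ℝ) i).comp
      (ContinuousLinearMap.snd ℝ _ _)
  let W : (I → ℝ) × (S → ℝ) →L[ℝ] ℝ :=
    (ContinuousLinearMap.proj (R := ℝ) (φ := fun _ : I => ℝ) ⟨z, hz⟩).comp
      (ContinuousLinearMap.fst ℝ _ _) - ∑ i : S, gpCoeff k σ x S z i • Y i
  have h := hb.map_fun ((ContinuousLinearMap.pi fun _ : Unit => W).prod (ContinuousLinearMap.pi Y))
  have h' : (fun p : Ω × (S → ℝ) => ((ContinuousLinearMap.pi fun _ : Unit => W).prod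
      (ContinuousLinearMap.pi Y)) (I.restrict (f p.1), p.2)) =
      fun p => ((fun _ : Unit => residual f k σ x S z p), fun i : S => f p.1 (x i) + p.2 i) := by
    funext p
    refine Prod.ext (funext fun _ => ?_) (funext fun i => ?_)
    · change W _ = _
      simp [W, Y, residual, mul_add]
    · simp [Y]
  rw [← h']
  exact h

variable (hf : IsGaussianProcess (fun z ω => f ω z) P)
  (hfm : ∀ z, Measurable fun ω => f ω z) (hmean : ∀ z, ∫ ω, f ω z ∂P = 0)
  (hcov : ∀ z z', cov[fun ω => f ω z, fun ω => f ω z'; P] = k z z')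

omit [IsProbabilityMeasure P] in
include hf hfm in
lemma memLp_two_comp_fst (S : Finset ℕ) (z : X) :
    MemLp (fun p : Ω × (S → ℝ) => f p.1 z) 2 (P.prod (finNoiseLaw v S)) :=
  (hasGaussianLaw_comp_fst (hf.hasGaussianLaw_eval z) (hfm z)).memLp_two

lemma memLp_two_comp_snd (S : Finset ℕ) (i : S) :
    MemLp (fun p : Ω × (S → ℝ) => p.2 i) 2 (P.prod (finNoiseLaw v S)) :=
  (HasGaussianLaw.eval (X := fun (i : S) (p : Ω × (S → ℝ)) => p.2 i)
    hasGaussianLaw_comp_snd i).memLp_two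

omit [IsProbabilityMeasure P] in
include hfm hcov in
lemma covariance_comp_fst (S : Finset ℕ) (z z' : X) :
    cov[fun p : Ω × (S → ℝ) => f p.1 z, fun p => f p.1 z'; P.prod (finNoiseLaw v S)] = k z z' := by
  have h := covariance_map_fun (μ := P.prod (finNoiseLaw v S)) (Z := Prod.fst)
    (X := fun ω => f ω z) (Y := fun ω => f ω z') (hfm z).aestronglyMeasurable
    (hfm z').aestronglyMeasurable measurable_fst.aemeasurable
  rw [← h, Measure.map_fst_prod]
  simpa using hcov z z'

lemma covariance_comp_snd (S : Finset ℕ) (i j : S) :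
    cov[fun p : Ω × (S → ℝ) => p.2 i, fun p => p.2 j; P.prod (finNoiseLaw v S)] =
      if i = j then (v : ℝ) else 0 := by
  have h := covariance_map_fun (μ := P.prod (finNoiseLaw v S)) (Z := Prod.snd)
    (X := fun e => e i) (Y := fun e => e j) (measurable_pi_apply i).aestronglyMeasurable
    (measurable_pi_apply j).aestronglyMeasurable measurable_snd.aemeasurable
  rw [← h, Measure.map_snd_prod]
  simpa using covariance_finNoiseLaw S i j

include hf in
lemma covariance_fst_snd (S : Finset ℕ) (z : X) (i : S) :
    cov[fun p : Ω × (S → ℝ) => f p.1 z, fun p => p.2 i; P.prod (finNoiseLaw v S)] = 0 :=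
  covariance_fst_snd_prod (hf.hasGaussianLaw_eval z).memLp_two
    (hasLaw_finNoiseLaw S i).hasGaussianLaw.memLp_two

include hf hfm in
lemma memLp_two_obs (x : ℕ → X) (S : Finset ℕ) (i : S) :
    MemLp (fun p : Ω × (S → ℝ) => f p.1 (x i) + p.2 i) 2 (P.prod (finNoiseLaw v S)) :=
  (memLp_two_comp_fst hf hfm S _).add (memLp_two_comp_snd S i)

include hf hfm hcov in
lemma covariance_fst_obs (x : ℕ → X) (S : Finset ℕ) (z : X) (i : S) :
    cov[fun p : Ω × (S → ℝ) => f p.1 z, fun p => f p.1 (x i) + p.2 i;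
      P.prod (finNoiseLaw v S)] = k z (x i) := by
  have h := covariance_add_right (memLp_two_comp_fst (v := v) hf hfm S z)
    (memLp_two_comp_fst (v := v) hf hfm S (x i)) (memLp_two_comp_snd S i)
  rw [covariance_comp_fst hfm hcov, covariance_fst_snd hf, add_zero] at h
  exact h

include hf hfm hcov in
lemma covariance_obs (hv : (v : ℝ) = σ ^ 2) (x : ℕ → X) (S : Finset ℕ) (i j : S) :
    cov[fun p : Ω × (S → ℝ) => f p.1 (x i) + p.2 i, fun p => f p.1 (x j) + p.2 j;
      P.prod (finNoiseLaw v S)] = regGram k σ x S i j := by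
  have h := covariance_add_left (memLp_two_comp_fst (v := v) hf hfm S (x i))
    (memLp_two_comp_snd S i) (memLp_two_obs hf hfm x S j)
  rw [covariance_fst_obs hf hfm hcov] at h
  have h2 := covariance_add_right (memLp_two_comp_snd (P := P) (v := v) S i)
    (memLp_two_comp_fst (v := v) hf hfm S (x j)) (memLp_two_comp_snd S j)
  rw [covariance_comp_snd, covariance_comm (fun p : Ω × (S → ℝ) => p.2 i) fun p => f p.1 (x j),
    covariance_fst_snd hf, zero_add] at h2
  rw [regGram_apply, ← hv]
  simp only [Subtype.coe_inj]
  rw [← h2]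
  exact h

include hf hfm in
lemma memLp_two_residual (x : ℕ → X) (S : Finset ℕ) (z : X) :
    MemLp (residual f k σ x S z) 2 (P.prod (finNoiseLaw v S)) :=
  (memLp_two_comp_fst hf hfm S z).sub
    (memLp_finsetSum _ fun i _ => (memLp_two_obs hf hfm x S i).const_mul _)

include hf hfm in
lemma covariance_residual (x : ℕ → X) (S : Finset ℕ) (z : X) {g : Ω × (S → ℝ) → ℝ}
    (hg : MemLp g 2 (P.prod (finNoiseLaw v S))) :
    cov[residual f k σ x S z, g; P.prod (finNoiseLaw v S)] =
      cov[fun p => f p.1 z, g; P.prod (finNoiseLaw v S)] - ∑ i : S, gpCoeff k σ x S z i *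
        cov[fun p => f p.1 (x i) + p.2 i, g; P.prod (finNoiseLaw v S)] := by
  have h1 := fun i : S => (memLp_two_obs (v := v) hf hfm x S i).const_mul (gpCoeff k σ x S z i)
  have h := covariance_fun_sub_left (memLp_two_comp_fst (v := v) hf hfm S z)
    (memLp_finsetSum Finset.univ fun i _ => h1 i) hg
  rw [covariance_fun_sum_left h1 hg] at h
  simp only [covariance_const_mul_left] at h
  exact h

variable {H : Type*} [NormedAddCommGroup H] [InnerProductSpace ℝ H] {φ : X → H}
  (hk : ∀ z z', k z z' = inner ℝ (φ z) (φ z')) (hσ : 0 < σ) (hv : (v : ℝ) = σ ^ 2)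

include hf hfm hcov hk hσ hv

/-- These are the normal equations for `gpCoeff`. -/
lemma covariance_residual_obs (x : ℕ → X) (S : Finset ℕ) (z : X) (j : S) :
    cov[residual f k σ x S z, fun p => f p.1 (x j) + p.2 j; P.prod (finNoiseLaw v S)] = 0 := by
  rw [covariance_residual hf hfm x S z (memLp_two_obs hf hfm x S j),
    covariance_fst_obs hf hfm hcov]
  simp only [covariance_obs hf hfm hcov hv]
  have h := congrFun (regGram_mulVec_inv hk hσ x S (kvec k x S z)) j
  rw [Matrix.mulVec, dotProduct] at h
  rw [sub_eq_zero, ← show kvec k x S z j = k z (x j) from rfl, ← h]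
  refine Finset.sum_congr rfl fun i _ => ?_
  rw [mul_comm, (regGram_isSymm hk x S).apply]
  rfl

lemma variance_residual (x : ℕ → X) (S : Finset ℕ) (z : X) :
    Var[residual f k σ x S z; P.prod (finNoiseLaw v S)] = gpVar k σ x S z := by
  have hr := memLp_two_residual (v := v) (k := k) (σ := σ) hf hfm x S z
  rw [← covariance_self hr.aemeasurable, covariance_residual hf hfm x S z hr]
  simp only [covariance_comm _ (residual f k σ x S z),
    covariance_residual_obs hf hfm hcov hk hσ hv, mul_zero, Finset.sum_const_zero, sub_zero]
  rw [covariance_residual hf hfm x S z (memLp_two_comp_fst hf hfm S z),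
    covariance_comp_fst hfm hcov]
  simp only [covariance_comm _ (fun p : Ω × (S → ℝ) => f p.1 z), covariance_fst_obs hf hfm hcov]
  exact congrArg (k z z - ·) (dotProduct_inv_comm hk x S _ _)

/-- Uncorrelated and jointly Gaussian. Thus the law of the residual given the data is its
unconditional law, with variance `gpVar`. -/
lemma indepFun_residual_obs (x : ℕ → X) (S : Finset ℕ) (z : X) :
    IndepFun (residual f k σ x S z) (fun p (i : S) => f p.1 (x i) + p.2 i)
      (P.prod (finNoiseLaw v S)) :=
  ((hasGaussianLaw_residual hf hfm x S z).indepFun_of_covariance_eval fun _ j =>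
    covariance_residual_obs hf hfm hcov hk hσ hv x S z j).comp
      (φ := fun g : Unit → ℝ => g ()) (ψ := id) (measurable_pi_apply _) measurable_id

include hmean

omit hcov hk hσ hv in
lemma integral_residual (x : ℕ → X) (S : Finset ℕ) (z : X) :
    ∫ p, residual f k σ x S z p ∂P.prod (finNoiseLaw v S) = 0 := by
  have h1 : ∀ z, ∫ p, f p.1 z ∂P.prod (finNoiseLaw v S) = 0 := fun z => by
    rw [integral_fun_fst (fun ω => f ω z)]
    simp [hmean]
  have h2 : ∀ i : S, ∫ p : Ω × (S → ℝ), p.2 i ∂P.prod (finNoiseLaw v S) = 0 := fun i => by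
    rw [integral_fun_snd (fun e : S → ℝ => e i), (hasLaw_finNoiseLaw S i).integral_eq]
    simp
  have hi := fun i => (memLp_two_obs (v := v) hf hfm x S i).integrable one_le_two
  unfold residual
  rw [integral_sub ((memLp_two_comp_fst hf hfm S z).integrable one_le_two)
    (integrable_finsetSum _ fun i _ => (hi i).const_mul _),
    integral_finsetSum _ fun i _ => (hi i).const_mul _, h1, zero_sub, neg_eq_zero]
  refine Finset.sum_eq_zero fun i _ => ?_
  rw [integral_const_mul, integral_add ((memLp_two_comp_fst hf hfm S _).integrable one_le_two)
    ((memLp_two_comp_snd S i).integrable one_le_two), h1, h2, add_zero, mul_zero]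

lemma measure_residual_gt_le (x : ℕ → X) (S : Finset ℕ) (z : X) {r : ℝ} (hr : 0 ≤ r) :
    P.prod (finNoiseLaw v S) {p | r * gpSd k σ x S z < |residual f k σ x S z p|} ≤
      ENNReal.ofReal (Real.exp (-(r ^ 2 / 2))) := by
  have h1 := hasGaussianLaw_residual (v := v) (k := k) (σ := σ) hf hfm x S z
  have h2 : HasGaussianLaw (residual f k σ x S z) (P.prod (finNoiseLaw v S)) :=
    HasGaussianLaw.eval (X := fun (_ : Unit) => residual f k σ x S z) h1.fst ()
  have h3 := h2.map_eq_gaussianReal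
  rw [variance_residual hf hfm hcov hk hσ hv, integral_residual hf hfm hmean] at h3
  have h4 := gaussianReal_abs_gt_le hr (gpVar k σ x S z).toNNReal
  have h5 : MeasurableSet {u : ℝ | r * √((gpVar k σ x S z).toNNReal : ℝ) < |u|} :=
    measurableSet_lt measurable_const measurable_id.abs
  rw [← h3, Measure.map_apply_of_aemeasurable h2.aemeasurable h5, Real.coe_toNNReal _
    (gpVar_nonneg hk hσ x S z)] at h4
  exact h4

end Conditioning

/-! ### Posterior tails for every observation vector -/

section PosteriorTail

open scoped NNReal ENNReal
open Filter Topology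

variable {v : ℝ≥0}

/-- Translation of finitely many coordinates of the noise. -/
lemma lintegral_add_finNoiseLaw (hv : v ≠ 0) {n : ℕ} {S : Finset ℕ} (hS : S = Finset.Icc 1 n)
    (F : S → ℝ) {G : (S → ℝ) → ℝ≥0∞} (hG : Measurable G) :
    ∫⁻ e, G (F + e) ∂finNoiseLaw v S =
      ∫⁻ e, G e * ∏ i, tilt v (F i) (e i) ∂finNoiseLaw v S := by
  -- The general change of measure is reused with the rounds themselves as query points and the
  -- shift as the objective.
  let g : ℕ → ℝ := fun i => if h : i ∈ S then F ⟨i, h⟩ else 0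
  have hg : ∀ i : S, g i = F i := fun i => dif_pos i.2
  have hd : IsNonanticipative fun (_ : ℕ → ℝ) (t : ℕ) => t := fun _ _ _ _ => rfl
  have hm : Measurable (S.restrict : (ℕ → ℝ) → S → ℝ) := measurable_pi_lambda _ fun i =>
    measurable_pi_apply _
  have hr : (noiseLaw v).map S.restrict = finNoiseLaw v S := Measure.infinitePi_map_restrict _
  have h1 : Measurable fun e => G (F + e) := hG.comp (measurable_const.add measurable_id)
  have h2 : Measurable fun e : S → ℝ => G e * ∏ i, tilt v (F i) (e i) :=
    hG.mul (Finset.measurable_fun_prod _ fun i _ => measurable_tilt measurable_const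
      (measurable_pi_apply i))
  rw [← hr, lintegral_map h1 hm, lintegral_map h2 hm]
  have h3 := lintegral_response hv hd (fun t => measurable_const) (g := g) (measurable_of_countable g)
    n (hG.comp hm)
  refine (lintegral_congr fun e => ?_).trans (h3.trans (lintegral_congr fun e => ?_))
  · refine congrArg G (funext fun i => ?_)
    have hi : (i : ℕ) ∈ Finset.Icc 1 n := by
      rw [← hS]
      exact i.2
    rw [Finset.mem_Icc] at hi
    obtain ⟨j, hj⟩ : ∃ j, (i : ℕ) = j + 1 := ⟨i - 1, by omega⟩
    have h4 := response_succ hd g e (n := j) (m := n) (by omega)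
    rw [← hj, hg] at h4
    exact h4.symm
  · rw [likelihood, ← hS, ← Finset.prod_coe_sort]
    simp only [hg]
    rfl

lemma tilt_eq (hv : v ≠ 0) (a u : ℝ) : tilt v a u =
    ENNReal.ofReal (Real.exp (u ^ 2 / (2 * v))) *
      ENNReal.ofReal (Real.exp (-((u - a) ^ 2 / (2 * v)))) := by
  have hv' : (0 : ℝ) < v := by exact_mod_cast pos_iff_ne_zero.2 hv
  rw [tilt, ← ENNReal.ofReal_mul (Real.exp_pos _).le, ← Real.exp_add]
  congr 2
  field_simp
  ring

variable {X Ω : Type*} [MeasurableSpace Ω] {P : Measure Ω} [IsProbabilityMeasure P]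

/-- If a likelihood-weighted open event is dominated for almost every observation vector, then it is
dominated for every observation vector. -/
lemma lintegral_indicator_le_of_ae (hv : v ≠ 0) {S : Finset ℕ} {F : Ω → S → ℝ} (hF : Measurable F)
    {A : Set (Ω × (S → ℝ))} (hAm : MeasurableSet A) (hAo : ∀ ω, IsOpen {e | (ω, e) ∈ A})
    {c : ℝ≥0∞} (hc : c ≠ ⊤)
    (h : ∀ᵐ e ∂finNoiseLaw v S, ∫⁻ ω, A.indicator 1 (ω, e) * ∏ i, tilt v (F ω i) (e i) ∂P ≤
      c * ∫⁻ ω, ∏ i, tilt v (F ω i) (e i) ∂P) (e : S → ℝ) :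
    ∫⁻ ω, A.indicator 1 (ω, e) * ∏ i, tilt v (F ω i) (e i) ∂P ≤
      c * ∫⁻ ω, ∏ i, tilt v (F ω i) (e i) ∂P := by
  -- Completing the square splits the likelihood into a factor `M` of the observations, which
  -- cancels, and a kernel `K ≤ 1` continuous in them; boundedness permits passage to the limit.
  let K : Ω → (S → ℝ) → ℝ≥0∞ := fun ω e =>
    ENNReal.ofReal (∏ i, Real.exp (-((e i - F ω i) ^ 2 / (2 * v))))
  let M : (S → ℝ) → ℝ≥0∞ := fun e => ∏ i, ENNReal.ofReal (Real.exp (e i ^ 2 / (2 * v)))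
  have hM0 : ∀ e, M e ≠ 0 := fun e => Finset.prod_ne_zero_iff.2 fun i _ => by
    simpa using Real.exp_pos _
  have hMt : ∀ e, M e ≠ ⊤ := fun e => ENNReal.prod_ne_top fun i _ => ENNReal.ofReal_ne_top
  have hK : ∀ ω e, ∏ i, tilt v (F ω i) (e i) = M e * K ω e := fun ω e => by
    simp only [tilt_eq hv, Finset.prod_mul_distrib, M, K]
    rw [ENNReal.ofReal_prod_of_nonneg fun i _ => (Real.exp_pos _).le]
  have hKm : ∀ e, Measurable fun ω => K ω e := fun e => by
    refine ENNReal.measurable_ofReal.comp (Finset.measurable_fun_prod _ fun i _ => ?_)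
    have := (measurable_pi_apply i).comp hF
    simp only [Function.comp_def] at this
    fun_prop
  have hKc : ∀ ω, Continuous (K ω) := fun ω => by
    refine ENNReal.continuous_ofReal.comp (continuous_finsetProd _ fun i _ => ?_)
    fun_prop
  have hK1 : ∀ ω e, K ω e ≤ 1 := fun ω e => by
    rw [ENNReal.ofReal_le_one]
    refine Finset.prod_le_one (fun i _ => (Real.exp_pos _).le) fun i _ => ?_
    rw [Real.exp_le_one_iff, neg_nonpos]
    positivity
  have hAe : ∀ e, Measurable fun ω => A.indicator (1 : Ω × (S → ℝ) → ℝ≥0∞) (ω, e) := fun e =>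
    (measurable_one.indicator hAm).comp measurable_prodMk_right
  have hiff : ∀ e, (∫⁻ ω, A.indicator 1 (ω, e) * ∏ i, tilt v (F ω i) (e i) ∂P ≤
      c * ∫⁻ ω, ∏ i, tilt v (F ω i) (e i) ∂P) ↔
      ∫⁻ ω, A.indicator 1 (ω, e) * K ω e ∂P ≤ c * ∫⁻ ω, K ω e ∂P := fun e => by
    simp only [hK, mul_left_comm _ (M e)]
    have h1 : Measurable fun ω => A.indicator (1 : Ω × (S → ℝ) → ℝ≥0∞) (ω, e) * K ω e :=
      (hAe e).mul (hKm e)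
    rw [lintegral_const_mul _ h1, lintegral_const_mul _ (hKm e),
      mul_left_comm, ENNReal.mul_le_mul_iff_right (hM0 e) (hMt e)]
  simp only [hiff] at h ⊢
  have : (gaussianReal 0 v).IsOpenPosMeasure :=
    -- The noise law charges every open set, so the good observation vectors are dense.
    (gaussianReal_absolutelyContinuous' 0 hv).isOpenPosMeasure
  obtain ⟨u, hu, hue⟩ := mem_closure_iff_seq_limit.1
    ((Measure.dense_of_ae h).closure_eq ▸ Set.mem_univ e)
  have hB : Tendsto (fun m => c * ∫⁻ ω, K ω (u m) ∂P) atTop (𝓝 (c * ∫⁻ ω, K ω e ∂P)) := by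
    refine ENNReal.Tendsto.const_mul ?_ (Or.inr hc)
    refine tendsto_lintegral_of_dominated_convergence (fun _ => 1) (fun m => hKm _)
      (fun m => ae_of_all _ fun ω => hK1 ω _) (by simp) (ae_of_all _ fun ω => ?_)
    exact ((hKc ω).tendsto e).comp hue
  -- Openness of the event makes its indicator lower semicontinuous, so Fatou's lemma treats the
  -- left side; dominated convergence treats the right.
  calc ∫⁻ ω, A.indicator 1 (ω, e) * K ω e ∂P
      ≤ ∫⁻ ω, liminf (fun m => A.indicator 1 (ω, u m) * K ω (u m)) atTop ∂P := by
        refine lintegral_mono fun ω => ?_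
        by_cases he : (ω, e) ∈ A
        · rw [Set.indicator_of_mem he, Pi.one_apply, one_mul]
          refine le_of_eq (Tendsto.liminf_eq ?_).symm
          refine (((hKc ω).tendsto e).comp hue).congr' ?_
          filter_upwards [hue.eventually ((hAo ω).mem_nhds he)] with m hm
          rw [Set.indicator_of_mem hm, Pi.one_apply, one_mul]
          rfl
        · simp [Set.indicator_of_notMem he]
    _ ≤ liminf (fun m => ∫⁻ ω, A.indicator 1 (ω, u m) * K ω (u m) ∂P) atTop :=
        lintegral_liminf_le fun m => (hAe _).mul (hKm _)
    _ ≤ liminf (fun m => c * ∫⁻ ω, K ω (u m) ∂P) atTop :=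
        liminf_le_liminf (Eventually.of_forall hu)
    _ = c * ∫⁻ ω, K ω e ∂P := hB.liminf_eq

variable {H : Type*} [NormedAddCommGroup H] [InnerProductSpace ℝ H] {φ : X → H}
  {k : X → X → ℝ} {σ : ℝ} {f : Ω → X → ℝ}
  (hf : IsGaussianProcess (fun z ω => f ω z) P)
  (hfm : ∀ z, Measurable fun ω => f ω z) (hmean : ∀ z, ∫ ω, f ω z ∂P = 0)
  (hcov : ∀ z z', cov[fun ω => f ω z, fun ω => f ω z'; P] = k z z')
  (hk : ∀ z z', k z z' = inner ℝ (φ z) (φ z')) (hσ : 0 < σ) (hv : (v : ℝ) = σ ^ 2)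

include hf hfm hmean hcov hk hσ hv

/-- Posterior tail bound of a Gaussian process for a deterministic design. -/
lemma lintegral_abs_sub_gpMean_gt_le (x : ℕ → X) (n : ℕ) (z : X) {r : ℝ} (hr : 0 ≤ r)
    (e : ℕ → ℝ) :
    ∫⁻ ω, {ω | r * gpSd k σ x (Finset.Icc 1 n) z <
        |f ω z - gpMean k σ x e (Finset.Icc 1 n) z|}.indicator 1 ω *
          likelihood v (fun _ => x) (f ω) n e ∂P ≤
      ENNReal.ofReal (Real.exp (-(r ^ 2 / 2))) *
        ∫⁻ ω, likelihood v (fun _ => x) (f ω) n e ∂P := by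
  set S := Finset.Icc 1 n with hS
  have hv0 : v ≠ 0 := by
    rintro rfl
    have : 0 < σ ^ 2 := by positivity
    simp at hv
    exact hσ.ne' (pow_eq_zero_iff two_ne_zero |>.1 hv.symm)
  let A : Set (Ω × (S → ℝ)) := {p | r * gpSd k σ x S z < |f p.1 z - gpCoeff k σ x S z ⬝ᵥ p.2|}
  have hAc : ∀ ω, Continuous fun e : S → ℝ => |f ω z - gpCoeff k σ x S z ⬝ᵥ e| := fun ω => by
    unfold dotProduct
    fun_prop
  have hAm : MeasurableSet A := by
    refine measurableSet_lt measurable_const (Measurable.abs (Measurable.sub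
      ((hfm z).comp measurable_fst) ?_))
    exact Finset.measurable_fun_sum _ fun i _ =>
      ((measurable_pi_apply i).comp measurable_snd).const_mul _
  let F : Ω → S → ℝ := fun ω i => f ω (x i)
  have hF : Measurable F := measurable_pi_lambda _ fun i => hfm _
  let Lk : Ω × (S → ℝ) → ℝ≥0∞ := fun p => ∏ i, tilt v (F p.1 i) (p.2 i)
  have hLk : Measurable Lk := Finset.measurable_fun_prod _ fun i _ =>
    measurable_tilt ((hfm _).comp measurable_fst) ((measurable_pi_apply i).comp measurable_snd)
  have hobs : Measurable fun p : Ω × (S → ℝ) => F p.1 + p.2 :=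
    (hF.comp measurable_fst).add measurable_snd
  -- Bayes' formula: weighting by the likelihood and integrating over pure noise in `s` amounts to
  -- evaluating at the true observations, restricted to `s`.
  have key : ∀ {G : Ω × (S → ℝ) → ℝ≥0∞}, Measurable G → ∀ {s : Set (S → ℝ)}, MeasurableSet s →
      ∫⁻ e in s, ∫⁻ ω, G (ω, e) * Lk (ω, e) ∂P ∂finNoiseLaw v S =
        ∫⁻ p, s.indicator 1 (F p.1 + p.2) * G (p.1, F p.1 + p.2) ∂P.prod (finNoiseLaw v S) := by
    intro G hG s hs
    have h1 : Measurable fun p : Ω × (S → ℝ) => s.indicator (1 : (S → ℝ) → ℝ≥0∞) p.2 :=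
      (measurable_one.indicator hs).comp measurable_snd
    have h2 : Measurable fun p : Ω × (S → ℝ) =>
        s.indicator 1 (F p.1 + p.2) * G (p.1, F p.1 + p.2) :=
      ((measurable_one.indicator hs).comp hobs).mul (hG.comp (measurable_fst.prodMk hobs))
    have h3 : Measurable fun p : Ω × (S → ℝ) =>
        s.indicator (1 : (S → ℝ) → ℝ≥0∞) p.2 * G p * Lk p := (h1.mul hG).mul hLk
    rw [lintegral_prod _ h2.aemeasurable, ← lintegral_indicator hs]
    have h4 : ∀ ω, ∫⁻ e, s.indicator 1 (F ω + e) * G (ω, F ω + e) ∂finNoiseLaw v S =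
        ∫⁻ e, s.indicator 1 e * G (ω, e) * Lk (ω, e) ∂finNoiseLaw v S := fun ω =>
      lintegral_add_finNoiseLaw hv0 hS (F ω)
        (G := fun e => s.indicator 1 e * G (ω, e))
        ((measurable_one.indicator hs).mul (hG.comp measurable_prodMk_left))
    simp only [h4]
    rw [lintegral_lintegral_swap (f := fun ω e => s.indicator 1 e * G (ω, e) * Lk (ω, e))
      h3.aemeasurable]
    refine lintegral_congr fun e => ?_
    by_cases he : e ∈ s <;> simp [he]
  -- Tested on each measurable set of observations, the claim is the independence of residual and
  -- observations together with the tail of the residual.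
  have hae : ∀ᵐ e ∂finNoiseLaw v S, ∫⁻ ω, A.indicator 1 (ω, e) * Lk (ω, e) ∂P ≤
      ENNReal.ofReal (Real.exp (-(r ^ 2 / 2))) * ∫⁻ ω, Lk (ω, e) ∂P := by
    have hI : Measurable (A.indicator (1 : Ω × (S → ℝ) → ℝ≥0∞)) := measurable_one.indicator hAm
    refine ae_le_of_forall_setLIntegral_le_of_sigmaFinite
      (Measurable.lintegral_prod_left' (hI.mul hLk)) fun s hs _ => ?_
    rw [key hI hs, lintegral_const_mul _ (Measurable.lintegral_prod_left' hLk)]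
    have h1 := key (G := fun _ => 1) measurable_const hs
    simp only [one_mul, mul_one] at h1
    rw [h1]
    have h2 := (indepFun_residual_obs hf hfm hcov hk hσ hv x S z).measure_inter_preimage_eq_mul
      {u | r * gpSd k σ x S z < |u|} s (measurableSet_lt measurable_const measurable_id.abs) hs
    have h3 : ∀ p : Ω × (S → ℝ), f p.1 z - gpCoeff k σ x S z ⬝ᵥ (F p.1 + p.2) =
        residual f k σ x S z p := fun p => rfl
    have h4 : ∀ p : Ω × (S → ℝ), s.indicator (1 : (S → ℝ) → ℝ≥0∞) (F p.1 + p.2) *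
        A.indicator 1 (p.1, F p.1 + p.2) =
        (residual f k σ x S z ⁻¹' {u | r * gpSd k σ x S z < |u|} ∩
          (fun p (i : S) => f p.1 (x i) + p.2 i) ⁻¹' s).indicator 1 p := fun p => by
      by_cases ha : r * gpSd k σ x S z < |residual f k σ x S z p|
      · have h5 : (p.1, F p.1 + p.2) ∈ A := ha
        rw [Set.indicator_of_mem h5, Pi.one_apply, mul_one]
        by_cases hb : F p.1 + p.2 ∈ s
        · rw [Set.indicator_of_mem hb, Set.indicator_of_mem]
          · rfl
          · exact ⟨ha, hb⟩
        · rw [Set.indicator_of_notMem hb, Set.indicator_of_notMem]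
          exact fun h => hb h.2
      · have h5 : (p.1, F p.1 + p.2) ∉ A := ha
        rw [Set.indicator_of_notMem h5, mul_zero, Set.indicator_of_notMem]
        exact fun h => ha h.1
    have hres : Measurable (residual f k σ x S z) :=
      ((hfm z).comp measurable_fst).sub (Finset.measurable_fun_sum _ fun i _ =>
        (((hfm _).comp measurable_fst).add
          ((measurable_pi_apply i).comp measurable_snd)).const_mul _)
    have hT : MeasurableSet {u : ℝ | r * gpSd k σ x S z < |u|} :=
      measurableSet_lt measurable_const measurable_id.abs
    have h7 : ∫⁻ p, s.indicator (1 : (S → ℝ) → ℝ≥0∞) (F p.1 + p.2) ∂P.prod (finNoiseLaw v S) =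
        P.prod (finNoiseLaw v S) ((fun p (i : S) => f p.1 (x i) + p.2 i) ⁻¹' s) :=
      lintegral_indicator_one (hobs hs)
    simp only [h4]
    have hsm : MeasurableSet ((fun (p : Ω × (S → ℝ)) (i : S) => f p.1 (x i) + p.2 i) ⁻¹' s) :=
      hobs hs
    rw [lintegral_indicator_one ((hres hT).inter hsm), h2, h7]
    gcongr
    exact measure_residual_gt_le hf hfm hmean hcov hk hσ hv x S z hr
  -- An almost sure bound would not do: its exceptional set depends on the design, and the design
  -- will be chosen as a function of `e`.
  have h := lintegral_indicator_le_of_ae hv0 hF hAm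
    (fun ω => isOpen_lt continuous_const (hAc ω)) ENNReal.ofReal_ne_top hae fun i => e i
  have h8 : ∀ ω, likelihood v (fun _ => x) (f ω) n e = ∏ i : S, tilt v (F ω i) (e i) := fun ω => by
    rw [likelihood, ← Finset.prod_coe_sort]
  simp only [h8, gpMean_eq_gpCoeff hk]
  exact h

end PosteriorTail

/-! ### Posterior tails for adaptive designs -/

section AdaptiveTail

open scoped NNReal ENNReal

variable {X Ω : Type*} [MeasurableSpace X] [MeasurableSpace Ω] {P : Measure Ω}
  [IsProbabilityMeasure P] {v : ℝ≥0}
  {H : Type*} [NormedAddCommGroup H] [InnerProductSpace ℝ H] {φ : X → H}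
  {k : X → X → ℝ} {σ : ℝ} {f : Ω → X → ℝ}

/-- Posterior tail bound of a Gaussian process for an adaptive design. -/
lemma measure_response_gt_le (hf : IsGaussianProcess (fun z ω => f ω z) P)
    (hfm : Measurable fun p : Ω × X => f p.1 p.2) (hmean : ∀ z, ∫ ω, f ω z ∂P = 0)
    (hcov : ∀ z z', cov[fun ω => f ω z, fun ω => f ω z'; P] = k z z')
    (hk : ∀ z z', k z z' = inner ℝ (φ z) (φ z')) (hσ : 0 < σ) (hv : (v : ℝ) = σ ^ 2)
    (hkm : Measurable fun p : X × X => k p.1 p.2)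
    {d : (ℕ → ℝ) → ℕ → X} (hd : IsNonanticipative d) (hdm : ∀ t, Measurable fun y => d y t)
    {Z : (ℕ → ℝ) → X} (hZ : Measurable Z) (n : ℕ) {r : ℝ} (hr : 0 ≤ r) :
    P.prod (noiseLaw v) {p | r * gpSd k σ (d (response d (f p.1) p.2 n)) (Finset.Icc 1 n)
        (Z (response d (f p.1) p.2 n)) < |f p.1 (Z (response d (f p.1) p.2 n)) -
          gpMean k σ (d (response d (f p.1) p.2 n)) (response d (f p.1) p.2 n) (Finset.Icc 1 n)
            (Z (response d (f p.1) p.2 n))|} ≤ ENNReal.ofReal (Real.exp (-(r ^ 2 / 2))) := by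
  set S := Finset.Icc 1 n with hS
  have hv0 : v ≠ 0 := by
    rintro rfl
    exact hσ.ne' (pow_eq_zero_iff two_ne_zero |>.1 hv.symm)
  let A : Set (Ω × (ℕ → ℝ)) := {p | r * gpSd k σ (d p.2) S (Z p.2) <
    |f p.1 (Z p.2) - gpMean k σ (d p.2) p.2 S (Z p.2)|}
  have hZ' : Measurable fun p : Ω × (ℕ → ℝ) => Z p.2 := hZ.comp measurable_snd
  have hA : MeasurableSet A := by
    refine measurableSet_lt ((measurable_gpSd hkm (fun i _ => (hdm i).comp measurable_snd)
      hZ').const_mul r) (Measurable.abs (Measurable.sub (hfm.comp (measurable_fst.prodMk hZ')) ?_))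
    exact measurable_gpMean hkm (fun i _ => (hdm i).comp measurable_snd)
      (fun i _ => (measurable_pi_apply i).comp measurable_snd) hZ'
  have hI : Measurable (A.indicator (1 : Ω × (ℕ → ℝ) → ℝ≥0∞)) := measurable_one.indicator hA
  have hY : Measurable fun p : Ω × (ℕ → ℝ) => response d (f p.1) p.2 n :=
    measurable_response (g := fun p : Ω × (ℕ → ℝ) => f p.1) hdm
      (hfm.comp ((measurable_fst.comp measurable_fst).prodMk measurable_snd)) measurable_snd n
  have hL : Measurable fun p : Ω × (ℕ → ℝ) => likelihood v d (f p.1) n p.2 :=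
    measurable_likelihood (g := fun p : Ω × (ℕ → ℝ) => f p.1) hdm
      (hfm.comp ((measurable_fst.comp measurable_fst).prodMk measurable_snd)) measurable_snd n
  have hfω : ∀ ω, Measurable (f ω) := fun ω => hfm.comp measurable_prodMk_left
  have key : ∀ {G : Ω × (ℕ → ℝ) → ℝ≥0∞}, Measurable G →
      ∫⁻ p, G (p.1, response d (f p.1) p.2 n) ∂P.prod (noiseLaw v) =
        ∫⁻ e, ∫⁻ ω, G (ω, e) * likelihood v d (f ω) n e ∂P ∂noiseLaw v := fun {G} hG => by
    have hGY : Measurable fun p : Ω × (ℕ → ℝ) => G (p.1, response d (f p.1) p.2 n) :=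
      hG.comp (measurable_fst.prodMk hY)
    rw [lintegral_prod _ hGY.aemeasurable,
      ← lintegral_lintegral_swap (f := fun ω e => G (ω, e) * likelihood v d (f ω) n e)
        (hG.mul hL).aemeasurable]
    exact lintegral_congr fun ω => lintegral_response hv0 hd hdm (hfω ω) n
      (hG.comp measurable_prodMk_left)
  -- The mixture of the likelihoods over the prior is a probability density.
  have h1 : ∫⁻ e, ∫⁻ ω, likelihood v d (f ω) n e ∂P ∂noiseLaw v = 1 := by
    have := key (G := fun _ => 1) measurable_const
    simpa using this.symm
  have h2 : P.prod (noiseLaw v) ((fun p => (p.1, response d (f p.1) p.2 n)) ⁻¹' A) =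
      ∫⁻ p, A.indicator 1 (p.1, response d (f p.1) p.2 n) ∂P.prod (noiseLaw v) :=
    (lintegral_indicator_one ((measurable_fst.prodMk hY) hA)).symm
  refine h2.trans_le ?_
  rw [key hI]
  -- For fixed `e` the likelihood of `d` is that of the constant design `d e`, and `Z e` is a fixed
  -- point, so the fixed-design bound applies under the outer integral.
  calc ∫⁻ e, ∫⁻ ω, A.indicator 1 (ω, e) * likelihood v d (f ω) n e ∂P ∂noiseLaw v
      ≤ ∫⁻ e, ENNReal.ofReal (Real.exp (-(r ^ 2 / 2))) *
        ∫⁻ ω, likelihood v d (f ω) n e ∂P ∂noiseLaw v :=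
        lintegral_mono fun e => lintegral_abs_sub_gpMean_gt_le hf
          (fun z => hfm.comp measurable_prodMk_right) hmean hcov hk hσ hv (d e) n (Z e) hr e
    _ = ENNReal.ofReal (Real.exp (-(r ^ 2 / 2))) := by
        rw [lintegral_const_mul _ (Measurable.lintegral_prod_left' hL), h1, mul_one]

end AdaptiveTail

/-! ### Samples of a Gaussian process and path space -/

section Sample

open scoped NNReal ENNReal

variable {X Ω : Type*} [MeasurableSpace Ω] {P : Measure Ω} [IsProbabilityMeasure P]
  {k : X → X → ℝ} {σ : ℝ} {f : Ω → X → ℝ} {ε : ℕ → Ω → ℝ}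

omit [IsProbabilityMeasure P] in
/-- The sample values, as elements of `L²`, are a feature map of the covariance kernel. -/
lemma IsGPSample.exists_featureMap (h : IsGPSample P k σ f ε) :
    ∃ φ : X → Lp ℝ 2 P, ∀ z z', k z z' = inner ℝ (φ z) (φ z') := by
  have hm : ∀ z, MemLp (fun ω => f ω z) 2 P := fun z =>
    (h.gaussian.hasGaussianLaw_eval z).memLp_two
  refine ⟨fun z => (hm z).toLp, fun z z' => ?_⟩
  rw [L2.inner_def, ← h.cov, covariance, h.mean, h.mean]
  refine integral_congr_ae ?_
  filter_upwards [(hm z).coeFn_toLp, (hm z').coeFn_toLp] with ω h1 h2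
  rw [h1, h2]
  simp [mul_comm]

omit [IsProbabilityMeasure P] in
lemma IsGPSample.measure_noise_gt_le (h : IsGPSample P k σ f ε) (hσ : 0 < σ) {δ : ℝ} (hδ : 0 < δ)
    (hδ1 : δ ≤ 1) {T : ℕ} (hT : 1 ≤ T) :
    P (⋃ t ∈ Finset.Icc 1 T, {ω | gaussNoiseBound σ T δ < |ε t ω|}) ≤ ENNReal.ofReal δ := by
  have hT' : (1 : ℝ) ≤ T := by exact_mod_cast hT
  have h0 : 1 ≤ T / δ := by
    rw [le_div_iff₀ hδ]
    linarith
  have h1 : ∀ t, P {ω | gaussNoiseBound σ T δ < |ε t ω|} ≤ ENNReal.ofReal (δ / T) := fun t => by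
    have h2 := gaussianReal_abs_gt_le (Real.sqrt_nonneg (2 * Real.log (T / δ)))
      (Real.toNNReal (σ ^ 2))
    rw [Real.sq_sqrt (mul_nonneg zero_le_two (Real.log_nonneg h0)), mul_div_cancel_left₀ _
      two_ne_zero, Real.exp_neg, Real.exp_log (by positivity), inv_div,
      Real.coe_toNNReal _ (sq_nonneg σ), Real.sqrt_sq hσ.le, ← h.law_noise t,
      Measure.map_apply (h.measurable_noise t)
        (measurableSet_lt measurable_const (measurable_id'.abs))] at h2
    rwa [mul_comm] at h2
  calc P (⋃ t ∈ Finset.Icc 1 T, {ω | gaussNoiseBound σ T δ < |ε t ω|})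
      ≤ ∑ t ∈ Finset.Icc 1 T, ENNReal.ofReal (δ / T) :=
        (measure_biUnion_finset_le _ _).trans (Finset.sum_le_sum fun t _ => h1 t)
    _ = ENNReal.ofReal δ := by
        rw [← ENNReal.ofReal_sum_of_nonneg fun _ _ => by positivity]
        simp only [Finset.sum_const, Nat.card_Icc, Nat.add_sub_cancel, nsmul_eq_mul]
        rw [mul_div_cancel₀ _ (by positivity)]

variable [TopologicalSpace X]

omit [IsProbabilityMeasure P] in
/-- A modification with continuous paths. -/
lemma IsGPSample.exists_continuous_modification (h : IsGPSample P k σ f ε)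
    (hc : ∀ᵐ ω ∂P, Continuous (f ω)) :
    ∃ g : Ω → {g : X → ℝ // Continuous g}, Measurable g ∧ ∀ᵐ ω ∂P, (g ω : X → ℝ) = f ω := by
  classical
  obtain ⟨N, hN, hNm, hN0⟩ := exists_measurable_superset_of_null (ae_iff.1 hc)
  have hcont : ∀ ω, ω ∉ N → Continuous (f ω) := fun ω hω => by
    by_contra hcon
    exact hω (hN hcon)
  let u : Ω → X → ℝ := fun ω => if ω ∈ N then 0 else f ω
  have hu : ∀ ω, Continuous (u ω) := fun ω => by
    by_cases hω : ω ∈ N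
    · simp only [u, if_pos hω]
      exact continuous_const
    · simp only [u, if_neg hω]
      exact hcont ω hω
  refine ⟨fun ω => ⟨u ω, hu ω⟩, Measurable.subtype_mk (measurable_pi_lambda _ fun z => ?_), ?_⟩
  · have h1 : (fun ω => u ω z) = fun ω => if ω ∈ N then 0 else f ω z := funext fun ω => by
      by_cases hω : ω ∈ N <;> simp [u, hω]
    rw [h1]
    exact Measurable.ite hNm measurable_const (h.measurable_f z)
  · filter_upwards [measure_eq_zero_iff_ae_notMem.1 hN0] with ω hω
    exact if_neg hω

variable [MeasurableSpace X] [BorelSpace X] [TopologicalSpace.MetrizableSpace X]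
  [SecondCountableTopology X]

/-- Posterior tail bound for the observations of a sample. -/
lemma IsGPSample.measure_gt_le (h : IsGPSample P k σ f ε) (hc : ∀ᵐ ω ∂P, Continuous (f ω))
    (hσ : 0 < σ) (hkm : Measurable fun p : X × X => k p.1 p.2)
    {d : (ℕ → ℝ) → ℕ → X} (hd : IsNonanticipative d) (hdm : ∀ t, Measurable fun y => d y t)
    {Z : (ℕ → ℝ) → X} (hZ : Measurable Z) (n : ℕ) {r : ℝ} (hr : 0 ≤ r) :
    P {ω | r * gpSd k σ (d (response d (f ω) (fun t => ε t ω) n)) (Finset.Icc 1 n)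
        (Z (response d (f ω) (fun t => ε t ω) n)) <
        |f ω (Z (response d (f ω) (fun t => ε t ω) n)) -
          gpMean k σ (d (response d (f ω) (fun t => ε t ω) n))
            (response d (f ω) (fun t => ε t ω) n) (Finset.Icc 1 n)
            (Z (response d (f ω) (fun t => ε t ω) n))|} ≤
      ENNReal.ofReal (Real.exp (-(r ^ 2 / 2))) := by
  obtain ⟨φ, hk⟩ := h.exists_featureMap
  -- The tail bound needs joint measurability in the sample and the point, which `f` on `Ω` may
  -- lack. The problem is moved to the space of continuous paths, where evaluation is jointly
  -- measurable.
  obtain ⟨g, hg, hgf⟩ := h.exists_continuous_modification hc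
  have hgz : ∀ z, Measurable fun ω => (g ω : X → ℝ) z := fun z =>
    (measurable_pi_apply z).comp (measurable_subtype_coe.comp hg)
  have hez : ∀ z, Measurable fun c : {g : X → ℝ // Continuous g} => (c : X → ℝ) z := fun z =>
    (measurable_pi_apply z).comp measurable_subtype_coe
  have hgfz : ∀ z, (fun ω => (g ω : X → ℝ) z) =ᵐ[P] fun ω => f ω z := fun z => by
    filter_upwards [hgf] with ω hω
    rw [hω]
  have hεm : Measurable fun ω t => ε t ω := measurable_pi_lambda _ h.measurable_noise
  have : IsProbabilityMeasure (P.map g) := Measure.isProbabilityMeasure_map hg.aemeasurable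
  have hlaw : P.map (fun ω => (g ω, fun t => ε t ω)) =
      (P.map g).prod (noiseLaw (Real.toNNReal (σ ^ 2))) := by
    have h1 : IndepFun (fun ω => (g ω : X → ℝ)) (fun ω t => ε t ω) P :=
      h.indep.congr (hgf.mono fun ω hω => hω.symm) Filter.EventuallyEq.rfl
    have h2 : IndepFun g (fun ω t => ε t ω) P := by
      rw [IndepFun_iff_Indep] at h1 ⊢
      have : MeasurableSpace.comap g inferInstance =
          MeasurableSpace.comap (fun ω => (g ω : X → ℝ)) inferInstance :=
        MeasurableSpace.comap_comp
      rwa [this]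
    rw [(indepFun_iff_map_prod_eq_prod_map_map hg.aemeasurable hεm.aemeasurable).1 h2,
      h.iIndep_noise.map_fun_eq_infinitePi_map h.measurable_noise]
    simp only [h.law_noise]
  have hgp : IsGaussianProcess (fun z (c : {g : X → ℝ // Continuous g}) => (c : X → ℝ) z)
      (P.map g) := by
    refine ⟨fun I => ⟨?_⟩⟩
    have h1 := ((h.gaussian.congr fun z => (hgfz z).symm).hasGaussianLaw I).isGaussian_map
    have h2 : Measurable fun c : {g : X → ℝ // Continuous g} => I.restrict (c : X → ℝ) :=
      measurable_pi_lambda _ fun i => hez i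
    exact (Measure.map_map h2 hg).symm ▸ h1
  have hmean : ∀ z, ∫ c : {g : X → ℝ // Continuous g}, (c : X → ℝ) z ∂P.map g = 0 := fun z => by
    rw [integral_map hg.aemeasurable (hez z).aestronglyMeasurable, integral_congr_ae (hgfz z),
      h.mean]
  have hcov : ∀ z z', cov[fun c : {g : X → ℝ // Continuous g} => (c : X → ℝ) z,
      fun c => (c : X → ℝ) z'; P.map g] = k z z' := fun z z' => by
    rw [covariance_map_fun (hez z).aestronglyMeasurable (hez z').aestronglyMeasurable
      hg.aemeasurable, ← h.cov]
    rw [covariance, covariance, integral_congr_ae (hgfz z), integral_congr_ae (hgfz z')]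
    refine integral_congr_ae ?_
    filter_upwards [hgf] with ω hω
    rw [hω]
  have hjoint : Measurable fun p : {g : X → ℝ // Continuous g} × X => (p.1 : X → ℝ) p.2 :=
    (measurable_uncurry_of_continuous_of_measurable
      (u := fun (z : X) (c : {g : X → ℝ // Continuous g}) => (c : X → ℝ) z)
      (fun c => c.2) hez).comp measurable_swap
  have hmain := measure_response_gt_le (v := Real.toNNReal (σ ^ 2)) hgp hjoint hmean hcov hk hσ
    (Real.coe_toNNReal _ (sq_nonneg σ)) hkm hd hdm hZ n hr
  let B : Set ((X → ℝ) × (ℕ → ℝ)) := {p | r * gpSd k σ (d (response d p.1 p.2 n))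
    (Finset.Icc 1 n) (Z (response d p.1 p.2 n)) < |p.1 (Z (response d p.1 p.2 n)) -
      gpMean k σ (d (response d p.1 p.2 n)) (response d p.1 p.2 n) (Finset.Icc 1 n)
        (Z (response d p.1 p.2 n))|}
  rw [← hlaw] at hmain
  refine le_trans ?_ hmain
  -- This inequality for image measures needs no measurability of the event.
  refine le_trans ?_ (Measure.le_map_apply (hg.prodMk hεm).aemeasurable _)
  refine measure_mono_ae ?_
  filter_upwards [hgf] with ω hω hω'
  have hB : ((g ω : X → ℝ), fun t => ε t ω) ∈ B := by
    rw [hω]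
    exact hω'
  exact hB

/-- The same at a later stage of the run. -/
lemma IsGPSample.measure_gt_le_of_le (h : IsGPSample P k σ f ε)
    (hc : ∀ᵐ ω ∂P, Continuous (f ω))
    (hσ : 0 < σ) (hkm : Measurable fun p : X × X => k p.1 p.2)
    {d : (ℕ → ℝ) → ℕ → X} (hd : IsNonanticipative d) (hdm : ∀ t, Measurable fun y => d y t)
    {n T : ℕ} (hnT : n ≤ T) {Z : (ℕ → ℝ) → X} (hZ : Measurable Z)
    (hZn : ∀ y y', (∀ i ∈ Finset.Icc 1 n, y i = y' i) → Z y = Z y') {r : ℝ} (hr : 0 ≤ r) :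
    P {ω | r * gpSd k σ (d (response d (f ω) (fun t => ε t ω) T)) (Finset.Icc 1 n)
        (Z (response d (f ω) (fun t => ε t ω) T)) <
        |f ω (Z (response d (f ω) (fun t => ε t ω) T)) -
          gpMean k σ (d (response d (f ω) (fun t => ε t ω) T))
            (response d (f ω) (fun t => ε t ω) T) (Finset.Icc 1 n)
            (Z (response d (f ω) (fun t => ε t ω) T))|} ≤
      ENNReal.ofReal (Real.exp (-(r ^ 2 / 2))) := by
  refine le_of_eq_of_le (congrArg P (Set.ext fun ω => ?_))
    (h.measure_gt_le hc hσ hkm hd hdm hZ n hr)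
  have h1 : ∀ i ∈ Finset.Icc 1 n, response d (f ω) (fun t => ε t ω) T i =
      response d (f ω) (fun t => ε t ω) n i := fun i hi =>
    response_of_le d _ _ (Finset.mem_Icc.1 hi).2 hnT
  have h2 := hd.congr h1
  rw [Set.mem_ofPred_eq, Set.mem_ofPred_eq, hZn _ _ h1,
    gpSd_congr fun i hi => h2 i (Finset.Icc_subset_Icc_right n.le_succ hi),
    gpMean_congr (fun i hi => h2 i (Finset.Icc_subset_Icc_right n.le_succ hi)) h1]

end Sample

/-! ### Finite domains -/

section Finite

open scoped NNReal ENNReal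

lemma sum_inv_sq_le (T : ℕ) : ∑ t ∈ Finset.Icc 1 T, 1 / (t : ℝ) ^ 2 ≤ Real.pi ^ 2 / 6 :=
  sum_le_hasSum _ (fun _ _ => by positivity) hasSum_zeta_two

lemma betaFinite_arg_ge {m : ℕ} (hm : 1 ≤ m) {δ : ℝ} (hδ : 0 < δ) (hδ1 : δ ≤ 1) {t : ℕ}
    (ht : 1 ≤ t) : 1 ≤ m * t ^ 2 * Real.pi ^ 2 / (6 * δ) := by
  have hm' : (1 : ℝ) ≤ m := by exact_mod_cast hm
  have ht' : (1 : ℝ) ≤ (t : ℝ) ^ 2 := one_le_pow₀ (by exact_mod_cast ht)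
  have h3 : (6 : ℝ) ≤ Real.pi ^ 2 := by nlinarith [Real.pi_gt_three]
  rw [le_div_iff₀ (by positivity), one_mul]
  calc 6 * δ ≤ 6 * 1 := by gcongr
    _ ≤ 1 * 1 * Real.pi ^ 2 := by linarith
    _ ≤ m * t ^ 2 * Real.pi ^ 2 := by gcongr

lemma betaFinite_mono {m : ℕ} (hm : 1 ≤ m) {δ : ℝ} (hδ : 0 < δ) :
    MonotoneOn (betaFinite m δ) (Set.Ici 1) := by
  intro s hs t _ hst
  have hm' : (1 : ℝ) ≤ m := by exact_mod_cast hm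
  have hs1 : (1 : ℝ) ≤ s := by exact_mod_cast hs
  have hst' : (s : ℝ) ≤ t := by exact_mod_cast hst
  unfold betaFinite
  have : 0 < Real.pi := Real.pi_pos
  gcongr

variable {X : Type*} [Fintype X] [Nonempty X] [TopologicalSpace X] [DiscreteTopology X]
  [MeasurableSpace X] [BorelSpace X] {k : X → X → ℝ} {κ σ δ : ℝ}
  {Ω : Type*} [MeasurableSpace Ω] {P : Measure Ω} [IsProbabilityMeasure P]
  {f : Ω → X → ℝ} {ε : ℕ → Ω → ℝ}

lemma zeroCost_finite (hσ : 0 < σ) (hκ : ∀ z z', |k z z'| ≤ κ) (hδ : 0 < δ) (hδ1 : δ < 1)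
    (h : IsGPSample P k σ f ε) {T : ℕ} (hT : 1 ≤ T) :
    ZeroCost P k κ σ δ (gaussNoiseBound σ T (δ / 2)) (betaFinite (Fintype.card X) (δ / 2)) T f ε
      √(8 * (σ ^ 2 + κ)) := by
  obtain ⟨φ, hk⟩ := h.exists_featureMap
  have hkc : Continuous fun p : X × X => k p.1 p.2 := continuous_of_discreteTopology
  have hkm : Measurable fun p : X × X => k p.1 p.2 := hkc.measurable
  have hfc : ∀ᵐ ω ∂P, Continuous (f ω) := ae_of_all _ fun ω => continuous_of_discreteTopology
  have hm : 1 ≤ Fintype.card X := Fintype.card_pos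
  have hβ := betaFinite_mono hm (half_pos hδ)
  refine zeroCost_of_ucb hk hσ hκ hβ fun sel hsel => ?_
  set β := betaFinite (Fintype.card X) (δ / 2) with hβdef
  set d := ucbQuery sel k σ β
  have hd : IsNonanticipative d := isNonanticipative_ucbQuery
  have hdm : ∀ t, Measurable fun y => d y t := measurable_ucbQuery hkc hkm hsel
  let A : ℕ → X → Set Ω := fun t z => {ω |
    √(β t) * gpSd k σ (d (response d (f ω) (fun t => ε t ω) T)) (Finset.Icc 1 (t - 1)) z <
      |f ω z - gpMean k σ (d (response d (f ω) (fun t => ε t ω) T))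
        (response d (f ω) (fun t => ε t ω) T) (Finset.Icc 1 (t - 1)) z|}
  have hA : ∀ t ∈ Finset.Icc 1 T, ∀ z, P (A t z) ≤
      ENNReal.ofReal (6 * (δ / 2) / Real.pi ^ 2 / Fintype.card X * (1 / (t : ℝ) ^ 2)) := by
    intro t ht z
    have ht' := Finset.mem_Icc.1 ht
    have h1 := h.measure_gt_le_of_le hfc hσ hkm hd hdm (n := t - 1) (T := T) (by omega)
      (Z := fun _ => z) measurable_const (fun _ _ _ => rfl) (Real.sqrt_nonneg (β t))
    -- `exp(-β_t/2)` is the union bound weight of one point in one round; the `π²/6` in `β_t`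
    -- normalizes the sum of `1/t²`.
    refine h1.trans (ENNReal.ofReal_le_ofReal (le_of_eq ?_))
    have h2 := betaFinite_arg_ge hm (half_pos hδ) (by linarith) ht'.1
    have ht0 : (0 : ℝ) < t := by exact_mod_cast ht'.1
    have hm0 : (0 : ℝ) < Fintype.card X := by exact_mod_cast hm
    have h3 : β t = 2 * Real.log (Fintype.card X * t ^ 2 * Real.pi ^ 2 / (6 * (δ / 2))) := rfl
    rw [h3, Real.sq_sqrt (mul_nonneg zero_le_two (Real.log_nonneg h2)),
      mul_div_cancel_left₀ _ two_ne_zero, Real.exp_neg, Real.exp_log (by positivity)]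
    field_simp
  refine ⟨(⋃ t ∈ Finset.Icc 1 T, {ω | gaussNoiseBound σ T (δ / 2) < |ε t ω|}) ∪
    ⋃ t ∈ Finset.Icc 1 T, ⋃ z ∈ Finset.univ, A t z, ?_, ?_⟩
  · refine (measure_union_le _ _).trans ?_
    have h1 : P (⋃ t ∈ Finset.Icc 1 T, ⋃ z ∈ Finset.univ, A t z) ≤ ENNReal.ofReal (δ / 2) := by
      calc P (⋃ t ∈ Finset.Icc 1 T, ⋃ z ∈ Finset.univ, A t z)
          ≤ ∑ t ∈ Finset.Icc 1 T, ∑ z : X, ENNReal.ofReal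
            (6 * (δ / 2) / Real.pi ^ 2 / Fintype.card X * (1 / (t : ℝ) ^ 2)) :=
            (measure_biUnion_finset_le _ _).trans (Finset.sum_le_sum fun t ht =>
              (measure_biUnion_finset_le _ _).trans (Finset.sum_le_sum fun z _ => hA t ht z))
        _ = ENNReal.ofReal (∑ t ∈ Finset.Icc 1 T, ∑ z : X,
            6 * (δ / 2) / Real.pi ^ 2 / Fintype.card X * (1 / (t : ℝ) ^ 2)) := by
            rw [ENNReal.ofReal_sum_of_nonneg fun _ _ =>
              Finset.sum_nonneg fun _ _ => by positivity]
            exact Finset.sum_congr rfl fun t _ =>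
              (ENNReal.ofReal_sum_of_nonneg fun _ _ => by positivity).symm
        _ ≤ ENNReal.ofReal (δ / 2) := by
            refine ENNReal.ofReal_le_ofReal ?_
            have hm0 : (0 : ℝ) < Fintype.card X := by exact_mod_cast hm
            have hpi := Real.pi_pos
            simp only [Finset.sum_const, Finset.card_univ, nsmul_eq_mul]
            rw [← Finset.mul_sum, ← Finset.mul_sum]
            calc (Fintype.card X : ℝ) * (6 * (δ / 2) / Real.pi ^ 2 / Fintype.card X *
                  ∑ t ∈ Finset.Icc 1 T, 1 / (t : ℝ) ^ 2)
                ≤ (Fintype.card X : ℝ) * (6 * (δ / 2) / Real.pi ^ 2 / Fintype.card X *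
                  (Real.pi ^ 2 / 6)) := by
                  gcongr
                  exact sum_inv_sq_le T
              _ = δ / 2 := by field_simp
    -- Half of `δ` pays for the noise bound, half for the confidence bounds.
    calc _ ≤ ENNReal.ofReal (δ / 2) + ENNReal.ofReal (δ / 2) :=
          add_le_add (h.measure_noise_gt_le hσ (half_pos hδ) (by linarith) hT) h1
      _ = ENNReal.ofReal δ := by
          rw [← ENNReal.ofReal_add (by positivity) (by positivity), add_halves]
  · refine ae_of_all _ fun ω hω => ⟨fun t ht => ?_, regret_le_of_uniform hk hσ hκ hβ hkc hsel
      fun t ht z => ?_⟩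
    · by_contra hcon
      exact hω (Or.inl (Set.mem_biUnion (Finset.mem_coe.2 ht) (not_le.1 hcon)))
    · by_contra hcon
      exact hω (Or.inr (Set.mem_biUnion (Finset.mem_coe.2 ht)
        (Set.mem_biUnion (Finset.mem_coe.2 (Finset.mem_univ z)) (not_le.1 hcon))))

end Finite

/-! ### Grids and the mean value inequality -/

section Grid

variable {d : ℕ}

lemma exists_cell {r : ℝ} (hr : 0 < r) {M : ℕ} (hM : 1 ≤ M) {u : ℝ} (hu0 : 0 ≤ u) (hu : u ≤ r) :
    ∃ i : Fin M, i * (r / M) ≤ u ∧ u ≤ (i + 1) * (r / M) := by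
  have hM' : (0 : ℝ) < M := by exact_mod_cast hM
  have hw : 0 < r / M := by positivity
  have hMw : M * (r / M) = r := mul_div_cancel₀ _ hM'.ne'
  by_cases h : ⌊u / (r / M)⌋₊ < M
  · refine ⟨⟨_, h⟩, ?_, ?_⟩
    · rw [← le_div_iff₀ hw]
      exact Nat.floor_le (by positivity)
    · rw [← div_le_iff₀ hw]
      exact (Nat.lt_floor_add_one _).le
  -- Only the right end `u = r` falls outside the half-open cells; it goes to the last one.
  · refine ⟨⟨M - 1, by omega⟩, ?_, ?_⟩
    · have h1 : (M : ℝ) ≤ u / (r / M) := (Nat.le_floor_iff (by positivity)).1 (not_lt.1 h)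
      rw [le_div_iff₀ hw] at h1
      refine le_trans ?_ h1
      gcongr
      exact Nat.sub_le _ _
    · push_cast [hM]
      rw [sub_add_cancel, hMw]
      exact hu

/-- A subset of the cube `[0, r]ᵈ` contains representatives of the cells of a grid with `Mᵈ`
cells. -/
lemma exists_cell_representatives {D : Set (EuclideanSpace ℝ (Fin d))} (hne : D.Nonempty) {r : ℝ}
    (hr : 0 < r) (hD : ∀ z ∈ D, ∀ j, 0 ≤ z j ∧ z j ≤ r) {M : ℕ} (hM : 1 ≤ M) :
    ∃ (p : (Fin d → Fin M) → D) (q : D → Fin d → Fin M), ∀ (z : D) (j : Fin d),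
      |(z : EuclideanSpace ℝ (Fin d)) j - (p (q z) : EuclideanSpace ℝ (Fin d)) j| ≤ r / M := by
  have : Nonempty D := hne.to_subtype
  choose q hq1 hq2 using fun (z : D) (j : Fin d) => exists_cell hr hM (hD z z.2 j).1 (hD z z.2 j).2
  -- `q` assigns a cell and `invFun` picks a point of `D` in it. A cell missing `D` gets an
  -- arbitrary point, which is never used for approximation.
  refine ⟨Function.invFun q, q, fun z j => ?_⟩
  have h := Function.invFun_eq (f := q) ⟨z, rfl⟩
  have h1 := hq1 z j
  have h2 := hq2 z j
  have h3 := hq1 (Function.invFun q (q z)) j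
  have h4 := hq2 (Function.invFun q (q z)) j
  rw [h] at h3 h4
  rw [abs_le]
  constructor <;> linarith

lemma norm_le_sqrt_mul_of_abs_le {v : EuclideanSpace ℝ (Fin d)} {s : ℝ} (hs : 0 ≤ s)
    (h : ∀ j, |v j| ≤ s) : ‖v‖ ≤ √d * s := by
  refine le_of_sq_le_sq ?_ (by positivity)
  rw [EuclideanSpace.norm_sq_eq, mul_pow, Real.sq_sqrt (Nat.cast_nonneg d)]
  calc ∑ j, ‖v j‖ ^ 2 ≤ ∑ _j : Fin d, s ^ 2 :=
        Finset.sum_le_sum fun j _ => pow_le_pow_left₀ (norm_nonneg _) (h j) 2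
    _ = d * s ^ 2 := by simp

lemma opNorm_le_sqrt_mul_of_abs_le {A : EuclideanSpace ℝ (Fin d) →L[ℝ] ℝ} {l : ℝ} (hl : 0 ≤ l)
    (h : ∀ j, |A (EuclideanSpace.single j 1)| ≤ l) : ‖A‖ ≤ √d * l := by
  refine A.opNorm_le_bound (by positivity) fun v => ?_
  have h1 : v = ∑ j, v j • EuclideanSpace.single j (1 : ℝ) := by
    have := (EuclideanSpace.basisFun (Fin d) ℝ).sum_repr v
    simpa using this.symm
  have h2 : ∑ j, |v j| ≤ √d * ‖v‖ := by
    refine le_of_sq_le_sq ?_ (by positivity)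
    rw [mul_pow, Real.sq_sqrt (Nat.cast_nonneg d), EuclideanSpace.norm_sq_eq]
    simpa using sq_sum_le_card_mul_sum_sq (s := Finset.univ) (f := fun j => |v j|)
  calc ‖A v‖ = |∑ j, v j * A (EuclideanSpace.single j 1)| := by
        conv_lhs => rw [h1]
        simp [map_sum]
    _ ≤ ∑ j, |v j| * l := (Finset.abs_sum_le_sum_abs _ _).trans
        (Finset.sum_le_sum fun j _ => by rw [abs_mul]; gcongr; exact h j)
    _ = l * ∑ j, |v j| := by rw [← Finset.sum_mul, mul_comm]
    _ ≤ l * (√d * ‖v‖) := by gcongr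
    _ = √d * l * ‖v‖ := by ring

/-- Mean value inequality in terms of the partial derivatives. -/
lemma abs_sub_le_of_partial_le {D : Set (EuclideanSpace ℝ (Fin d))} (hD : Convex ℝ D)
    {F : EuclideanSpace ℝ (Fin d) → ℝ} {F' : EuclideanSpace ℝ (Fin d) → _ →L[ℝ] ℝ}
    (hF : ∀ z ∈ D, HasFDerivWithinAt F (F' z) D z) {l : ℝ} (hl : 0 ≤ l)
    (hF' : ∀ z ∈ D, ∀ j, |F' z (EuclideanSpace.single j 1)| ≤ l)
    {z w : EuclideanSpace ℝ (Fin d)} (hz : z ∈ D) (hw : w ∈ D) {s : ℝ} (hs : 0 ≤ s)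
    (h : ∀ j, |z j - w j| ≤ s) : |F z - F w| ≤ d * l * s := by
  have h1 := hD.norm_image_sub_le_of_norm_hasFDerivWithin_le hF
    (fun z hz => opNorm_le_sqrt_mul_of_abs_le hl (hF' z hz)) hw hz
  refine h1.trans ?_
  -- One `√d` comes from the operator norm in terms of partial derivatives, one from the Euclidean
  -- norm in terms of coordinates.
  calc √d * l * ‖z - w‖ ≤ √d * l * (√d * s) := by
        gcongr
        exact norm_le_sqrt_mul_of_abs_le hs h
    _ = (√d * √d) * l * s := by ring
    _ = d * l * s := by rw [Real.mul_self_sqrt (Nat.cast_nonneg d)]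

end Grid

/-! ### The GP-UCB parameter on convex domains -/

section BetaConvex

variable {d : ℕ} {a b r δ : ℝ}

lemma betaConvex_mono (hδ : 0 < δ) (h1 : 1 ≤ d * b * r * √(Real.log (4 * d * a / δ))) :
    MonotoneOn (betaConvex d a b r δ) (Set.Ici 1) := by
  intro s hs t _ hst
  have hs1 : (1 : ℝ) ≤ s := by exact_mod_cast hs
  have hst' : (s : ℝ) ≤ t := by exact_mod_cast hst
  have hpi := Real.pi_pos
  have h2 : ∀ t : ℝ, t ^ 2 * d * b * r * √(Real.log (4 * d * a / δ)) =
    t ^ 2 * (d * b * r * √(Real.log (4 * d * a / δ))) := fun t => by ring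
  unfold betaConvex
  rw [h2, h2]
  have h0 : 0 < d * b * r * √(Real.log (4 * d * a / δ)) := by linarith
  gcongr

lemma one_le_cells (h1 : 1 ≤ d * b * r * √(Real.log (4 * d * a / δ))) {t : ℕ} (ht : 1 ≤ t) :
    1 ≤ t ^ 2 * d * b * r * √(Real.log (4 * d * a / δ)) := by
  have ht' : (1 : ℝ) ≤ (t : ℝ) ^ 2 := one_le_pow₀ (by exact_mod_cast ht)
  calc (1 : ℝ) = 1 * 1 := by ring
    _ ≤ t ^ 2 * (d * b * r * √(Real.log (4 * d * a / δ))) := by gcongr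
    _ = _ := by ring

lemma two_le_betaConvex (hδ : 0 < δ) (hδ1 : δ ≤ 1 / 2)
    (h1 : 1 ≤ d * b * r * √(Real.log (4 * d * a / δ))) {t : ℕ} (ht : 1 ≤ t) :
    2 ≤ betaConvex d a b r δ t := by
  have ht' : (1 : ℝ) ≤ (t : ℝ) ^ 2 := one_le_pow₀ (by exact_mod_cast ht)
  have h2 : 0 ≤ Real.log (t ^ 2 * d * b * r * √(Real.log (4 * d * a / δ))) :=
    Real.log_nonneg (one_le_cells h1 ht)
  have h3 : Real.exp 1 ≤ t ^ 2 * (2 * Real.pi ^ 2) / (3 * δ) := by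
    have h4 : (9 : ℝ) ≤ Real.pi ^ 2 := by nlinarith [Real.pi_gt_three]
    have h5 : (6 : ℝ) ≤ t ^ 2 * (2 * Real.pi ^ 2) / (3 * δ) := by
      rw [le_div_iff₀ (by positivity)]
      nlinarith
    linarith [Real.exp_one_lt_d9]
  have h6 : 1 ≤ Real.log (t ^ 2 * (2 * Real.pi ^ 2) / (3 * δ)) := by
    rw [Real.le_log_iff_exp_le (lt_of_lt_of_le (Real.exp_pos _) h3)]
    exact h3
  have h7 : 0 ≤ 2 * (d : ℝ) * Real.log (t ^ 2 * d * b * r * √(Real.log (4 * d * a / δ))) := by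
    positivity
  rw [betaConvex]
  linarith

lemma exp_neg_betaConvex (hδ : 0 < δ) (h1 : 1 ≤ d * b * r * √(Real.log (4 * d * a / δ))) {t : ℕ}
    (ht : 1 ≤ t) : Real.exp (-(betaConvex d a b r δ t / 2)) =
      3 * δ / (t ^ 2 * (2 * Real.pi ^ 2)) *
        ((t ^ 2 * d * b * r * √(Real.log (4 * d * a / δ))) ^ d)⁻¹ := by
  have ht0 : (0 : ℝ) < t := by exact_mod_cast ht
  have h2 : 0 < t ^ 2 * d * b * r * √(Real.log (4 * d * a / δ)) := by
    linarith [one_le_cells h1 ht]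
  have hpi := Real.pi_pos
  have h3 : betaConvex d a b r δ t / 2 = Real.log (t ^ 2 * (2 * Real.pi ^ 2) / (3 * δ)) +
      Real.log ((t ^ 2 * d * b * r * √(Real.log (4 * d * a / δ))) ^ d) := by
    rw [betaConvex, Real.log_pow]
    ring
  rw [h3, neg_add, Real.exp_add, Real.exp_neg, Real.exp_neg, Real.exp_log (by positivity),
    Real.exp_log (by positivity), inv_div]

end BetaConvex

/-! ### Convex domains -/

section Convex

open scoped ENNReal

/-- A sample with vanishing variances and continuous paths vanishes. -/
lemma IsGPSample.ae_eq_zero {X Ω : Type*} [MeasurableSpace Ω] {P : Measure Ω}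
    [IsProbabilityMeasure P] {k : X → X → ℝ} {σ : ℝ} {f : Ω → X → ℝ} {ε : ℕ → Ω → ℝ}
    [TopologicalSpace X] [TopologicalSpace.SeparableSpace X] (h : IsGPSample P k σ f ε)
    (hc : ∀ᵐ ω ∂P, Continuous (f ω)) (hk : ∀ z, k z z ≤ 0) : ∀ᵐ ω ∂P, ∀ z, f ω z = 0 := by
  obtain ⟨s, hs, hsd⟩ := TopologicalSpace.exists_countable_dense X
  have h1 : ∀ z, ∀ᵐ ω ∂P, f ω z = 0 := fun z => by
    have hm := (h.gaussian.hasGaussianLaw_eval z).memLp_two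
    have h2 : Var[fun ω => f ω z; P] = 0 := by
      refine le_antisymm ?_ (variance_nonneg _ _)
      rw [← covariance_self hm.aemeasurable, h.cov]
      exact hk z
    have h3 := ae_eq_integral_of_variance_eq_zero hm h2
    rwa [h.mean] at h3
  filter_upwards [hc, (ae_ball_iff hs).2 fun z _ => h1 z] with ω hω h2
  exact congrFun (hω.ext_on hsd continuous_const h2)

variable {d : ℕ} {r : ℝ} {D : Set (EuclideanSpace ℝ (Fin d))} {k : D → D → ℝ}
  {κ σ a b δ : ℝ} {Ω : Type*} [MeasurableSpace Ω] {P : Measure Ω} [IsProbabilityMeasure P]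
  {f : Ω → D → ℝ} {ε : ℕ → Ω → ℝ}

omit [IsProbabilityMeasure P] in
/-- With high probability the sample is Lipschitz in each coordinate, in the following sense. -/
lemma HasDerivTails.exists_modulus (hder : HasDerivTails P D f a b) (hD : Convex ℝ D)
    (hδ : 0 < δ) (ha : 0 < a) (hb : 0 < b)
    (h1 : 1 ≤ d * b * r * √(Real.log (4 * d * a / δ))) :
    ∃ E : Set Ω, P E ≤ ENNReal.ofReal (δ / 4) ∧ ∀ᵐ ω ∂P, ω ∉ E → ∀ (z w : D) (s : ℝ), 0 ≤ s →
      (∀ j, |(z : EuclideanSpace ℝ (Fin d)) j - (w : EuclideanSpace ℝ (Fin d)) j| ≤ s) →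
      |f ω z - f ω w| ≤ d * (b * √(Real.log (4 * d * a / δ))) * s := by
  obtain ⟨F, F', hF, hF', htail⟩ := hder
  have hL : 0 < √(Real.log (4 * d * a / δ)) := by
    by_contra hcon
    have h0 : √(Real.log (4 * d * a / δ)) = 0 := le_antisymm (not_lt.1 hcon) (Real.sqrt_nonneg _)
    rw [h0] at h1
    norm_num at h1
  have hd : (0 : ℝ) < d := by
    rcases Nat.eq_zero_or_pos d with rfl | h
    · norm_num at h1
    · exact_mod_cast h
  refine ⟨⋃ j ∈ Finset.univ, {ω | ∃ z ∈ D, b * √(Real.log (4 * d * a / δ)) <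
    |F' ω z (EuclideanSpace.single j 1)|}, ?_, ?_⟩
  · have h2 : a * Real.exp (-(b * √(Real.log (4 * d * a / δ)) / b) ^ 2) = δ / (4 * d) := by
      rw [mul_div_cancel_left₀ _ hb.ne', Real.sq_sqrt (Real.sqrt_pos.1 hL).le, Real.exp_neg,
        Real.exp_log (by positivity)]
      field_simp
    calc _ ≤ ∑ _j : Fin d, ENNReal.ofReal (δ / (4 * d)) :=
          (measure_biUnion_finset_le _ _).trans (Finset.sum_le_sum fun j _ => by
            rw [← h2]
            exact htail j _ (by positivity))
      _ = ENNReal.ofReal (δ / 4) := by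
          rw [← ENNReal.ofReal_sum_of_nonneg fun _ _ => by positivity]
          simp only [Finset.sum_const, Finset.card_univ, Fintype.card_fin, nsmul_eq_mul]
          congr 1
          field_simp
  · filter_upwards [hF'] with ω hω hE z w s hs hzw
    rw [← hF, ← hF]
    refine abs_sub_le_of_partial_le hD hω (by positivity) (fun z hz j => ?_) z.2 w.2 hs hzw
    by_contra hcon
    exact hE (Set.mem_biUnion (Finset.mem_coe.2 (Finset.mem_univ j)) ⟨z, hz, not_le.1 hcon⟩)

omit [IsProbabilityMeasure P] in
lemma HasDerivTails.ae_continuous (hder : HasDerivTails P D f a b) :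
    ∀ᵐ ω ∂P, Continuous (f ω) := by
  obtain ⟨F, F', hF, hF', -⟩ := hder
  filter_upwards [hF'] with ω hω
  have h1 : ContinuousOn (F ω) D := fun z hz => (hω z hz).continuousWithinAt
  have h2 : f ω = D.domRestrict (F ω) := funext fun z => (hF ω z).symm
  rw [h2]
  exact h1.domRestrict

/-- Absorbs an additive constant into the regret rate: the factor `T * b` is at least `1`, and the
gain is bounded below by that of a single evaluation at `z`. -/
lemma le_mul_sqrt_of_pos_variance {X H : Type*} [Nonempty X] [NormedAddCommGroup H]
    [InnerProductSpace ℝ H] {k : X → X → ℝ} {φ : X → H}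
    (hk : ∀ z z', k z z' = inner ℝ (φ z) (φ z'))
    (hσ : 0 < σ) (hκ : ∀ z z', |k z z'| ≤ κ) {C A : ℝ} (hC : 0 ≤ C) {z : X} (hz : 0 < k z z)
    (hCz : A ≤ C * √(1 / 2 * Real.log (1 + k z z / σ ^ 2))) {T : ℕ} (hT : 1 ≤ T) {b : ℝ}
    (hb : 1 ≤ b) : A ≤ C * √(T * b * maxInfoGain k σ T) := by
  have hT' : (1 : ℝ) ≤ T := by exact_mod_cast hT
  refine hCz.trans (mul_le_mul_of_nonneg_left (Real.sqrt_le_sqrt ?_) hC)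
  have h1 := log_le_maxInfoGain hk hσ hκ T z
  have h2 : Real.log (1 + k z z / σ ^ 2) ≤ Real.log (1 + T * k z z / σ ^ 2) := by
    refine Real.log_le_log (by positivity) ?_
    gcongr
    exact le_mul_of_one_le_left hz.le hT'
  have h3 := maxInfoGain_nonneg hk hσ hκ T
  have h4 : (1 : ℝ) ≤ T * b := one_le_mul_of_one_le_of_one_le hT' hb
  nlinarith

/-- In `hCk` the number `4` is the total discretization error. It can be absorbed once some prior
variance is positive; if none is, the sample vanishes and so does the regret. This is why the
constant depends on the kernel here. -/
lemma zeroCost_convex (hr : 0 < r) (hne : D.Nonempty) (hDc : IsCompact D) (hD : Convex ℝ D)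
    (hDr : ∀ z ∈ D, ∀ j, 0 ≤ z j ∧ z j ≤ r) (hkc : Continuous fun p : D × D => k p.1 p.2)
    (hκ : ∀ z z', |k z z'| ≤ κ) (hσ : 0 < σ) (ha : 0 < a) (hb : 0 < b) (hδ : 0 < δ) (hδ1 : δ < 1)
    (h1 : 1 ≤ d * b * r * √(Real.log (4 * d * a / (δ / 2))))
    (h : IsGPSample P k σ f ε) (hder : HasDerivTails P D f a b) {T : ℕ} (hT : 1 ≤ T)
    {C : ℝ} (hC : 0 ≤ C) (hCk : (∀ z, k z z ≤ 0) ∨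
      ∃ z, 0 < k z z ∧ 4 ≤ C * √(1 / 2 * Real.log (1 + k z z / σ ^ 2))) :
    ZeroCost P k κ σ δ (gaussNoiseBound σ T (δ / 2)) (betaConvex d a b r (δ / 2)) T f ε
      (√(8 * (σ ^ 2 + κ)) + C) := by
  have : Nonempty D := hne.to_subtype
  have : CompactSpace D := isCompact_iff_compactSpace.1 hDc
  obtain ⟨φ, hk⟩ := h.exists_featureMap
  have hkm : Measurable fun p : D × D => k p.1 p.2 := hkc.measurable
  have hfc := hder.ae_continuous
  have hδ2 := half_pos hδ
  have hβ := betaConvex_mono (d := d) (a := a) (b := b) (r := r) hδ2 h1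
  refine zeroCost_of_ucb hk hσ hκ hβ fun sel hsel => ?_
  set β := betaConvex d a b r (δ / 2) with hβdef
  set q := ucbQuery sel k σ β
  have hq : IsNonanticipative q := isNonanticipative_ucbQuery
  have hqm : ∀ t, Measurable fun y => q y t := measurable_ucbQuery hkc hkm hsel
  set Λ := √(Real.log (4 * d * a / (δ / 2))) with hΛ
  -- The real number of cells per axis in round `t`, chosen so that the Lipschitz error over a cell
  -- is about `1/t²`; `h1` makes its integer part positive.
  set τ : ℕ → ℝ := fun t => t ^ 2 * d * b * r * Λ with hτ
  have hτ1 : ∀ t, 1 ≤ t → 1 ≤ τ t := fun t ht => one_le_cells h1 ht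
  have hM : ∀ t, 1 ≤ t → 1 ≤ ⌊τ t⌋₊ := fun t ht => Nat.floor_pos.2 (hτ1 t ht)
  have hrep : ∀ t, ∃ p : (Fin d → Fin ⌊τ t⌋₊) → D, 1 ≤ t → ∃ c : D → Fin d → Fin ⌊τ t⌋₊,
      ∀ (z : D) (j : Fin d), |(z : EuclideanSpace ℝ (Fin d)) j -
        (p (c z) : EuclideanSpace ℝ (Fin d)) j| ≤ r / ⌊τ t⌋₊ := fun t => by
    by_cases ht : 1 ≤ t
    · obtain ⟨p, c, hpc⟩ := exists_cell_representatives hne hr hDr (hM t ht)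
      exact ⟨p, fun _ => ⟨c, hpc⟩⟩
    · exact ⟨fun _ => ⟨hne.some, hne.some_mem⟩, fun h => absurd h ht⟩
  choose p hp using hrep
  let Y : Ω → ℕ → ℝ := fun ω => response q (f ω) (fun t => ε t ω) T
  let A : ℕ → ((ℕ → ℝ) → D) → Set Ω := fun t Z => {ω |
    √(β t) * gpSd k σ (q (Y ω)) (Finset.Icc 1 (t - 1)) (Z (Y ω)) <
      |f ω (Z (Y ω)) - gpMean k σ (q (Y ω)) (Y ω) (Finset.Icc 1 (t - 1)) (Z (Y ω))|}
  have hA : ∀ t ∈ Finset.Icc 1 T, ∀ Z : (ℕ → ℝ) → D, Measurable Z →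
      (∀ y y', (∀ i ∈ Finset.Icc 1 (t - 1), y i = y' i) → Z y = Z y') → P (A t Z) ≤
      ENNReal.ofReal (Real.exp (-(β t / 2))) := by
    intro t ht Z hZ hZn
    have ht' := Finset.mem_Icc.1 ht
    have h2 := h.measure_gt_le_of_le hfc hσ hkm hq hqm (n := t - 1) (T := T) (by omega) hZ hZn
      (Real.sqrt_nonneg (β t))
    rw [Real.sq_sqrt (zero_le_two.trans (two_le_betaConvex hδ2 (by linarith) h1 ht'.1))] at h2
    exact h2
  obtain ⟨E, hE, hmod⟩ := hder.exists_modulus hD hδ2 ha hb h1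
  -- The query generally lies off the grid, so its confidence bound is a separate event, for a point
  -- determined by the past data.
  let G : ℕ → Set Ω := fun t =>
    A t (fun y => q y t) ∪ ⋃ c ∈ Finset.univ, A t fun _ => p t c
  have hG : ∀ t ∈ Finset.Icc 1 T, P (G t) ≤
      ENNReal.ofReal (3 * (δ / 2) / Real.pi ^ 2 * (1 / (t : ℝ) ^ 2)) := by
    intro t ht
    have ht' := Finset.mem_Icc.1 ht
    have ht0 : (0 : ℝ) < t := by exact_mod_cast ht'.1
    have hpi := Real.pi_pos
    have h2 : P (A t fun y => q y t) ≤ ENNReal.ofReal (Real.exp (-(β t / 2))) := by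
      refine hA t ht _ (hqm t) fun y y' hy => ?_
      obtain ⟨n, rfl⟩ : ∃ n, t = n + 1 := ⟨t - 1, by omega⟩
      exact hq y y' n hy
    have h3 : P (⋃ c ∈ Finset.univ, A t fun _ => p t c) ≤
        ∑ _c : Fin d → Fin ⌊τ t⌋₊, ENNReal.ofReal (Real.exp (-(β t / 2))) :=
      (measure_biUnion_finset_le _ _).trans (Finset.sum_le_sum fun c _ =>
        hA t ht _ measurable_const fun _ _ _ => rfl)
    rw [← ENNReal.ofReal_sum_of_nonneg fun _ _ => (Real.exp_pos _).le] at h3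
    refine (measure_union_le _ _).trans ((add_le_add h2 h3).trans ?_)
    rw [← ENNReal.ofReal_add (Real.exp_pos _).le (by positivity)]
    refine ENNReal.ofReal_le_ofReal ?_
    have h4 : Real.exp (-(β t / 2)) =
        3 * (δ / 2) / (t ^ 2 * (2 * Real.pi ^ 2)) * (τ t ^ d)⁻¹ :=
      exp_neg_betaConvex hδ2 h1 ht'.1
    have h5 : 1 ≤ τ t ^ d := one_le_pow₀ (hτ1 t ht'.1)
    have h6 : (⌊τ t⌋₊ : ℝ) ^ d ≤ τ t ^ d := by
      gcongr
      exact Nat.floor_le (zero_le_one.trans (hτ1 t ht'.1))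
    simp only [Finset.sum_const, Finset.card_univ, Fintype.card_pi, Fintype.card_fin,
      Finset.prod_const, nsmul_eq_mul, Nat.cast_pow, h4]
    -- There are `1 + ⌊τ t⌋^d` events, at most `2 τ^d`, and the factor `τ^(-d)` in `exp(-β_t/2)`
    -- cancels their number.
    calc 3 * (δ / 2) / (t ^ 2 * (2 * Real.pi ^ 2)) * (τ t ^ d)⁻¹ + (⌊τ t⌋₊ : ℝ) ^ d *
          (3 * (δ / 2) / (t ^ 2 * (2 * Real.pi ^ 2)) * (τ t ^ d)⁻¹)
        ≤ τ t ^ d * (3 * (δ / 2) / (t ^ 2 * (2 * Real.pi ^ 2)) * (τ t ^ d)⁻¹) + τ t ^ d *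
          (3 * (δ / 2) / (t ^ 2 * (2 * Real.pi ^ 2)) * (τ t ^ d)⁻¹) := by
          have he : 0 ≤ 3 * (δ / 2) / (t ^ 2 * (2 * Real.pi ^ 2)) * (τ t ^ d)⁻¹ := by
            rw [← h4]
            exact (Real.exp_pos _).le
          exact add_le_add (le_mul_of_one_le_left he h5) (mul_le_mul_of_nonneg_right h6 he)
      _ = 3 * (δ / 2) / Real.pi ^ 2 * (1 / (t : ℝ) ^ 2) := by
          field_simp
          norm_num
  refine ⟨(⋃ t ∈ Finset.Icc 1 T, {ω | gaussNoiseBound σ T (δ / 2) < |ε t ω|}) ∪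
    (E ∪ ⋃ t ∈ Finset.Icc 1 T, G t), ?_, ?_⟩
  · have h2 : P (⋃ t ∈ Finset.Icc 1 T, G t) ≤ ENNReal.ofReal (δ / 4) := by
      refine (measure_biUnion_finset_le _ _).trans ((Finset.sum_le_sum hG).trans ?_)
      rw [← ENNReal.ofReal_sum_of_nonneg fun _ _ => by positivity]
      refine ENNReal.ofReal_le_ofReal ?_
      rw [← Finset.mul_sum]
      have hpi := Real.pi_pos
      calc 3 * (δ / 2) / Real.pi ^ 2 * ∑ t ∈ Finset.Icc 1 T, 1 / (t : ℝ) ^ 2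
          ≤ 3 * (δ / 2) / Real.pi ^ 2 * (Real.pi ^ 2 / 6) := by
            gcongr
            exact sum_inv_sq_le T
        _ = δ / 4 := by
            field_simp
            norm_num
    -- The budget is `δ/2` for the noise, `δ/8` for the derivatives and `δ/4` for the confidence
    -- bounds.
    calc _ ≤ ENNReal.ofReal (δ / 2) + (ENNReal.ofReal (δ / 2 / 4) + ENNReal.ofReal (δ / 4)) :=
          (measure_union_le _ _).trans (add_le_add
            (h.measure_noise_gt_le hσ hδ2 (by linarith) hT)
            ((measure_union_le _ _).trans (add_le_add hE h2)))
      _ ≤ ENNReal.ofReal δ := by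
          rw [← ENNReal.ofReal_add (by positivity) (by positivity),
            ← ENNReal.ofReal_add (by positivity) (by positivity)]
          exact ENNReal.ofReal_le_ofReal (by linarith)
  have hzero : ∀ᵐ ω ∂P, (∀ z, k z z ≤ 0) → ∀ z, f ω z = 0 := by
    by_cases hk0 : ∀ z, k z z ≤ 0
    · filter_upwards [h.ae_eq_zero hfc hk0] with ω hω _ using hω
    · exact ae_of_all _ fun ω h => absurd h hk0
  filter_upwards [hmod, hzero] with ω hω hω0 hωE
  have hgood : ∀ t ∈ Finset.Icc 1 T, ω ∉ G t := fun t ht hcon =>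
    hωE (Or.inr (Or.inr (Set.mem_biUnion (Finset.mem_coe.2 ht) hcon)))
  have hωmod := hω fun hcon => hωE (Or.inr (Or.inl hcon))
  have hconf : IsConfident sel k σ β T (f ω) (Y ω) := fun t ht => by
    by_contra hcon
    exact hgood t ht (Or.inl (not_le.1 hcon))
  refine ⟨fun t ht => ?_, hconf, ?_⟩
  · by_contra hcon
    exact hωE (Or.inl (Set.mem_biUnion (Finset.mem_coe.2 ht) (not_le.1 hcon)))
  have hκ0 : 0 ≤ κ := (abs_nonneg _).trans (hκ ⟨_, hne.some_mem⟩ ⟨_, hne.some_mem⟩)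
  rcases hCk with hk0 | ⟨z, hz, hCz⟩
  · have h2 : regret (f ω) (q (Y ω)) T = 0 := by
      simp [regret, hω0 hk0]
    exact h2.trans_le (by positivity)
  -- The comparison goes through the representative of the cell of `z`. Rounding `τ` down costs at
  -- most a factor `2`, hence `η = 2` and a total excess of `4`.
  have hreg := regret_le (f := f ω) (x := q (Y ω)) (T := T) (η := 2) hk hσ hκ hβ zero_le_two
    fun t ht z => by
      have ht' := (Finset.mem_Icc.1 ht).1
      have ht0 : (0 : ℝ) < t := by exact_mod_cast ht'
      obtain ⟨c, hc⟩ := hp t ht'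
      have hM0 : (0 : ℝ) < ⌊τ t⌋₊ := by exact_mod_cast hM t ht'
      have h2 : f ω z - f ω (p t (c z)) ≤ d * (b * Λ) * (r / ⌊τ t⌋₊) := (abs_le.1 (hωmod z (p t (c z)) (r / ⌊τ t⌋₊) (by positivity) (hc z))).2
      have h3 : |f ω (p t (c z)) - gpMean k σ (q (Y ω)) (Y ω) (Finset.Icc 1 (t - 1))
          (p t (c z))| ≤ √(β t) * gpSd k σ (q (Y ω)) (Finset.Icc 1 (t - 1)) (p t (c z)) := by
        by_contra hcon
        exact hgood t ht (Or.inr (Set.mem_biUnion (Finset.mem_coe.2 (Finset.mem_univ (c z)))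
          (not_le.1 hcon)))
      have h4 : f ω (p t (c z)) - f ω (q (Y ω) t) ≤ 2 * √(β t) *
          gpSd k σ (q (Y ω)) (Finset.Icc 1 (t - 1)) (q (Y ω) t) + 0 := gap_le (z := p t (c z)) (ρ := 0) hkc hsel hconf ht (by
        change _ ≤ ucb k σ β (q (Y ω)) (Y ω) (t - 1) (p t (c z)) + 0
        rw [ucb, Nat.sub_add_cancel ht', add_zero]
        linarith [(abs_le.1 h3).2])
      have h5 : d * (b * Λ) * (r / ⌊τ t⌋₊) ≤ 2 / (t : ℝ) ^ 2 := by
        have h6 : τ t ≤ 2 * ⌊τ t⌋₊ := by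
          have := Nat.lt_floor_add_one (τ t)
          have h7 : (1 : ℝ) ≤ ⌊τ t⌋₊ := by exact_mod_cast hM t ht'
          linarith
        rw [mul_div_assoc', div_le_div_iff₀ hM0 (by positivity)]
        calc d * (b * Λ) * r * t ^ 2 = τ t := by
              rw [hτ]
              ring
          _ ≤ 2 * ⌊τ t⌋₊ := h6
      linarith
  have h2 := le_mul_sqrt_of_pos_variance hk hσ hκ hC hz hCz hT
    (one_le_two.trans (two_le_betaConvex hδ2 (by linarith) h1 hT))
  refine hreg.trans ?_
  rw [add_mul]
  refine add_le_add le_rfl ?_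
  linarith

end Convex

/-! ### Constants and the RKHS instance -/

section Settings

variable {X : Type*}

lemma exists_le_mul_sqrt_log (k : X → X → ℝ) {σ : ℝ} (hσ : 0 < σ) :
    ∃ C : ℝ, 0 ≤ C ∧ ((∀ z, k z z ≤ 0) ∨
      ∃ z, 0 < k z z ∧ 4 ≤ C * √(1 / 2 * Real.log (1 + k z z / σ ^ 2))) := by
  by_cases h : ∃ z, 0 < k z z
  · obtain ⟨z, hz⟩ := h
    have h1 : 0 < Real.log (1 + k z z / σ ^ 2) :=
      Real.log_pos (lt_add_of_pos_right 1 (by positivity))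
    exact ⟨4 / √(1 / 2 * Real.log (1 + k z z / σ ^ 2)), by positivity, Or.inr ⟨z, hz, by
      rw [div_mul_cancel₀ _ (by positivity)]⟩⟩
  · exact ⟨0, le_rfl, Or.inl fun z => not_lt.1 fun hz => h ⟨z, hz⟩⟩

lemma zeroCost_kernel [TopologicalSpace X] [CompactSpace X] [TopologicalSpace.MetrizableSpace X]
    [Nonempty X] [MeasurableSpace X] [BorelSpace X] {k : X → X → ℝ} {κ σ : ℝ} (hσ : 0 < σ)
    (hκ : ∀ z z', |k z z'| ≤ κ) (hkc : Continuous fun p : X × X => k p.1 p.2)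
    {H : Type*} [NormedAddCommGroup H] [InnerProductSpace ℝ H] [CompleteSpace H] [RKHS ℝ H X ℝ]
    (hk : ∀ z z', RKHS.kernel H z z' 1 = k z z') {f : H} {Bf : ℝ} (hf : ‖f‖ ^ 2 ≤ Bf) {δ : ℝ}
    (hδ : 0 < δ) (hδ1 : δ < 1) {Ω : Type*} [MeasurableSpace Ω] {P : Measure Ω}
    [IsProbabilityMeasure P] {ε : ℕ → Ω → ℝ} (hε : IsBoundedNoise P σ ε) (T : ℕ) :
    ZeroCost P k κ σ δ σ (betaRKHS k σ Bf (δ / 2)) T (fun _ => ⇑f) ε √(8 * (σ ^ 2 + κ)) := by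
  let _ := TopologicalSpace.metrizableSpaceMetric X
  have hφ : ∀ z z', k z z' = inner ℝ (RKHS.kerFun H z 1) (RKHS.kerFun H z' 1) := fun z z' => by
    rw [real_inner_comm, ← RKHS.kernel_inner, hk]
    simp
  have hfφ : (⇑f : X → ℝ) = fun z => inner ℝ (RKHS.kerFun H z 1) f := funext fun z => by
    rw [RKHS.kerFun_inner]
    simp
  have hc : Continuous fun z => inner ℝ (RKHS.kerFun H z 1) f :=
    (continuous_featureMap hφ hkc).inner continuous_const
  rw [hfφ]
  exact zeroCost_rkhs hφ hσ hκ hkc hkc.measurable hc.measurable hf hδ hδ1 hε T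

end Settings

end
end RCGP

theorem theorem1 :
    -- finite domain, `f` a sample of a Gaussian process
    (∀ κ σ : ℝ, 0 < σ → ∃ C : ℝ,
      ∀ (X : Type*) [Fintype X] [Nonempty X] [TopologicalSpace X] [DiscreteTopology X]
        [MeasurableSpace X] [BorelSpace X] (k : X → X → ℝ), (∀ z z', |k z z'| ≤ κ) →
      ∀ δ : ℝ, 0 < δ → δ < 1 →
      ∀ (Ω : Type*) [MeasurableSpace Ω] (P : Measure Ω) [IsProbabilityMeasure P]
        (f : Ω → X → ℝ) (ε : ℕ → Ω → ℝ), RCGP.IsGPSample P k σ f ε →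
      ∀ T : ℕ, 1 ≤ T →
        RCGP.ZeroCost P k κ σ δ (RCGP.gaussNoiseBound σ T (δ / 2))
          (RCGP.betaFinite (Fintype.card X) (δ / 2)) T f ε C) ∧
    -- compact convex domain, `f` a sample of a Gaussian process with smooth paths
    (∀ (d : ℕ) (r : ℝ) (D : Set (EuclideanSpace ℝ (Fin d))), 0 < r →
      D.Nonempty → IsCompact D → Convex ℝ D → (∀ z ∈ D, ∀ j, 0 ≤ z j ∧ z j ≤ r) →
      ∀ (k : D → D → ℝ) (κ σ a b δ : ℝ), Continuous (fun p : D × D => k p.1 p.2) →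
      (∀ z z', |k z z'| ≤ κ) → 0 < σ → 0 < a → 0 < b → 0 < δ → δ < 1 →
      1 ≤ d * b * r * √(Real.log (4 * d * a / (δ / 2))) →
      ∃ C : ℝ,
      ∀ (Ω : Type*) [MeasurableSpace Ω] (P : Measure Ω) [IsProbabilityMeasure P]
        (f : Ω → D → ℝ) (ε : ℕ → Ω → ℝ), RCGP.IsGPSample P k σ f ε →
        RCGP.HasDerivTails P D f a b →
      ∀ T : ℕ, 1 ≤ T →
        RCGP.ZeroCost P k κ σ δ (RCGP.gaussNoiseBound σ T (δ / 2))
          (RCGP.betaConvex d a b r (δ / 2)) T f ε C) ∧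
    -- compact domain, `f` an arbitrary function in the RKHS of `k`
    (∀ κ σ : ℝ, 0 < σ → ∃ C : ℝ,
      ∀ (X : Type*) [TopologicalSpace X] [CompactSpace X] [TopologicalSpace.MetrizableSpace X]
        [Nonempty X] [MeasurableSpace X] [BorelSpace X] (k : X → X → ℝ),
      Continuous (fun p : X × X => k p.1 p.2) → (∀ z z', |k z z'| ≤ κ) →
      ∀ (H : Type*) [NormedAddCommGroup H] [InnerProductSpace ℝ H] [CompleteSpace H]
        [RKHS ℝ H X ℝ], (∀ z z', RKHS.kernel H z z' 1 = k z z') →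
      ∀ (f : H) (Bf : ℝ), ‖f‖ ^ 2 ≤ Bf →
      ∀ δ : ℝ, 0 < δ → δ < 1 →
      ∀ (Ω : Type*) [MeasurableSpace Ω] (P : Measure Ω) [IsProbabilityMeasure P]
        (ε : ℕ → Ω → ℝ), RCGP.IsBoundedNoise P σ ε →
      ∀ T : ℕ, 1 ≤ T →
        RCGP.ZeroCost P k κ σ δ σ (RCGP.betaRKHS k σ Bf (δ / 2)) T (fun _ => ⇑f) ε C) := by
  refine ⟨fun κ σ hσ => ⟨√(8 * (σ ^ 2 + κ)), ?_⟩, ?_, fun κ σ hσ => ⟨√(8 * (σ ^ 2 + κ)), ?_⟩⟩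
  · intro X _ _ _ _ _ _ k hκ δ hδ hδ1 Ω _ P _ f ε h T hT
    exact RCGP.zeroCost_finite hσ hκ hδ hδ1 h hT
  · intro d r D hr hne hDc hD hDr k κ σ a b δ hkc hκ hσ ha hb hδ hδ1 h1
    obtain ⟨C, hC, hCk⟩ := RCGP.exists_le_mul_sqrt_log k hσ
    -- `C` is fixed from the kernel and `σ` before the probability space, the sample and the horizon
    -- appear.
    refine ⟨√(8 * (σ ^ 2 + κ)) + C, ?_⟩
    intro Ω _ P _ f ε h hder T hT
    exact RCGP.zeroCost_convex hr hne hDc hD hDr hkc hκ hσ ha hb hδ hδ1 h1 h hder hT hC hCk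
  · intro X _ _ _ _ _ _ k hkc hκ H _ _ _ _ hk f Bf hBf δ hδ hδ1 Ω _ P _ ε hε T _
    exact RCGP.zeroCost_kernel hσ hκ hkc hk hBf hδ hδ1 hε T
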